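/- Let $M$ be a smooth (Hausdorff, second countable) manifold, $E\to M$ a smooth real vector bundle of finite rank carrying a Lie algebroid structure with anchor $\rho:E\to TM$ and bracket $[\cdot,\cdot]$ on $\Gamma(E)$, and let $S$ be a smooth symmetric section of $E^*\otimes E^*$, with $S^\sharp:E\to E^*$, $a\mapsto S(a,\cdot)$. Let $d\in\mathbb N$. In a local basis $(b_I)$ of $E$ write $[b_I,b_J]=c_{IJ}{}^K b_K$. For a smooth $d$-manifold $\Sigma$, a smooth vector bundle morphism $\varphi=(X,A):T\Sigma\to E$ (base map $X$, components $A^I$) is a *solution* if $$dX=\rho(A),\qquad dA^I+\tfrac12 c_{JK}{}^I A^J\wedge A^K=0 .$$ Its metric is $g=\tfrac12 S_{IJ}A^IA^J$ with $A^IA^J=A^I\otimes A^J+A^J\otimes A^I$, i.e. $g(u,w)=S(A(u),A(w))$; the solution is *non-degenerate* if $g$ is non-degenerate at every point. A section $\varepsilon\in\Gamma(X^*E)$ generates the infinitesimal gauge transformation $$\delta_\varepsilon X=\rho(\varepsilon),\qquad \delta_\varepsilon A^I=d\varepsilon^I+c_{KJ}{}^I A^K\varepsilon^J ,$$ and $\delta_\varepsilon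 g$ denotes the induced variation of $g$. Call $(\Sigma,g)$ *maximally extended* if $\Sigma$ is compact or no geodesic of finite affine length runs off $\Sigma$ at a regular place, that is: whenever $\gamma:(0,1)\to\Sigma$ is an affinely parametrized geodesic of $g$, $U$ an open neighbourhood of its image, $h$ a smooth non-degenerate metric on $\mathbb R^d$ and $f:U\to\mathbb R^d$ a smooth map with $f^*h=g|_U$ such that $f(\gamma(t))$ converges in $\mathbb R^d$ as $t\to1$, then $\gamma(t)$ converges in $\Sigma$ as $t\to 1$. (This holds, for instance, if $g$ is geodesically complete, or if some curvature scalar is unbounded along every geodesic that cannot be continued in $\Sigma$ to infinite affine length.) Two solutions on $\Sigma$ are *gauge equivalent* if they are joined by a smooth path $(\varphi_t)_{t\in[0,1]}$ of non-degenerate solutions with maximally extended metrics satisfying $\frac{d}{dt}\varphi_t=\delta_{\varepsilon_t}\varphi_t$ for a smooth family $\varepsilon_t\in\Gamma(X_t^*E)$. **Theorem.** Suppose that $\dim \operatorname{im}S^\sharp_x=d$ for every $x\in M$ and that ${}^E\mathcal L_\psi S=0$ for every section $\psi$ of $\ker S^\sharp$, where $({}^E\mathcal L_\psi S)(a,b)=\rho(\psi)\big(S(a,b)\big)-S([\psi,a],b)-S(a,[\psi,b])$.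 Then $(E,S)$ defines a reasonable theory of $E$-gravity in dimension $d$: 1. for every $X_0\in M$ there is a non-degenerate solution on $\Sigma=\mathbb R^d$ whose base map has $X_0$ in its image; 2. if two solutions on a smooth $d$-manifold $\Sigma$ (Hausdorff, second countable) with metrics $g_{(1)},g_{(2)}$ are gauge equivalent, there is a diffeomorphism $D:\Sigma\to\Sigma$ with $g_{(1)}=D^*g_{(2)}$. Moreover, for every smooth $d$-manifold $\Sigma$ (Hausdorff, second countable) and every solution $\varphi=(X,A)$ on it, without any assumption of maximal extension: 3. if $\varphi$ is non-degenerate, then for every $\varepsilon\in\Gamma(X^*E)$ there is a smooth vector field $v$ on $\Sigma$ with $\delta_\varepsilon g=\mathcal L_v g$; 4. $\delta_\varepsilon g=0$ for every section $\varepsilon$ of $X^*\ker S^\sharp$. -/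

import Mathlib

open Bundle Set Filter Topology Module
open scoped Manifold ContDiff

universe u

noncomputable section

namespace EGravity

/-! ### Lie algebroids, frames, tensors -/

section Target

variable (m : ℕ) (M : Type*) [TopologicalSpace M] [ChartedSpace (EuclideanSpace ℝ (Fin m)) M]
  [IsManifold (𝓡 m) ∞ M]
  (F : Type*) [NormedAddCommGroup F] [NormedSpace ℝ F]
  (E : M → Type*) [TopologicalSpace (TotalSpace F E)] [∀ x, TopologicalSpace (E x)]
  [∀ x, AddCommGroup (E x)] [∀ x, Module ℝ (E x)] [FiberBundle F E] [VectorBundle ℝ F E]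

/-- The space `Γ(E)` of smooth sections of the vector bundle `E → M`. -/
abbrev Sec := Cₛ^∞⟮𝓡 m; F, E⟯

/-- A Lie algebroid structure on the vector bundle `E → M`: a smooth bundle map `ρ : E → TM` (the
anchor) and a Lie bracket on `Γ(E)` with `[ψ, f ψ'] = f [ψ, ψ'] + (ρ(ψ) f) ψ'`. -/
structure LieAlgebroid where
  /-- the anchor -/
  anchor : ∀ x : M, E x →ₗ[ℝ] TangentSpace (𝓡 m) x
  anchor_smooth : ContMDiff ((𝓡 m).prod 𝓘(ℝ, F)) (𝓡 m).tangent ∞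
    (fun p : TotalSpace F E => (⟨p.1, anchor p.1 p.2⟩ : TangentBundle (𝓡 m) M))
  /-- the bracket of sections -/
  bracket : Sec m M F E →ₗ[ℝ] Sec m M F E →ₗ[ℝ] Sec m M F E
  bracket_self : ∀ a, bracket a a = 0
  jacobi : ∀ a b c, bracket a (bracket b c) = bracket (bracket a b) c + bracket b (bracket a c)
  /-- the Leibniz identity; `b'` is the section `f b` -/
  leibniz : ∀ (a b b' : Sec m M F E) (f : M → ℝ), ContMDiff (𝓡 m) 𝓘(ℝ, ℝ) ∞ f →
    (∀ x, b' x = f x • b x) → ∀ x,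
      bracket a b' x = f x • bracket a b x + (mvfderiv (𝓡 m) f x (anchor x (a x))) • b x

/-- A smooth symmetric section `S` of `E* ⊗ E*`. The linear map `S x : E x → (E x)*` is `S^♯`. -/
structure SymTensor where
  /-- the bilinear form on each fibre -/
  form : ∀ x : M, E x →ₗ[ℝ] E x →ₗ[ℝ] ℝ
  symm : ∀ x a b, form x a b = form x b a
  smooth : ∀ a b : Sec m M F E, ContMDiff (𝓡 m) 𝓘(ℝ, ℝ) ∞ (fun x => form x (a x) (b x))

/-- A local basis `(b_I)` of `E` over an open set `dom`; the `b_I` are restrictions to `dom` of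
global sections (such local bases exist around every point), so that they can be bracketed. -/
structure Frame where
  /-- the sections `b_I` -/
  sec : Fin (finrank ℝ F) → Sec m M F E
  /-- the domain -/
  dom : Set M
  isOpen_dom : IsOpen dom
  isFrame : IsLocalFrameOn (𝓡 m) F ∞ (fun i x => sec i x) dom

end Target

section TargetOps

variable {m : ℕ} {M : Type*} [TopologicalSpace M] [ChartedSpace (EuclideanSpace ℝ (Fin m)) M]
  [IsManifold (𝓡 m) ∞ M]
  {F : Type*} [NormedAddCommGroup F] [NormedSpace ℝ F]
  {E : M → Type*} [TopologicalSpace (TotalSpace F E)] [∀ x, TopologicalSpace (E x)]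
  [∀ x, AddCommGroup (E x)] [∀ x, Module ℝ (E x)] [FiberBundle F E] [VectorBundle ℝ F E]

/-- The `I`-th component `e^I` of `e ∈ E x` in the local basis; meaningful for `x ∈ dom`. -/
def Frame.comp (b : Frame m M F E) (i : Fin (finrank ℝ F)) (x : M) : E x →ₗ[ℝ] ℝ :=
  b.isFrame.coeff i x

/-- The structure functions `c_{IJ}^K` in `[b_I, b_J] = c_{IJ}^K b_K`. -/
def LieAlgebroid.structureFun (L : LieAlgebroid m M F E) (b : Frame m M F E)
    (i j k : Fin (finrank ℝ F)) (x : M) : ℝ :=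
  b.comp k x (L.bracket (b.sec i) (b.sec j) x)

/-- The components `S_{IJ}`. -/
def SymTensor.comp (S : SymTensor m M F E) (b : Frame m M F E)
    (i j : Fin (finrank ℝ F)) (x : M) : ℝ :=
  S.form x (b.sec i x) (b.sec j x)

/-- The `E`-Lie derivative of `S` along `ψ`, evaluated on sections:
`(L_ψ S)(a, b) = ρ(ψ)(S(a, b)) - S([ψ, a], b) - S(a, [ψ, b])`. -/
def LieAlgebroid.lieDeriv (L : LieAlgebroid m M F E) (ψ : Sec m M F E) (S : SymTensor m M F E)
    (a b : Sec m M F E) (x : M) : ℝ :=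
  mvfderiv (𝓡 m) (fun y => S.form y (a y) (b y)) x (L.anchor x (ψ x))
    - S.form x (L.bracket ψ a x) (b x) - S.form x (a x) (L.bracket ψ b x)

/-- `S` is invariant under the `E`-Lie derivative along every section of `ker S^♯`. -/
def LieAlgebroid.KernelInvariant (L : LieAlgebroid m M F E) (S : SymTensor m M F E) : Prop :=
  ∀ ψ : Sec m M F E, (∀ x, S.form x (ψ x) = 0) →
    ∀ (a b : Sec m M F E) (x : M), L.lieDeriv ψ S a b x = 0

end TargetOps

/-! ### Metrics on the spacetime manifold `W` -/

section Metric

variable {d : ℕ} {W : Type*} [TopologicalSpace W] [ChartedSpace (EuclideanSpace ℝ (Fin d)) W]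

/-- The tangent vector of `W` with components `u` in the coordinates of the preferred chart at
`x₀`, at the point with coordinates `y`. -/
def coordVec (x₀ : W) (y u : EuclideanSpace ℝ (Fin d)) :
    TangentSpace (𝓡 d) ((extChartAt (𝓡 d) x₀).symm y) :=
  mfderiv 𝓘(ℝ, EuclideanSpace ℝ (Fin d)) (𝓡 d) (extChartAt (𝓡 d) x₀).symm y u

variable (d W) in
/-- A field of bilinear forms on the tangent spaces of `W`. -/
abbrev BilinField := ∀ x : W, TangentSpace (𝓡 d) x → TangentSpace (𝓡 d) x → ℝ

/-- Everywhere non-degenerate. -/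
def NonDegenerate (g : BilinField d W) : Prop :=
  ∀ (x : W) (v : TangentSpace (𝓡 d) x), (∀ w, g x v w = 0) → v = 0

/-- The coordinate expression of `g` in the chart at `x₀`. -/
def chartForm (g : BilinField d W) (x₀ : W) (y u w : EuclideanSpace ℝ (Fin d)) : ℝ :=
  g ((extChartAt (𝓡 d) x₀).symm y) (coordVec x₀ y u) (coordVec x₀ y w)

/-- The coordinate expression of a vector field in the chart at `x₀`. -/
def chartField (v : ∀ x : W, TangentSpace (𝓡 d) x) (x₀ : W) (y : EuclideanSpace ℝ (Fin d)) :
    EuclideanSpace ℝ (Fin d) :=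
  mfderiv (𝓡 d) 𝓘(ℝ, EuclideanSpace ℝ (Fin d)) (extChartAt (𝓡 d) x₀)
    ((extChartAt (𝓡 d) x₀).symm y) (v ((extChartAt (𝓡 d) x₀).symm y))

/-- The Lie derivative `L_v g`, computed at `x` in the chart at `x`:
`v^k ∂_k g(∂_i, ∂_j) + g(∂_i v, ∂_j) + g(∂_i, ∂_j v)`. The vectors `u`, `w` are given by their
components in the chart at `x`. -/
def lieDerivMetric (v : ∀ x : W, TangentSpace (𝓡 d) x) (g : BilinField d W) (x : W)
    (u w : EuclideanSpace ℝ (Fin d)) : ℝ :=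
  let y := extChartAt (𝓡 d) x x
  fderiv ℝ (fun z => chartForm g x z u w) y (chartField v x y)
    + chartForm g x y (fderiv ℝ (chartField v x) y u) w
    + chartForm g x y u (fderiv ℝ (chartField v x) y w)

/-- `γ` is, on the parameter interval `(0, 1)`, an affinely parametrised geodesic of `g`: in the
chart at each of its points, `d/dt (g_{jk} γ'^j) = ½ ∂_k g_{ij} γ'^i γ'^j`. -/
def IsGeodesic (g : BilinField d W) (γ : ℝ → W) : Prop :=
  ContMDiffOn 𝓘(ℝ, ℝ) (𝓡 d) ∞ γ (Ioo 0 1) ∧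
  ∀ t ∈ Ioo (0 : ℝ) 1,
    let c : ℝ → EuclideanSpace ℝ (Fin d) := fun s => extChartAt (𝓡 d) (γ t) (γ s)
    ∀ w : EuclideanSpace ℝ (Fin d),
      HasDerivAt (fun s => chartForm g (γ t) (c s) (deriv c s) w)
        (2⁻¹ * fderiv ℝ (fun y => chartForm g (γ t) y (deriv c t) (deriv c t)) (c t) w) t

/-- `(W, g)` is maximally extended: `W` is compact, or no geodesic of finite affine length runs off
`W` at a regular place. That is: let `γ : (0, 1) → W` be a geodesic for which some neighbourhood
`U` of it is mapped by a local isometry `f` into `ℝᵈ`, equipped with some smooth non-degenerate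
metric `h`, in such a way that `f ∘ γ` has an endpoint `y` in `ℝᵈ`; then `γ` has an endpoint
in `W`. Geodesically complete metrics have this property, and so do those all of whose incomplete
geodesics run into curvature singularities. -/
def MaximallyExtended (g : BilinField d W) : Prop :=
  CompactSpace W ∨
  ∀ γ : ℝ → W, IsGeodesic g γ →
    ∀ U : Set W, IsOpen U → γ '' Ioo 0 1 ⊆ U →
    ∀ f : W → EuclideanSpace ℝ (Fin d),
      ContMDiffOn (𝓡 d) 𝓘(ℝ, EuclideanSpace ℝ (Fin d)) ∞ f U →
    ∀ h : EuclideanSpace ℝ (Fin d) →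
        EuclideanSpace ℝ (Fin d) →L[ℝ] EuclideanSpace ℝ (Fin d) →L[ℝ] ℝ,
      ContDiff ℝ ∞ h → (∀ y u w, h y u w = h y w u) →
      (∀ y u, (∀ w, h y u w = 0) → u = 0) →
      (∀ x ∈ U, ∀ u w : TangentSpace (𝓡 d) x,
        h (f x) (mfderiv (𝓡 d) 𝓘(ℝ, EuclideanSpace ℝ (Fin d)) f x u)
          (mfderiv (𝓡 d) 𝓘(ℝ, EuclideanSpace ℝ (Fin d)) f x w) = g x u w) →
    ∀ y, Tendsto (fun t => f (γ t)) (𝓝[<] 1) (𝓝 y) → ∃ x, Tendsto γ (𝓝[<] 1) (𝓝 x)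

end Metric

/-! ### Fields, field equations, gauge symmetries -/

section Fields

variable (d : ℕ) (W : Type*) [TopologicalSpace W] [ChartedSpace (EuclideanSpace ℝ (Fin d)) W]
  [IsManifold (𝓡 d) ∞ W]
  (m : ℕ) (M : Type*) [TopologicalSpace M] [ChartedSpace (EuclideanSpace ℝ (Fin m)) M]
  [IsManifold (𝓡 m) ∞ M]
  (F : Type*) [NormedAddCommGroup F] [NormedSpace ℝ F]
  (E : M → Type*) [TopologicalSpace (TotalSpace F E)] [∀ x, TopologicalSpace (E x)]
  [∀ x, AddCommGroup (E x)] [∀ x, Module ℝ (E x)] [FiberBundle F E] [VectorBundle ℝ F E]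

/-- The fields `(X, A)`: a smooth vector bundle morphism `φ : TW → E`, with base map `X` and
fibrewise linear part `A`. -/
structure FieldConfig where
  /-- the base map `X` -/
  base : W → M
  /-- the `E`-valued one-form `A` -/
  form : ∀ x : W, TangentSpace (𝓡 d) x →ₗ[ℝ] E (base x)
  smooth : ContMDiff (𝓡 d).tangent ((𝓡 m).prod 𝓘(ℝ, F)) ∞
    (fun p : TangentBundle (𝓡 d) W => (⟨base p.1, form p.1 p.2⟩ : TotalSpace F E))

end Fields

section FieldOps

variable {d : ℕ} {W : Type*} [TopologicalSpace W] [ChartedSpace (EuclideanSpace ℝ (Fin d)) W]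
  [IsManifold (𝓡 d) ∞ W]
  {m : ℕ} {M : Type*} [TopologicalSpace M] [ChartedSpace (EuclideanSpace ℝ (Fin m)) M]
  [IsManifold (𝓡 m) ∞ M]
  {F : Type*} [NormedAddCommGroup F] [NormedSpace ℝ F]
  {E : M → Type*} [TopologicalSpace (TotalSpace F E)] [∀ x, TopologicalSpace (E x)]
  [∀ x, AddCommGroup (E x)] [∀ x, Module ℝ (E x)] [FiberBundle F E] [VectorBundle ℝ F E]

/-- The components `A^I` of `A` at `x ∈ W`, defined where `X(x)` lies in the domain of the frame. -/
def FieldConfig.comp (φ : FieldConfig d W m M F E) (b : Frame m M F E) (i : Fin (finrank ℝ F)) (x : W)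
    (u : TangentSpace (𝓡 d) x) : ℝ :=
  b.comp i (φ.base x) (φ.form x u)

/-- The coefficient functions of the one-form `A^I` in the chart at `x₀`, contracted with a
constant vector `u`. -/
def FieldConfig.chartComp (φ : FieldConfig d W m M F E) (b : Frame m M F E) (i : Fin (finrank ℝ F)) (x₀ : W)
    (u y : EuclideanSpace ℝ (Fin d)) : ℝ :=
  φ.comp b i ((extChartAt (𝓡 d) x₀).symm y) (coordVec x₀ y u)

/-- The field equations `dX^i = ρ^i_I A^I` and `dA^I + ½ c_{JK}^I A^J ∧ A^K = 0`. The second one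
is written at each `x ∈ W` in the chart at `x`, in every local basis of `E` around `X(x)`:
`u^μ w^ν (∂_μ A^I_ν - ∂_ν A^I_μ + c_{JK}^I A^J_μ A^K_ν) = 0`. -/
def FieldConfig.IsSolution (L : LieAlgebroid m M F E) (φ : FieldConfig d W m M F E) : Prop :=
  (∀ (x : W) (u : TangentSpace (𝓡 d) x),
    mfderiv (𝓡 d) (𝓡 m) φ.base x u = L.anchor (φ.base x) (φ.form x u)) ∧
  ∀ (b : Frame m M F E) (x : W), φ.base x ∈ b.dom →
    ∀ (i : Fin (finrank ℝ F)) (u w : EuclideanSpace ℝ (Fin d)),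
      let y := extChartAt (𝓡 d) x x
      fderiv ℝ (φ.chartComp b i x w) y u - fderiv ℝ (φ.chartComp b i x u) y w
        + ∑ j, ∑ k, L.structureFun b j k i (φ.base x)
            * φ.comp b j x u * φ.comp b k x w = 0

/-- The metric `g = ½ S_{IJ} A^I A^J`. The product of one-forms is `A^I A^J = A^I ⊗ A^J + A^J ⊗ A^I`,
so that `g(u, w) = S(A(u), A(w))`. -/
def FieldConfig.metric (S : SymTensor m M F E) (φ : FieldConfig d W m M F E) : BilinField d W :=
  fun x u w => S.form (φ.base x) (φ.form x u) (φ.form x w)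

/-- A smooth section of the pullback bundle `X^* E`. -/
structure FieldConfig.GaugeParameter (φ : FieldConfig d W m M F E) where
  /-- the section -/
  val : ∀ x : W, E (φ.base x)
  smooth : ContMDiff (𝓡 d) ((𝓡 m).prod 𝓘(ℝ, F)) ∞
    (fun x => (⟨φ.base x, val x⟩ : TotalSpace F E))

/-- The gauge variation `δ_ε A^I = dε^I + c_{KJ}^I A^K ε^J` of `A^I`, contracted with a tangent
vector `u` at `x`. (The variation of `X` is `δ_ε X = ρ(ε)`.) -/
def FieldConfig.gaugeVar (L : LieAlgebroid m M F E) (φ : FieldConfig d W m M F E) (ε : ∀ x, E (φ.base x))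
    (b : Frame m M F E) (i : Fin (finrank ℝ F)) (x : W) (u : TangentSpace (𝓡 d) x) : ℝ :=
  mvfderiv (𝓡 d) (fun z => b.comp i (φ.base z) (ε z)) x u
    + ∑ k, ∑ j, L.structureFun b k j i (φ.base x) * φ.comp b k x u * b.comp j (φ.base x) (ε x)

/-- The gauge variation `δ_ε g` of `g = S_{IJ}(X) A^I ⊗ A^J`, from the variations
`δ_ε X = ρ(ε)` and `δ_ε A^I` by the Leibniz rule, in a local basis of `E` around `X(x)`. -/
def FieldConfig.metricVar (L : LieAlgebroid m M F E) (S : SymTensor m M F E) (φ : FieldConfig d W m M F E)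
    (ε : ∀ x, E (φ.base x)) (b : Frame m M F E) (x : W) (u w : TangentSpace (𝓡 d) x) : ℝ :=
  ∑ i, ∑ j,
    (mvfderiv (𝓡 m) (S.comp b i j) (φ.base x) (L.anchor (φ.base x) (ε x))
        * φ.comp b i x u * φ.comp b j x w
      + S.comp b i j (φ.base x) * φ.gaugeVar L ε b i x u * φ.comp b j x w
      + S.comp b i j (φ.base x) * φ.comp b i x u * φ.gaugeVar L ε b j x w)

/-- `Φ` is a smooth one-parameter family of solutions which for `t ∈ [0, 1]` is the flow of the
gauge transformations generated by the smooth family `ε t ∈ Γ(X_t^* E)`: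
`d/dt X_t = δ_{ε t} X_t` and `d/dt A_t = δ_{ε t} A_t`. -/
structure IsGaugeFlow (L : LieAlgebroid m M F E) (Φ : ℝ → FieldConfig d W m M F E)
    (ε : ∀ (t : ℝ) (x : W), E ((Φ t).base x)) : Prop where
  smooth_field : ContMDiff (𝓘(ℝ, ℝ).prod (𝓡 d).tangent) ((𝓡 m).prod 𝓘(ℝ, F)) ∞
    (fun p : ℝ × TangentBundle (𝓡 d) W =>
      (⟨(Φ p.1).base p.2.1, (Φ p.1).form p.2.1 p.2.2⟩ : TotalSpace F E))
  smooth_param : ContMDiff (𝓘(ℝ, ℝ).prod (𝓡 d)) ((𝓡 m).prod 𝓘(ℝ, F)) ∞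
    (fun p : ℝ × W => (⟨(Φ p.1).base p.2, ε p.1 p.2⟩ : TotalSpace F E))
  solution : ∀ t ∈ Icc (0 : ℝ) 1, (Φ t).IsSolution L
  deriv_base : ∀ t ∈ Icc (0 : ℝ) 1, ∀ x : W,
    mfderiv 𝓘(ℝ, ℝ) (𝓡 m) (fun s => (Φ s).base x) t (1 : ℝ) = L.anchor ((Φ t).base x) (ε t x)
  deriv_form : ∀ t ∈ Icc (0 : ℝ) 1, ∀ (b : Frame m M F E) (x : W), (Φ t).base x ∈ b.dom →
    ∀ (i : Fin (finrank ℝ F)) (u : TangentSpace (𝓡 d) x),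
      HasDerivAt (fun s => (Φ s).comp b i x u) ((Φ t).gaugeVar L (ε t) b i x u) t

/-- Gauge equivalence of metrically non-degenerate, maximally extended solutions: they are connected
by a flow of gauge transformations through solutions of this kind. -/
def GaugeEquivalent (L : LieAlgebroid m M F E) (S : SymTensor m M F E)
    (φ₁ φ₂ : FieldConfig d W m M F E) : Prop :=
  ∃ (Φ : ℝ → FieldConfig d W m M F E) (ε : ∀ (t : ℝ) (x : W), E ((Φ t).base x)),
    IsGaugeFlow L Φ ε ∧ Φ 0 = φ₁ ∧ Φ 1 = φ₂ ∧
    ∀ t ∈ Icc (0 : ℝ) 1, NonDegenerate ((Φ t).metric S) ∧ MaximallyExtended ((Φ t).metric S)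

end FieldOps

/-! ### Reasonable theories -/

section Reasonable

variable {m : ℕ} {M : Type*} [TopologicalSpace M] [ChartedSpace (EuclideanSpace ℝ (Fin m)) M]
  [IsManifold (𝓡 m) ∞ M]
  {F : Type*} [NormedAddCommGroup F] [NormedSpace ℝ F]
  {E : M → Type*} [TopologicalSpace (TotalSpace F E)] [∀ x, TopologicalSpace (E x)]
  [∀ x, AddCommGroup (E x)] [∀ x, Module ℝ (E x)] [FiberBundle F E] [VectorBundle ℝ F E]

/-- Through every point of `M` there is a solution on `ℝᵈ` with everywhere non-degenerate metric. -/
def HasNonDegenerateSolutions (d : ℕ) (L : LieAlgebroid m M F E) (S : SymTensor m M F E) : Prop :=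
  ∀ X₀ : M, ∃ φ : FieldConfig d (EuclideanSpace ℝ (Fin d)) m M F E,
    φ.IsSolution L ∧ NonDegenerate (φ.metric S) ∧ X₀ ∈ range φ.base

/-- Gauge equivalent solutions have diffeomorphic metrics. -/
def GaugeActsByDiffeos (d : ℕ) (L : LieAlgebroid m M F E) (S : SymTensor m M F E) : Prop :=
  ∀ (W : Type u) [TopologicalSpace W] [T2Space W] [SecondCountableTopology W]
    [ChartedSpace (EuclideanSpace ℝ (Fin d)) W] [IsManifold (𝓡 d) ∞ W]
    (φ₁ φ₂ : FieldConfig d W m M F E), GaugeEquivalent L S φ₁ φ₂ →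
    ∃ D : W ≃ₘ^∞⟮𝓡 d, 𝓡 d⟯ W, ∀ (x : W) (v w : TangentSpace (𝓡 d) x),
      φ₁.metric S x v w
        = φ₂.metric S (D x) (mfderiv (𝓡 d) (𝓡 d) D x v) (mfderiv (𝓡 d) (𝓡 d) D x w)

/-- `(E, S)` defines a reasonable theory of `E`-gravity in `d` spacetime dimensions. -/
def IsReasonable (d : ℕ) (L : LieAlgebroid m M F E) (S : SymTensor m M F E) : Prop :=
  HasNonDegenerateSolutions d L S ∧ GaugeActsByDiffeos.{u} d L S

/-- The infinitesimal form of the second condition: on every metrically non-degenerate solution, on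
any spacetime manifold and for every gauge parameter `ε`, there is a smooth vector field `v`
with `δ_ε g = L_v g`. -/
def GaugeActsByDiffeosInfinitesimally (d : ℕ) (L : LieAlgebroid m M F E) (S : SymTensor m M F E) :
    Prop :=
  ∀ (W : Type u) [TopologicalSpace W] [T2Space W] [SecondCountableTopology W]
    [ChartedSpace (EuclideanSpace ℝ (Fin d)) W] [IsManifold (𝓡 d) ∞ W]
    (φ : FieldConfig d W m M F E), φ.IsSolution L → NonDegenerate (φ.metric S) →
    ∀ ε : φ.GaugeParameter, ∃ v : ∀ x : W, TangentSpace (𝓡 d) x,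
      ContMDiff (𝓡 d) (𝓡 d).tangent ∞ (fun x => (⟨x, v x⟩ : TangentBundle (𝓡 d) W)) ∧
      ∀ (b : Frame m M F E) (x : W), φ.base x ∈ b.dom → ∀ u w : TangentSpace (𝓡 d) x,
        φ.metricVar L S ε.val b x u w = lieDerivMetric v (φ.metric S) x u w

/-- The metric of every solution is invariant under the gauge transformations with parameter
in `ker S^♯`. -/
def KernelGaugeActsTrivially (d : ℕ) (L : LieAlgebroid m M F E) (S : SymTensor m M F E) : Prop :=
  ∀ (W : Type u) [TopologicalSpace W] [T2Space W] [SecondCountableTopology W]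
    [ChartedSpace (EuclideanSpace ℝ (Fin d)) W] [IsManifold (𝓡 d) ∞ W]
    (φ : FieldConfig d W m M F E), φ.IsSolution L →
    ∀ ε : φ.GaugeParameter, (∀ x, S.form (φ.base x) (ε.val x) = 0) →
      ∀ (b : Frame m M F E) (x : W), φ.base x ∈ b.dom → ∀ u w : TangentSpace (𝓡 d) x,
        φ.metricVar L S ε.val b x u w = 0

end Reasonable

end EGravity

end

/-!
The four assertions rest on the following ideas.

*Existence of solutions.* In coordinates of `M` and a local basis of `E`, the component of `A` in
the radial direction is prescribed by a linear map `a`. The radial part of the field equations is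
then an ordinary differential equation along each ray from the origin, whose solution depends
smoothly on the direction. The left-hand sides of the remaining equations solve a homogeneous linear
equation along the rays, by the Jacobi identity and the compatibility of the anchor with the
brackets, so they vanish (`exists_flat_field`). If `a` maps `ℝᵈ` isomorphically to a
complement of `ker S^♯`, then `g` is non-degenerate near the origin, and pulling back along an
embedding of `ℝᵈ` in a small ball gives `exists_nondegenerate_solution`. Smooth dependence on
initial values (`exists_smooth_local_flow_on`) is obtained from the inverse function theorem in a
space of continuous curves.

*Infinitesimal gauge transformations.* By the constant rank of `S`, each vector of `ker S^♯`
extends to a section `ψ` of `ker S^♯`; comparing `δ_ε g` with the components of the hypothesis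
that `S` is invariant along `ψ` shows that `δ_ε g = 0` for `ε` in `ker S^♯`
(`FieldConfig.metricVar_eq_zero_of_kernel`). For a general `ε`, non-degeneracy gives a vector field
`v` with `g(v, ·) = S(ε, A(·))`. As `dim im S^♯ = d`, the difference `ε - A(v)` lies in `ker S^♯`,
while `A(v)` acts on `g` by `L_v` because of the field equations. Hence `δ_ε g = L_v g`
(`FieldConfig.metricVar_eq_lieDerivMetric`).

*Finite gauge transformations.* Along a gauge flow the metrics therefore satisfy
`d/dt g_t = - L_{v_t} g_t` for a smooth time-dependent vector field `v_t` (`IsMetricFlow`), and the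
flow of `v_t`, as far as it exists, consists of local isometries
(`IsMetricFlow.eventually_isIsometryAt`). It has to be shown that it exists for all times. The set
of points which survive from time `t` to time `s` is open. If it were not closed, a coordinate ball
of surviving points would touch a point `x` which is lost at some time `T`. A geodesic of `g_t` which
runs through this ball into `x` is carried by the flow to a geodesic of `g_T`, which ends at a
regular place in the sense of `MaximallyExtended`, and so has a cluster point `z` in the manifold
(`IsMetricFlow.isClosed_flowDomain`). Following the flow backwards from `z` shows that `x` is
carried to `z`, hence is not lost after all (`IsMetricFlow.mem_flowDomain_of_mapClusterPt`). So the
sets of survivors are unions of connected components, and as every point survives for a short time,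
the flow is complete (`IsMetricFlow.mem_flowDomain`) and the diffeomorphism is its value at time `1`.
-/

noncomputable section

namespace EGravity

/-! ### Smooth dependence of solutions of ordinary differential equations on initial values -/

section Flow

universe v

variable {K : Type*} [TopologicalSpace K] [CompactSpace K]

/-- A bilinear map applied pointwise to continuous functions. -/
def pointwiseBilin (K : Type*) [TopologicalSpace K] [CompactSpace K] {H E G : Type*}
    [NormedAddCommGroup H] [NormedSpace ℝ H]
    [NormedAddCommGroup E] [NormedSpace ℝ E] [NormedAddCommGroup G] [NormedSpace ℝ G]
    (P : H →L[ℝ] E →L[ℝ] G) : C(K, H) →L[ℝ] C(K, E) →L[ℝ] C(K, G) :=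
  LinearMap.mkContinuous₂
    (LinearMap.mk₂ ℝ (fun (A : C(K, H)) (h : C(K, E)) =>
        (⟨fun k => P (A k) (h k), by fun_prop⟩ : C(K, G)))
      (fun _ _ _ => by ext; simp) (fun _ _ _ => by ext; simp)
      (fun _ _ _ => by ext; simp) (fun _ _ _ => by ext; simp)) ‖P‖
    (fun A h => by
      rw [ContinuousMap.norm_le _ (by positivity)]
      intro k
      refine (P.le_opNorm₂ (A k) (h k)).trans ?_
      gcongr
      · exact A.norm_coe_le_norm k
      · exact h.norm_coe_le_norm k)

lemma hasFDerivAt_postcomp {H E G : Type*} [NormedAddCommGroup H] [NormedSpace ℝ H]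
    [NormedAddCommGroup E] [NormedSpace ℝ E]
    [NormedAddCommGroup G] [NormedSpace ℝ G] (P : H →L[ℝ] E →L[ℝ] G) (g : C(E, G)) (g' : C(E, H))
    (hg : ∀ x, HasFDerivAt g (P (g' x)) x) (α : C(K, E)) :
    HasFDerivAt (fun β : C(K, E) => g.comp β) (pointwiseBilin K P (g'.comp α)) α := by
  rw [hasFDerivAt_iff_isLittleO, Asymptotics.isLittleO_iff]
  intro c hc
  have hcpt : IsCompact (range α) := isCompact_range α.continuous
  have := hcpt.uniformContinuousAt_of_continuousAt (f := fun x => P (g' x))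
    (fun a _ => (P.continuous.comp g'.continuous).continuousAt) (Metric.dist_mem_uniformity hc)
  obtain ⟨δ, hδ, hδ'⟩ := Metric.mem_uniformity_dist.1 this
  filter_upwards [Metric.ball_mem_nhds α hδ] with β hβ
  rw [ContinuousMap.norm_le _ (by positivity)]
  intro k
  have hk : dist (β k) (α k) < δ := (ContinuousMap.dist_apply_le_dist k).trans_lt hβ
  have key := (convex_ball (α k) δ).norm_image_sub_le_of_norm_hasFDerivWithin_le' (f := g)
    (f' := fun x => P (g' x)) (φ := P (g' (α k))) (C := c) (x := α k) (y := β k)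
    (fun x _ => (hg x).hasFDerivWithinAt)
    (fun x hx => by
      have := hδ' (a := α k) (b := x) (by rw [dist_comm]; exact hx) (mem_range_self k)
      rw [← dist_eq_norm, dist_comm]; exact le_of_lt this)
    (Metric.mem_ball_self hδ) hk
  refine key.trans ?_
  gcongr
  exact (β - α).norm_coe_le_norm k

/-- The superposition operator `α ↦ g ∘ α` of a smooth map `g` is smooth on the Banach space of
continuous functions on a compact space. -/
lemma contDiff_postcomp {E : Type v} [NormedAddCommGroup E] [NormedSpace ℝ E] (n : ℕ) :
    ∀ {G : Type v} [NormedAddCommGroup G] [NormedSpace ℝ G] (g : C(E, G)), ContDiff ℝ n g →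
      ContDiff ℝ n (fun β : C(K, E) => g.comp β) := by
  induction n with
  | zero =>
    intro G _ _ g _
    exact contDiff_zero.2 g.continuous_postcomp
  | succ n ih =>
    intro G _ _ g hg
    have hg' := (contDiff_succ_iff_fderiv (n := n)).1 (by exact_mod_cast hg)
    push_cast
    rw [contDiff_succ_iff_hasFDerivAt]
    let g' : C(E, E →L[ℝ] G) := ⟨fderiv ℝ g, hg'.2.2.continuous⟩
    let P := ContinuousLinearMap.id ℝ (E →L[ℝ] G)
    exact ⟨fun α => pointwiseBilin K P (g'.comp α),
      (pointwiseBilin K P).contDiff.comp (ih g' hg'.2.2),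
      fun α => hasFDerivAt_postcomp P g g' (fun x => (hg'.1 x).hasFDerivAt) α⟩

/-- Integration from `0`, as an operator on continuous functions on `[-1, 1]`. -/
def integralOp (E : Type*) [NormedAddCommGroup E] [NormedSpace ℝ E] :
    C(Icc (-1 : ℝ) 1, E) →L[ℝ] C(Icc (-1 : ℝ) 1, E) :=
  LinearMap.mkContinuous
    { toFun := fun β => ⟨fun t => ∫ τ in (0 : ℝ)..t, IccExtend (by norm_num) β τ, by
        have : Continuous fun t : ℝ => ∫ τ in (0 : ℝ)..t, IccExtend (by norm_num) β τ :=
          intervalIntegral.continuous_primitive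
            (fun a b => (β.continuous.Icc_extend' (h := by norm_num)).intervalIntegrable a b) 0
        exact this.comp continuous_subtype_val⟩
      map_add' := fun β γ => by
        ext t
        simp only [ContinuousMap.coe_mk, ContinuousMap.add_apply]
        rw [← intervalIntegral.integral_add
          ((β.continuous.Icc_extend' (h := by norm_num)).intervalIntegrable _ _)
          ((γ.continuous.Icc_extend' (h := by norm_num)).intervalIntegrable _ _)]
        rfl
      map_smul' := fun c β => by
        ext t
        simp only [ContinuousMap.coe_mk, ContinuousMap.smul_apply, RingHom.id_apply]
        rw [← intervalIntegral.integral_smul]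
        rfl } 1
    (fun β => by
      rw [one_mul, ContinuousMap.norm_le _ (norm_nonneg _)]
      intro t
      have := intervalIntegral.norm_integral_le_of_norm_le_const (a := (0 : ℝ)) (b := t)
        (f := IccExtend (by norm_num : (-1 : ℝ) ≤ 1) β) (C := ‖β‖)
        (fun x _ => β.norm_coe_le_norm _)
      refine this.trans ?_
      have h1 : |(t : ℝ) - 0| ≤ 1 := by rw [sub_zero]; exact abs_le.2 t.2
      nlinarith [norm_nonneg β])

/-- A smooth vector field on a Banach space has a local flow which is jointly smooth in time and
initial value. The curves `t ↦ φ (s t) x` on `[-1, 1]` are the solutions `α` of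
`α = x + s ∫ f ∘ α`, to which the inverse function theorem applies at `s = 0`. -/
theorem exists_smooth_local_flow {E : Type v} [NormedAddCommGroup E] [NormedSpace ℝ E]
    [CompleteSpace E] {f : E → E} (hf : ContDiff ℝ ∞ f) (x₀ : E) :
    ∃ δ > 0, ∃ φ : ℝ → E → E,
      ContDiffOn ℝ ∞ (fun p : ℝ × E => φ p.1 p.2) (Ioo (-δ) δ ×ˢ Metric.ball x₀ δ) ∧
      ∀ x ∈ Metric.ball x₀ δ, φ 0 x = x ∧
        ∀ s ∈ Ioo (-δ) δ, HasDerivAt (fun s => φ s x) (f (φ s x)) s := by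
  let I := Icc (-1 : ℝ) 1
  let C := C(I, E)
  let fc : C(E, E) := ⟨f, hf.continuous⟩
  let N : C → C := fun α => fc.comp α
  have hN : ContDiff ℝ ∞ N := contDiff_infty.2 fun n =>
    contDiff_postcomp n fc (contDiff_infty.1 hf n)
  let cst : E →L[ℝ] C := ContinuousLinearMap.const ℝ I
  let Ψ : (ℝ × E) × C → (ℝ × E) × C := fun p =>
    (p.1, p.2 - cst p.1.2 - p.1.1 • integralOp E (N p.2))
  have hΨ : ContDiff ℝ ∞ Ψ := by
    have h1 : ContDiff ℝ ∞ fun p : (ℝ × E) × C => integralOp E (N p.2) :=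
      (integralOp E).contDiff.comp (hN.comp contDiff_snd)
    have h2 : ContDiff ℝ ∞ fun p : (ℝ × E) × C => cst p.1.2 :=
      cst.contDiff.comp (contDiff_snd.comp contDiff_fst)
    exact contDiff_fst.prodMk ((contDiff_snd.sub h2).sub ((contDiff_fst.comp contDiff_fst).smul h1))
  let p₀ : (ℝ × E) × C := ((0, x₀), cst x₀)
  -- the derivative at `p₀` is a shear
  let w : C := integralOp E (N (cst x₀))
  let B : (ℝ × E) →L[ℝ] C := cst.comp (ContinuousLinearMap.snd ℝ ℝ E) +
    (ContinuousLinearMap.fst ℝ ℝ E).smulRight w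
  let L : ((ℝ × E) × C) ≃L[ℝ] ((ℝ × E) × C) :=
    ContinuousLinearEquiv.equivOfInverse
      ((ContinuousLinearMap.fst ℝ (ℝ × E) C).prod
        (ContinuousLinearMap.snd ℝ (ℝ × E) C - B.comp (ContinuousLinearMap.fst ℝ (ℝ × E) C)))
      ((ContinuousLinearMap.fst ℝ (ℝ × E) C).prod
        (ContinuousLinearMap.snd ℝ (ℝ × E) C + B.comp (ContinuousLinearMap.fst ℝ (ℝ × E) C)))
      (fun p => by ext <;> simp) (fun p => by ext <;> simp)
  have hL : HasFDerivAt Ψ (L : ((ℝ × E) × C) →L[ℝ] ((ℝ × E) × C)) p₀ := by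
    have h1 : HasFDerivAt (fun p : (ℝ × E) × C => p.1) (ContinuousLinearMap.fst ℝ (ℝ × E) C) p₀ :=
      hasFDerivAt_fst
    have h2 : HasFDerivAt (fun p : (ℝ × E) × C => p.2) (ContinuousLinearMap.snd ℝ (ℝ × E) C) p₀ :=
      hasFDerivAt_snd
    have h3 : HasFDerivAt (fun p : (ℝ × E) × C => cst p.1.2) _ p₀ :=
      cst.hasFDerivAt.comp p₀ (hasFDerivAt_snd.comp p₀ h1)
    have h4 : HasFDerivAt (fun p : (ℝ × E) × C => p.1.1) _ p₀ := hasFDerivAt_fst.comp p₀ h1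
    have h5 : HasFDerivAt (fun p : (ℝ × E) × C => integralOp E (N p.2)) _ p₀ :=
      ((((integralOp E).contDiff.comp (hN.comp contDiff_snd)).differentiable (by simp)) p₀).hasFDerivAt
    have h6 := h1.prodMk ((h2.sub h3).sub (h4.smul h5))
    refine HasFDerivAt.congr_fderiv (f := Ψ) h6 ?_
    ext p <;> simp [L, B, p₀, w]
  have hLs := hΨ.contDiffAt (x := p₀)
  let e := hLs.toOpenPartialHomeomorph Ψ hL (by simp)
  have he : ∀ p, e p = Ψ p := fun p => rfl
  have hp₀ : p₀ ∈ e.source := hLs.mem_toOpenPartialHomeomorph_source hL (by simp)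
  have hΨp₀ : Ψ p₀ = ((0, x₀), 0) := by ext <;> simp [Ψ, p₀]
  have hsymm₀ : e.symm ((0, x₀), 0) = p₀ := by rw [← hΨp₀, ← he, e.left_inv hp₀]
  let S : Set ((ℝ × E) × C) := fderiv ℝ Ψ ⁻¹' range
    ((↑) : (((ℝ × E) × C) ≃L[ℝ] ((ℝ × E) × C)) → (((ℝ × E) × C) →L[ℝ] ((ℝ × E) × C)))
  have hS : S ∈ 𝓝 p₀ := by
    apply (hΨ.continuous_fderiv (by simp)).continuousAt.preimage_mem_nhds
    rw [hL.fderiv]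
    exact ContinuousLinearEquiv.nhds L
  have hsrc := e.open_source.mem_nhds hp₀
  obtain ⟨ρ, hρ, hρ'⟩ := Metric.mem_nhds_iff.1 (inter_mem hS hsrc)
  have htgt : ((0, x₀), (0 : C)) ∈ e.target := by rw [← hΨp₀, ← he]; exact e.map_source hp₀
  have hcont : ContinuousAt (fun q : ℝ × E => e.symm (q, 0)) (0, x₀) :=
    ContinuousAt.comp (f := fun q : ℝ × E => (q, (0 : C))) (e.continuousAt_symm htgt)
      (by fun_prop)
  have hev : ∀ᶠ q in 𝓝 ((0 : ℝ), x₀), (q, (0 : C)) ∈ e.target ∧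
      e.symm (q, 0) ∈ Metric.ball p₀ ρ := by
    refine Filter.Eventually.and ?_ ?_
    · exact (show ContinuousAt (fun q : ℝ × E => (q, (0 : C))) (0, x₀) by fun_prop).preimage_mem_nhds
        (e.open_target.mem_nhds htgt)
    · apply hcont.preimage_mem_nhds
      simp only [hsymm₀]
      exact Metric.ball_mem_nhds _ hρ
  obtain ⟨δ, hδ, hδ'⟩ := Metric.mem_nhds_iff.1 hev
  let α : ℝ → E → C := fun s x => (e.symm ((s, x), 0)).2
  have hmem : ∀ s ∈ Ioo (-δ) δ, ∀ x ∈ Metric.ball x₀ δ, ((s, x) : ℝ × E) ∈ Metric.ball (0, x₀) δ := by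
    intro s hs x hx
    rw [← ball_prod_same, mem_prod, Real.ball_eq_Ioo]
    exact ⟨by simpa using hs, hx⟩
  have hα : ∀ s ∈ Ioo (-δ) δ, ∀ x ∈ Metric.ball x₀ δ, e.symm ((s, x), 0) = ((s, x), α s x) := by
    intro s hs x hx
    have h := e.right_inv (hδ' (hmem s hs x hx)).1
    rw [he] at h
    have h1 : (Ψ (e.symm ((s, x), 0))).1 = (s, x) := congrArg Prod.fst h
    exact Prod.ext h1 rfl
  have heq : ∀ s ∈ Ioo (-δ) δ, ∀ x ∈ Metric.ball x₀ δ,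
      α s x = cst x + s • integralOp E (N (α s x)) := by
    intro s hs x hx
    have h := e.right_inv (hδ' (hmem s hs x hx)).1
    rw [hα s hs x hx, he] at h
    have h2 : α s x - cst x - s • integralOp E (N (α s x)) = 0 := congrArg Prod.snd h
    rw [sub_sub, sub_eq_zero] at h2
    exact h2
  have hball : ∀ s ∈ Ioo (-δ) δ, ∀ x ∈ Metric.ball x₀ δ,
      ((s, x), α s x) ∈ Metric.ball p₀ ρ := by
    intro s hs x hx
    rw [← hα s hs x hx]
    exact (hδ' (hmem s hs x hx)).2
  -- uniqueness among curves near the constant one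
  have huniq : ∀ s ∈ Ioo (-δ) δ, ∀ x ∈ Metric.ball x₀ δ, ∀ β : C, dist β (cst x₀) < ρ →
      ((s, x), β) ∈ Metric.ball p₀ ρ → β = cst x + s • integralOp E (N β) → β = α s x := by
    intro s hs x hx β _ hb hβ
    have h1 : Ψ ((s, x), β) = Ψ ((s, x), α s x) := by
      have h2 := heq s hs x hx
      refine Prod.ext rfl ?_
      change β - cst x - s • integralOp E (N β) = α s x - cst x - s • integralOp E (N (α s x))
      rw [sub_sub, sub_sub, ← hβ, ← h2, sub_self, sub_self]
    have := e.injOn (hρ' hb).2 (hρ' (hball s hs x hx)).2 h1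
    exact congrArg Prod.snd this
  have hone : (1 : ℝ) ∈ I := ⟨by norm_num, le_rfl⟩
  have hscale : ∀ s ∈ Ioo (-δ) δ, ∀ x ∈ Metric.ball x₀ δ, ∀ t : I,
      α (s * t) x ⟨1, hone⟩ = α s x t := by
    intro s hs x hx t
    have ht : |(t : ℝ)| ≤ 1 := abs_le.2 t.2
    have habs : |s * t| ≤ |s| := by
      rw [abs_mul]; exact mul_le_of_le_one_right (abs_nonneg _) ht
    have hst : s * t ∈ Ioo (-δ) δ := abs_lt.1 (habs.trans_lt (abs_lt.2 hs))
    have hmul : ∀ r : I, (t : ℝ) * r ∈ I := fun r => abs_le.1 (by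
      rw [abs_mul]; exact mul_le_one₀ ht (abs_nonneg _) (abs_le.2 r.2))
    let β : C := (α s x).comp ⟨fun r => ⟨t * r, hmul r⟩, by fun_prop⟩
    have hβd : dist β (cst x₀) ≤ dist (α s x) (cst x₀) := by
      rw [ContinuousMap.dist_le dist_nonneg]
      intro r
      exact ContinuousMap.dist_apply_le_dist (f := α s x) (g := cst x₀) ⟨t * r, hmul r⟩
    have hb := hball s hs x hx
    rw [← ball_prod_same, mem_prod] at hb
    have hb2 : dist (α s x) (cst x₀) < ρ := hb.2
    have h1 : β = α (s * t) x := by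
      refine huniq _ hst x hx β (hβd.trans_lt hb2) ?_ ?_
      · rw [← ball_prod_same, mem_prod]
        refine ⟨?_, hβd.trans_lt hb2⟩
        have hb1 := hb.1
        rw [← ball_prod_same, mem_prod, Real.ball_eq_Ioo] at hb1 ⊢
        refine ⟨?_, hb1.2⟩
        have : |s| < ρ := abs_lt.2 (by simpa using hb1.1)
        simpa using abs_lt.1 (habs.trans_lt this)
      · ext r
        have h2 : α s x ⟨t * r, hmul r⟩ = x + s • ∫ τ in (0 : ℝ)..(t * r),
            IccExtend (by norm_num : (-1 : ℝ) ≤ 1) (N (α s x)) τ :=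
          congrArg (fun γ : C => γ ⟨t * r, hmul r⟩) (heq s hs x hx)
        change α s x ⟨t * r, hmul r⟩ = x + (s * t) • ∫ τ in (0 : ℝ)..r,
            IccExtend (by norm_num : (-1 : ℝ) ≤ 1) (N β) τ
        rw [h2]
        congr 1
        have h3 := intervalIntegral.smul_integral_comp_mul_left (a := (0 : ℝ)) (b := r)
          (fun τ => IccExtend (by norm_num : (-1 : ℝ) ≤ 1) (N (α s x)) τ) (t : ℝ)
        rw [mul_zero] at h3
        rw [mul_smul, ← h3]
        congr 2
        apply intervalIntegral.integral_congr
        intro τ hτ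
        have hτ' : τ ∈ I := by
          have h4 := uIcc_subset_Icc (by norm_num : (0 : ℝ) ∈ Icc (-1 : ℝ) 1) r.2
          exact h4 hτ
        beta_reduce
        rw [IccExtend_of_mem _ _ (hmul ⟨τ, hτ'⟩), IccExtend_of_mem _ _ hτ']
        rfl
    rw [← h1]
    change α s x ⟨t * 1, _⟩ = _
    congr 1
    exact Subtype.ext (mul_one _)
  refine ⟨δ, hδ, fun s x => α s x ⟨1, hone⟩, ?_, ?_⟩
  · intro q hq
    have hq' : q ∈ Metric.ball ((0 : ℝ), x₀) δ := hmem q.1 hq.1 q.2 hq.2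
    obtain ⟨ht, hb⟩ := hδ' hq'
    obtain ⟨L', hL'⟩ := (hρ' hb).1
    have h1 : ContDiffAt ℝ ∞ e.symm (q, 0) :=
      e.contDiffAt_symm ht
        (by rw [hL']; exact ((hΨ.differentiable (by simp)) _).hasFDerivAt) hΨ.contDiffAt
    have h2 : ContDiffAt ℝ ∞ (fun q : ℝ × E => e.symm (q, 0)) q :=
      ContDiffAt.comp q (f := fun q : ℝ × E => (q, (0 : C))) h1 (by fun_prop)
    exact (((ContinuousMap.evalCLM ℝ (⟨1, hone⟩ : I)).contDiff.contDiffAt.comp q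
      (contDiffAt_snd.comp q h2)).contDiffWithinAt)
  · intro x hx
    refine ⟨?_, ?_⟩
    · have h0 := heq 0 (by constructor <;> linarith) x hx
      dsimp only
      rw [h0]
      rw [zero_smul, add_zero]
      rfl
    · intro s hs
      -- a larger time `s₁`, so that `s = s₁ t` with `|t| < 1`
      obtain ⟨s₁, hs₁, hs₁'⟩ := exists_between (abs_lt.2 hs)
      have hs₁0 : 0 < s₁ := (abs_nonneg s).trans_lt hs₁
      have hs₁m : s₁ ∈ Ioo (-δ) δ := ⟨by linarith, hs₁'⟩
      have hform : ∀ s' ∈ Ioo (-s₁) s₁, ∃ h : s' / s₁ ∈ I,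
          α s' x ⟨1, hone⟩ = α s₁ x ⟨s' / s₁, h⟩ := by
        intro s' hs'
        have h : s' / s₁ ∈ I := abs_le.1 (by
          rw [abs_div, abs_of_pos hs₁0]; exact div_le_one_of_le₀ (abs_lt.2 hs').le hs₁0.le)
        refine ⟨h, ?_⟩
        have := hscale s₁ hs₁m x hx ⟨s' / s₁, h⟩
        rw [← this]
        dsimp only
        rw [mul_div_cancel₀ _ hs₁0.ne']
      have hsm : s ∈ Ioo (-s₁) s₁ := abs_lt.1 hs₁
      have hcontI : Continuous (IccExtend (by norm_num : (-1 : ℝ) ≤ 1) (N (α s₁ x))) :=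
        (N (α s₁ x)).continuous.Icc_extend' (h := by norm_num)
      have hD : HasDerivAt (fun s' : ℝ => x + s₁ • ∫ τ in (0 : ℝ)..(s' / s₁),
          IccExtend (by norm_num : (-1 : ℝ) ≤ 1) (N (α s₁ x)) τ) (f (α s x ⟨1, hone⟩)) s := by
        have h1 := (intervalIntegral.integral_hasDerivAt_right (hcontI.intervalIntegrable 0 (s / s₁))
          (hcontI.stronglyMeasurableAtFilter _ _) hcontI.continuousAt)
        have h2 := (h1.scomp s ((hasDerivAt_id s).div_const s₁)).const_smul s₁ |>.const_add x
        refine HasDerivAt.congr_deriv h2 ?_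
        obtain ⟨h, h3⟩ := hform s hsm
        rw [h3, IccExtend_of_mem _ _ h, smul_smul, mul_one_div_cancel hs₁0.ne', one_smul]
        rfl
      refine hD.congr_of_eventuallyEq ?_
      filter_upwards [Ioo_mem_nhds hsm.1 hsm.2] with s' hs'
      obtain ⟨h, h3⟩ := hform s' hs'
      rw [h3]
      exact congrArg (fun γ : C => γ ⟨s' / s₁, h⟩) (heq s₁ hs₁m x hx)

lemma exists_contDiff_eventuallyEq {E G : Type*} [NormedAddCommGroup E] [NormedSpace ℝ E]
    [FiniteDimensional ℝ E] [NormedAddCommGroup G] [NormedSpace ℝ G] {f : E → G} {U : Set E}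
    (hU : IsOpen U) (hf : ContDiffOn ℝ ∞ f U) {x₀ : E} (hx : x₀ ∈ U) :
    ∃ f' : E → G, ContDiff ℝ ∞ f' ∧ f' =ᶠ[𝓝 x₀] f := by
  obtain ⟨r, hr, hrU⟩ := Metric.isOpen_iff.1 hU x₀ hx
  let χ : ContDiffBump x₀ := ⟨r / 4, r / 2, by linarith, by linarith⟩
  refine ⟨fun x => χ x • f x, contDiff_iff_contDiffAt.2 fun x => ?_, ?_⟩
  · by_cases h : x ∈ U
    · exact χ.contDiff.contDiffAt.smul (hf.contDiffAt (hU.mem_nhds h))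
    · have : x ∉ tsupport χ := by
        rw [χ.tsupport_eq]
        intro hx'
        exact h (hrU (Metric.closedBall_subset_ball (by change r / 2 < r; linarith) hx'))
      have h0 : (fun x => χ x • f x) =ᶠ[𝓝 x] fun _ => 0 := by
        filter_upwards [(isClosed_tsupport χ).isOpen_compl.mem_nhds this] with y hy
        rw [image_eq_zero_of_notMem_tsupport hy, zero_smul]
      exact contDiffAt_const.congr_of_eventuallyEq h0
  · filter_upwards [χ.eventuallyEq_one] with y hy
    rw [hy, Pi.one_apply, one_smul]

/-- The local flow of a vector field which is smooth on an open set `U`, for so short a time that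
it does not leave `U`. -/
theorem exists_smooth_local_flow_on {E : Type v} [NormedAddCommGroup E] [NormedSpace ℝ E]
    [FiniteDimensional ℝ E] {f : E → E} {U : Set E} (hU : IsOpen U) (hf : ContDiffOn ℝ ∞ f U)
    {x₀ : E} (hx₀ : x₀ ∈ U) :
    ∃ δ > 0, ∃ φ : ℝ → E → E,
      ContDiffOn ℝ ∞ (fun p : ℝ × E => φ p.1 p.2) (Ioo (-δ) δ ×ˢ Metric.ball x₀ δ) ∧
      ∀ x ∈ Metric.ball x₀ δ, φ 0 x = x ∧
        ∀ s ∈ Ioo (-δ) δ, φ s x ∈ U ∧ HasDerivAt (fun s => φ s x) (f (φ s x)) s := by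
  have := FiniteDimensional.complete ℝ E
  obtain ⟨f', hf', hff⟩ := exists_contDiff_eventuallyEq hU hf hx₀
  obtain ⟨δ, hδ, φ, hφ, hφ'⟩ := exists_smooth_local_flow hf' x₀
  have hmem : Ioo (-δ) δ ×ˢ Metric.ball x₀ δ ∈ 𝓝 ((0 : ℝ), x₀) :=
    (isOpen_Ioo.prod Metric.isOpen_ball).mem_nhds
      ⟨⟨by linarith, hδ⟩, Metric.mem_ball_self hδ⟩
  have hc : ContinuousAt (fun p : ℝ × E => φ p.1 p.2) (0, x₀) :=
    hφ.continuousOn.continuousAt hmem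
  have h0 : φ 0 x₀ = x₀ := (hφ' x₀ (Metric.mem_ball_self hδ)).1
  have hev : ∀ᶠ p in 𝓝 ((0 : ℝ), x₀), φ p.1 p.2 ∈ U ∧ f' (φ p.1 p.2) = f (φ p.1 p.2) := by
    have h1 : Tendsto (fun p : ℝ × E => φ p.1 p.2) (𝓝 (0, x₀)) (𝓝 x₀) := by
      simpa only [h0] using hc.tendsto
    exact h1.eventually ((hU.eventually_mem hx₀).and hff)
  obtain ⟨δ', hδ', hb⟩ := Metric.mem_nhds_iff.1 hev
  have hsub : Ioo (-min δ δ') (min δ δ') ⊆ Ioo (-δ) δ :=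
    Ioo_subset_Ioo (neg_le_neg (min_le_left _ _)) (min_le_left _ _)
  refine ⟨min δ δ', lt_min hδ hδ', φ, hφ.mono (prod_mono hsub
    (Metric.ball_subset_ball (min_le_left _ _))), fun x hx => ?_⟩
  have hx1 := Metric.ball_subset_ball (min_le_left δ δ') hx
  refine ⟨(hφ' x hx1).1, fun s hs => ?_⟩
  have hm : ((s, x) : ℝ × E) ∈ Metric.ball ((0 : ℝ), x₀) δ' := by
    rw [← ball_prod_same, mem_prod, Real.ball_eq_Ioo]
    have h1 := Ioo_subset_Ioo (neg_le_neg (min_le_right δ δ')) (min_le_right δ δ') hs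
    exact ⟨by simpa using h1, Metric.ball_subset_ball (min_le_right _ _) hx⟩
  obtain ⟨h1, h2⟩ := hb hm
  refine ⟨h1, ?_⟩
  have := (hφ' x hx1).2 s (hsub hs)
  rwa [h2] at this

/-- A solution of a linear ordinary differential equation which vanishes at time `0` vanishes. -/
lemma linear_ode_eq_zero {E : Type*} [NormedAddCommGroup E] [NormedSpace ℝ E]
    {δ : ℝ} {u : ℝ → E} {Λ : ℝ → E →L[ℝ] E} (hΛ : ContinuousOn Λ (Ioo (-δ) δ))
    (hu : ∀ s ∈ Ioo (-δ) δ, HasDerivAt u (Λ s (u s)) s) (h0 : u 0 = 0) :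
    ∀ s ∈ Ioo (-δ) δ, u s = 0 := by
  intro s hs
  have hI : Icc (-|s|) |s| ⊆ Ioo (-δ) δ := by
    have := abs_lt.2 hs
    exact Icc_subset_Ioo (by linarith) this
  obtain ⟨C, hC⟩ := isCompact_Icc.exists_bound_of_continuousOn (hΛ.mono hI)
  have hC0 : 0 ≤ max C 0 := le_max_right _ _
  have key : EqOn u (fun _ => 0) (Icc (-|s|) |s|) := by
    by_cases hs0 : s = 0
    · intro t ht
      have : t = 0 := by simpa [hs0] using ht
      rw [this, h0]
    have hpos : 0 < |s| := abs_pos.2 hs0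
    refine ODE_solution_unique_of_mem_Icc (v := fun t x => Λ t x) (s := fun _ => univ)
      (K := ⟨max C 0, hC0⟩) (t₀ := 0) ?_ ⟨by linarith, hpos⟩ ?_ ?_ ?_ ?_ ?_ ?_ ?_
    · intro t ht
      refine ((Λ t).lipschitz.weaken ?_).lipschitzOnWith
      exact (hC t (Ioo_subset_Icc_self ht)).trans (le_max_left _ _)
    · exact fun t ht => (hu t (hI ht)).continuousAt.continuousWithinAt
    · exact fun t ht => hu t (hI (Ioo_subset_Icc_self ht))
    · exact fun _ _ => mem_univ _
    · exact continuousOn_const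
    · intro t ht
      simpa using hasDerivAt_const t (0 : E)
    · exact fun _ _ => mem_univ _
    · exact h0
  exact key ⟨neg_abs_le s, le_abs_self s⟩

end Flow

/-! ### Local solutions in coordinates -/

section LocalSolution

lemma two_le_infty : (2 : WithTop ℕ∞) ≤ ∞ := by
  change ((2 : ℕ∞) : WithTop ℕ∞) ≤ ((⊤ : ℕ∞) : WithTop ℕ∞)
  exact WithTop.coe_le_coe.2 le_top

lemma hasDerivAt_comp_curve {Y G : Type*} [NormedAddCommGroup Y] [NormedSpace ℝ Y]
    [NormedAddCommGroup G] [NormedSpace ℝ G] {c : Y → G} {c' : Y →L[ℝ] G} {γ : ℝ → Y} {γ' : Y}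
    {s : ℝ} (hc : HasFDerivAt c c' (γ s)) (hγ : HasDerivAt γ γ' s) :
    HasDerivAt (fun s => c (γ s)) (c' γ') s :=
  hc.comp_hasDerivAt s hγ

lemma hasFDerivAt_comp_map {D Y G : Type*} [NormedAddCommGroup D] [NormedSpace ℝ D]
    [NormedAddCommGroup Y] [NormedSpace ℝ Y]
    [NormedAddCommGroup G] [NormedSpace ℝ G] {c : Y → G} {c' : Y →L[ℝ] G} {X : D → Y}
    {X' : D →L[ℝ] Y} {x : D} (hc : HasFDerivAt c c' (X x)) (hX : HasFDerivAt X X' x) :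
    HasFDerivAt (fun x => c (X x)) (c'.comp X') x :=
  hc.comp x hX

lemma hasDerivAt_bilin {R R' Z : Type*} [NormedAddCommGroup R] [NormedSpace ℝ R]
    [NormedAddCommGroup R'] [NormedSpace ℝ R'] [NormedAddCommGroup Z] [NormedSpace ℝ Z]
    {Q : ℝ → R →L[ℝ] R' →L[ℝ] Z} {Q' : R →L[ℝ] R' →L[ℝ] Z} {b₁ : ℝ → R} {b₁' : R} {b₂ : ℝ → R'}
    {b₂' : R'} {s : ℝ} (hQ : HasDerivAt Q Q' s) (h₁ : HasDerivAt b₁ b₁' s)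
    (h₂ : HasDerivAt b₂ b₂' s) :
    HasDerivAt (fun s => Q s (b₁ s) (b₂ s))
      (Q' (b₁ s) (b₂ s) + Q s b₁' (b₂ s) + Q s (b₁ s) b₂') s := by
  have := (hQ.clm_apply h₁).clm_apply h₂
  refine this.congr_deriv ?_
  simp only [add_apply]

lemma fderiv_const_sub_comp_apply {D R : Type*} [NormedAddCommGroup D] [NormedSpace ℝ D]
    [NormedAddCommGroup R] [NormedSpace ℝ R] {C : D → R →L[ℝ] R →L[ℝ] R}
    {C' : D →L[ℝ] R →L[ℝ] R →L[ℝ] R} {B : D → D →L[ℝ] R} {B' : D →L[ℝ] D →L[ℝ] R} {x : D}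
    (hC : HasFDerivAt C C' x) (hB : HasFDerivAt B B' x) (a : D →L[ℝ] R) (u w : D) :
    fderiv ℝ (fun x => a - (C x (a x)).comp (B x)) x u w
      = - (C' u (a x) (B x w) + C x (a u) (B x w) + C x (a x) (B' u w)) := by
  have h1 : HasFDerivAt (fun x => C x (a x)) _ x := hC.clm_apply a.hasFDerivAt
  have h2 : HasFDerivAt (fun x => a - (C x (a x)).comp (B x)) _ x := (h1.clm_comp hB).const_sub a
  rw [h2.fderiv]
  simp only [neg_apply, add_apply,
    ContinuousLinearMap.comp_apply, ContinuousLinearMap.compL_apply,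
    ContinuousLinearMap.flip_apply]
  abel

/-- Differentiation in a parameter commutes with the time derivative. -/
lemma hasDerivAt_fderiv_param {D G : Type*} [NormedAddCommGroup D] [NormedSpace ℝ D]
    [NormedAddCommGroup G] [NormedSpace ℝ G] {ψ g : ℝ × D → G} {Ω : Set (ℝ × D)} (hΩ : IsOpen Ω)
    (hψ : ContDiffOn ℝ ∞ ψ Ω)
    (hg : ∀ p ∈ Ω, HasDerivAt (fun s => ψ (s, p.2)) (g p) p.1) {s : ℝ} {x : D}
    (hp : (s, x) ∈ Ω) (u : D) :
    HasDerivAt (fun s => fderiv ℝ (fun x => ψ (s, x)) x u)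
      (fderiv ℝ (fun x => g (s, x)) x u) s := by
  have hd : ∀ p ∈ Ω, HasFDerivAt ψ (fderiv ℝ ψ p) p := fun p hp =>
    ((hψ.contDiffAt (hΩ.mem_nhds hp)).differentiableAt (by simp)).hasFDerivAt
  have h2 : HasFDerivAt (fderiv ℝ ψ) (fderiv ℝ (fderiv ℝ ψ) (s, x)) (s, x) :=
    (((hψ.contDiffAt (hΩ.mem_nhds hp)).fderiv_right (m := 1)
      (by rw [one_add_one_eq_two]; exact two_le_infty)).differentiableAt
      (by simp)).hasFDerivAt
  have hx : ∀ p ∈ Ω, fderiv ℝ (fun x => ψ (p.1, x)) p.2 u = fderiv ℝ ψ p (0, u) := by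
    intro p hp
    have h1 : HasFDerivAt (fun x : D => (p.1, x)) (ContinuousLinearMap.inr ℝ ℝ D) p.2 :=
      hasFDerivAt_prodMk_right p.1 p.2
    have := (hd p hp).comp p.2 h1
    exact congrArg (fun L => L u) this.fderiv
  have hs : ∀ p ∈ Ω, g p = fderiv ℝ ψ p (1, 0) := by
    intro p hp
    have h1 : HasFDerivAt (fun s : ℝ => (s, p.2)) (ContinuousLinearMap.inl ℝ ℝ D) p.1 :=
      hasFDerivAt_prodMk_left p.1 p.2
    have := ((hd p hp).comp p.1 h1).hasDerivAt
    rw [(hg p hp).unique this]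
    simp
  have hsymm := (hψ.contDiffAt (hΩ.mem_nhds hp)).isSymmSndFDerivAt (n := ∞)
    (by rw [minSmoothness_of_isRCLikeNormedField]; exact two_le_infty)
  have e1 : ∀ᶠ s' in 𝓝 s, (s', x) ∈ Ω :=
    (Continuous.prodMk_left x).continuousAt.preimage_mem_nhds (hΩ.mem_nhds hp)
  have e2 : ∀ᶠ x' in 𝓝 x, (s, x') ∈ Ω :=
    (Continuous.prodMk_right s).continuousAt.preimage_mem_nhds (hΩ.mem_nhds hp)
  have hev : ∀ v : ℝ × D, HasFDerivAt (fun p => fderiv ℝ ψ p v)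
      ((fderiv ℝ (fderiv ℝ ψ) (s, x)).flip v) (s, x) := fun v => by
    have := h2.clm_apply (hasFDerivAt_const v (s, x))
    rwa [ContinuousLinearMap.comp_zero, zero_add] at this
  have k1 : HasDerivAt (fun s' => fderiv ℝ ψ (s', x) (0, u))
      (fderiv ℝ (fderiv ℝ ψ) (s, x) (1, 0) (0, u)) s :=
    (hev (0, u)).comp_hasDerivAt (f := fun s' => (s', x)) s
      ((hasDerivAt_id s).prodMk (hasDerivAt_const s x))
  have k2 : HasFDerivAt (fun x' => fderiv ℝ ψ (s, x') (1, 0))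
      (((fderiv ℝ (fderiv ℝ ψ) (s, x)).flip (1, 0)).comp (ContinuousLinearMap.inr ℝ ℝ D)) x :=
    (hev (1, 0)).comp x (hasFDerivAt_prodMk_right s x)
  have k3 : HasFDerivAt (fun x' => g (s, x'))
      (((fderiv ℝ (fderiv ℝ ψ) (s, x)).flip (1, 0)).comp (ContinuousLinearMap.inr ℝ ℝ D)) x := by
    refine k2.congr_of_eventuallyEq ?_
    filter_upwards [e2] with x' hx'
    exact hs _ hx'
  rw [k3.fderiv]
  have k4 := k1.congr_of_eventuallyEq (f₁ := fun s => fderiv ℝ (fun x => ψ (s, x)) x u) (by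
    filter_upwards [e1] with s' hs'
    exact hx _ hs')
  refine k4.congr_deriv ?_
  exact hsymm (1, 0) (0, u)

/-- The field equations integrated along rays: `X(s, x)` and `B(s, x)` are `X` and `s A` at the
point `s x`, in the gauge where `A` is constant on the direction of the ray. -/
lemma exists_radial_field {D Y R : Type*} [NormedAddCommGroup D] [NormedSpace ℝ D]
    [FiniteDimensional ℝ D] [NormedAddCommGroup Y] [NormedSpace ℝ Y] [FiniteDimensional ℝ Y]
    [NormedAddCommGroup R] [NormedSpace ℝ R] [FiniteDimensional ℝ R]
    {O : Set Y} (hO : IsOpen O) {ρ : Y → R →L[ℝ] Y} {c : Y → R →L[ℝ] R →L[ℝ] R}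
    (hρ : ContDiffOn ℝ ∞ ρ O) (hc : ContDiffOn ℝ ∞ c O)
    {y₀ : Y} (hy₀ : y₀ ∈ O) (a : D →L[ℝ] R) :
    ∃ δ > 0, ∃ (X : ℝ × D → Y) (B : ℝ × D → D →L[ℝ] R),
      ContDiffOn ℝ ∞ X (Ioo (-δ) δ ×ˢ Metric.ball 0 δ) ∧
      ContDiffOn ℝ ∞ B (Ioo (-δ) δ ×ˢ Metric.ball 0 δ) ∧
      (∀ x ∈ Metric.ball 0 δ, X (0, x) = y₀ ∧ B (0, x) = 0) ∧
      ∀ p ∈ Ioo (-δ) δ ×ˢ Metric.ball (0 : D) δ, X p ∈ O ∧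
        HasDerivAt (fun s => X (s, p.2)) (ρ (X p) (a p.2)) p.1 ∧
        HasDerivAt (fun s => B (s, p.2)) (a - (c (X p) (a p.2)).comp (B p)) p.1 := by
  let S := D × Y × (D →L[ℝ] R)
  let f : S → S := fun p => (0, ρ p.2.1 (a p.1), a - (c p.2.1 (a p.1)).comp p.2.2)
  let U : Set S := {p | p.2.1 ∈ O}
  have hU : IsOpen U := hO.preimage (continuous_fst.comp continuous_snd)
  have hX1 : ContDiffOn ℝ ∞ (fun p : S => p.2.1) U :=
    (contDiff_fst.comp contDiff_snd).contDiffOn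
  have hx1 : ContDiffOn ℝ ∞ (fun p : S => a p.1) U := (a.contDiff.comp contDiff_fst).contDiffOn
  have hf : ContDiffOn ℝ ∞ f U := by
    refine contDiffOn_const.prodMk ((ContDiffOn.clm_apply (hρ.comp hX1 fun p hp => hp) hx1).prodMk ?_)
    exact contDiffOn_const.sub (((hc.comp hX1 fun p hp => hp).clm_apply hx1).clm_comp
      (contDiff_snd.comp contDiff_snd).contDiffOn)
  obtain ⟨δ, hδ, φ, hφ, hφ'⟩ := exists_smooth_local_flow_on hU hf
    (x₀ := ((0, y₀, 0) : S)) hy₀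
  let J := Ioo (-δ) δ
  let N := Metric.ball (0 : D) δ
  have hN : ∀ x ∈ N, ((x, y₀, 0) : S) ∈ Metric.ball ((0, y₀, 0) : S) δ := by
    intro x hx
    rw [← ball_prod_same, ← ball_prod_same]
    exact ⟨hx, Metric.mem_ball_self hδ, Metric.mem_ball_self hδ⟩
  let Ω : Set (ℝ × D) := J ×ˢ N
  have hΩ : IsOpen Ω := isOpen_Ioo.prod Metric.isOpen_ball
  let q : ℝ × D → S := fun p => φ p.1 (p.2, y₀, 0)
  have hq : ContDiffOn ℝ ∞ q Ω := by
    refine hφ.comp (f := fun p : ℝ × D => (p.1, ((p.2, y₀, 0) : S))) ?_ (fun p hp => ⟨hp.1, hN _ hp.2⟩)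
    exact (contDiff_fst.prodMk (contDiff_snd.prodMk (contDiff_const.prodMk contDiff_const))).contDiffOn
  have hqd : ∀ p ∈ Ω, HasDerivAt (fun s => q (s, p.2)) (f (q p)) p.1 := fun p hp =>
    ((hφ' _ (hN _ hp.2)).2 p.1 hp.1).2
  have hqO : ∀ p ∈ Ω, (q p).2.1 ∈ O := fun p hp => ((hφ' _ (hN _ hp.2)).2 p.1 hp.1).1
  have hq0 : ∀ x ∈ N, q (0, x) = (x, y₀, 0) := fun x hx => (hφ' _ (hN _ hx)).1
  have h0J : (0 : ℝ) ∈ J := ⟨by linarith, hδ⟩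
  have hq1 : ∀ p ∈ Ω, (q p).1 = p.2 := by
    rintro ⟨s, x⟩ ⟨hs, hx⟩
    have := linear_ode_eq_zero (δ := δ) (u := fun s => (q (s, x)).1 - x) (Λ := fun _ => 0)
      continuousOn_const (fun s hs => by
        have := ((hqd (s, x) ⟨hs, hx⟩).hasFDerivAt.fst.hasDerivAt).sub_const x
        simpa [f] using this) (by simp [hq0 x hx]) s hs
    exact sub_eq_zero.1 this
  refine ⟨δ, hδ, fun p => (q p).2.1, fun p => (q p).2.2,
    (contDiff_fst.comp contDiff_snd).comp_contDiffOn hq,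
    (contDiff_snd.comp contDiff_snd).comp_contDiffOn hq,
    fun x hx => by simp [hq0 x hx], fun p hp => ⟨hqO p hp, ?_, ?_⟩⟩
  · have := (hqd p hp).hasFDerivAt.snd.fst.hasDerivAt
    simpa [f, hq1 p hp] using this
  · have := (hqd p hp).hasFDerivAt.snd.snd.hasDerivAt
    simpa [f, hq1 p hp] using this

set_option maxHeartbeats 1000000 in
set_option synthInstance.maxHeartbeats 200000 in
/-- Local existence of flat fields. `ρ` and `c` are the anchor and the structure functions of a
Lie algebroid in a local basis. For each `x`, the equations are integrated along the ray through
`x`, with `A` prescribed to be constant on the direction of the ray; the remaining equations then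
hold because their left-hand sides solve homogeneous linear equations along the rays. -/
theorem exists_flat_field {D Y R : Type*} [NormedAddCommGroup D] [NormedSpace ℝ D]
    [FiniteDimensional ℝ D] [NormedAddCommGroup Y] [NormedSpace ℝ Y] [FiniteDimensional ℝ Y]
    [NormedAddCommGroup R] [NormedSpace ℝ R] [FiniteDimensional ℝ R]
    {O : Set Y} (hO : IsOpen O) {ρ : Y → R →L[ℝ] Y} {c : Y → R →L[ℝ] R →L[ℝ] R}
    (hρ : ContDiffOn ℝ ∞ ρ O) (hc : ContDiffOn ℝ ∞ c O)
    (hanti : ∀ y ∈ O, ∀ ξ η, c y ξ η = - c y η ξ)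
    (hanchor : ∀ y ∈ O, ∀ ξ η,
      fderiv ℝ ρ y (ρ y ξ) η - fderiv ℝ ρ y (ρ y η) ξ = ρ y (c y ξ η))
    (hjac : ∀ y ∈ O, ∀ ξ η ζ,
      fderiv ℝ c y (ρ y ξ) η ζ + fderiv ℝ c y (ρ y η) ζ ξ + fderiv ℝ c y (ρ y ζ) ξ η
        + c y ξ (c y η ζ) + c y η (c y ζ ξ) + c y ζ (c y ξ η) = 0)
    {y₀ : Y} (hy₀ : y₀ ∈ O) (a : D →L[ℝ] R) :
    ∃ s₀ : ℝ, s₀ ≠ 0 ∧ ∃ r > 0, ∃ (X : D → Y) (A : D → D →L[ℝ] R),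
      ContDiffOn ℝ ∞ X (Metric.ball 0 r) ∧ ContDiffOn ℝ ∞ A (Metric.ball 0 r) ∧
      X 0 = y₀ ∧ A 0 = s₀ • a ∧
      ∀ x ∈ Metric.ball (0 : D) r, X x ∈ O ∧
        (∀ u, fderiv ℝ X x u = ρ (X x) (A x u)) ∧
        ∀ u w, fderiv ℝ A x u w - fderiv ℝ A x w u + c (X x) (A x u) (A x w) = 0 := by
  obtain ⟨δ, hδ, X, B, hX, hB, hXB0, hall⟩ := exists_radial_field hO hρ hc hy₀ a
  set J := Ioo (-δ) δ with hJ
  set N := Metric.ball (0 : D) δ with hNdef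
  have hΩ : IsOpen (J ×ˢ N) := isOpen_Ioo.prod Metric.isOpen_ball
  have hqO : ∀ p ∈ J ×ˢ N, X p ∈ O := fun p hp => (hall p hp).1
  have hXd : ∀ p ∈ J ×ˢ N, HasDerivAt (fun s => X (s, p.2)) (ρ (X p) (a p.2)) p.1 :=
    fun p hp => (hall p hp).2.1
  have hBd : ∀ p ∈ J ×ˢ N,
      HasDerivAt (fun s => B (s, p.2)) (a - (c (X p) (a p.2)).comp (B p)) p.1 :=
    fun p hp => (hall p hp).2.2
  -- derivatives in the parameter
  have hXx : ∀ p ∈ J ×ˢ N, HasFDerivAt (fun x => X (p.1, x)) (fderiv ℝ (fun x => X (p.1, x)) p.2) p.2 := by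
    intro p hp
    have h1 : ContDiffAt ℝ ∞ (fun x => X (p.1, x)) p.2 :=
      ContDiffAt.comp (f := fun x => (p.1, x)) p.2 (hX.contDiffAt (hΩ.mem_nhds hp)) (contDiff_prodMk_right p.1).contDiffAt
    exact (h1.differentiableAt (by simp)).hasFDerivAt
  have hBx : ∀ p ∈ J ×ˢ N, HasFDerivAt (fun x => B (p.1, x)) (fderiv ℝ (fun x => B (p.1, x)) p.2) p.2 := by
    intro p hp
    have h1 : ContDiffAt ℝ ∞ (fun x => B (p.1, x)) p.2 :=
      ContDiffAt.comp (f := fun x => (p.1, x)) p.2 (hB.contDiffAt (hΩ.mem_nhds hp)) (contDiff_prodMk_right p.1).contDiffAt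
    exact (h1.differentiableAt (by simp)).hasFDerivAt
  have hρd : ∀ y ∈ O, HasFDerivAt ρ (fderiv ℝ ρ y) y := fun y hy =>
    ((hρ.contDiffAt (hO.mem_nhds hy)).differentiableAt (by simp)).hasFDerivAt
  have hcd : ∀ y ∈ O, HasFDerivAt c (fderiv ℝ c y) y := fun y hy =>
    ((hc.contDiffAt (hO.mem_nhds hy)).differentiableAt (by simp)).hasFDerivAt
  have hanti' : ∀ y ∈ O, ∀ v ξ η, fderiv ℝ c y v ξ η + fderiv ℝ c y v η ξ = 0 := by
    intro y hy v ξ η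
    have h1 : ∀ ξ η, HasFDerivAt (fun y => c y ξ η) (((fderiv ℝ c y).flip ξ).flip η) y := by
      intro ξ η
      have h2 := ((hcd y hy).clm_apply (hasFDerivAt_const ξ y)).clm_apply (hasFDerivAt_const η y)
      refine h2.congr_fderiv ?_
      ext v
      simp
    have h3 : (fun y => c y ξ η + c y η ξ) =ᶠ[𝓝 y] fun _ => 0 := by
      filter_upwards [hO.mem_nhds hy] with z hz
      rw [hanti z hz, neg_add_cancel]
    have h4 := ((h1 ξ η).add (h1 η ξ)).congr_of_eventuallyEq h3.symm
    exact congrArg (fun L => L v) (h4.unique (hasFDerivAt_const (0 : R) y))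
  have hcont : ∀ x ∈ N, ContinuousOn (fun s => X (s, x)) J := fun x hx s hs =>
    (hXd (s, x) ⟨hs, hx⟩).continuousAt.continuousWithinAt
  have hX0 : ∀ x ∈ N, X (0, x) = y₀ := fun x hx => (hXB0 x hx).1
  have hB0 : ∀ x ∈ N, B (0, x) = 0 := fun x hx => (hXB0 x hx).2
  have hX0' : ∀ x ∈ N, fderiv ℝ (fun x => X (0, x)) x = 0 := fun x hx => by
    have : (fun x => X (0, x)) =ᶠ[𝓝 x] fun _ => y₀ := by
      filter_upwards [Metric.isOpen_ball.mem_nhds hx] with z hz using hX0 z hz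
    rw [this.fderiv_eq, fderiv_const_apply]
  have hB0' : ∀ x ∈ N, fderiv ℝ (fun x => B (0, x)) x = 0 := fun x hx => by
    have : (fun x => B (0, x)) =ᶠ[𝓝 x] fun _ => 0 := by
      filter_upwards [Metric.isOpen_ball.mem_nhds hx] with z hz using hB0 z hz
    rw [this.fderiv_eq, fderiv_const_apply]
  have hXX : ∀ x ∈ N, ∀ s ∈ J, ∀ u, fderiv ℝ (fun x => X (s, x)) x u = ρ (X (s, x)) (B (s, x) u) := by
    intro x hx s hs u
    refine sub_eq_zero.1 (linear_ode_eq_zero (δ := δ)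
      (u := fun s => fderiv ℝ (fun x => X (s, x)) x u - ρ (X (s, x)) (B (s, x) u))
      (Λ := fun s => (fderiv ℝ ρ (X (s, x))).flip (a x)) ?_ ?_ ?_ s hs)
    · have h1 : ContinuousOn (fderiv ℝ ρ) O := hρ.continuousOn_fderiv_of_isOpen hO (by simp)
      have h2 := h1.comp (hcont x hx) (fun s hs => hqO (s, x) ⟨hs, hx⟩)
      exact (((ContinuousLinearMap.flipₗᵢ ℝ Y R Y).continuous.comp_continuousOn h2).clm_apply
        continuousOn_const :)
    · intro s hs
      have hp : (s, x) ∈ J ×ˢ N := ⟨hs, hx⟩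
      have k1 := hasDerivAt_fderiv_param (g := fun p => ρ (X p) (a p.2)) hΩ hX hXd hp u
      have k2 : HasFDerivAt (fun x => ρ (X (s, x)) (a x)) _ x :=
        ((hρd _ (hqO _ hp)).comp x (hXx _ hp)).clm_apply a.hasFDerivAt
      have k3 : HasDerivAt (fun s => ρ (X (s, x)) (B (s, x) u)) _ s :=
        ((hρd _ (hqO _ hp)).comp_hasDerivAt s (hXd _ hp)).clm_apply
        ((hBd _ hp).clm_apply (hasDerivAt_const s u))
      rw [k2.fderiv] at k1
      refine (k1.sub k3).congr_deriv ?_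
      have := hanchor _ (hqO _ hp) (a x) (B (s, x) u)
      simp only [add_apply, ContinuousLinearMap.comp_apply,
        ContinuousLinearMap.flip_apply, map_sub, sub_apply, map_zero, add_zero]
      rw [← this]
      abel
    · simp [hX0' x hx, hB0 x hx]
  have hFF : ∀ x ∈ N, ∀ s ∈ J, ∀ u w, fderiv ℝ (fun x => B (s, x)) x u w
      - fderiv ℝ (fun x => B (s, x)) x w u + c (X (s, x)) (B (s, x) u) (B (s, x) w) = 0 := by
    intro x hx s hs u w
    refine linear_ode_eq_zero (δ := δ)
      (u := fun s => fderiv ℝ (fun x => B (s, x)) x u w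
        - fderiv ℝ (fun x => B (s, x)) x w u + c (X (s, x)) (B (s, x) u) (B (s, x) w))
      (Λ := fun s => - c (X (s, x)) (a x)) ?_ ?_ ?_ s hs
    · have h2 := hc.continuousOn.comp (hcont x hx) (fun s hs => hqO (s, x) ⟨hs, hx⟩)
      exact (h2.clm_apply continuousOn_const).neg
    · intro s hs
      have hp : (s, x) ∈ J ×ˢ N := ⟨hs, hx⟩
      have k1 := hasDerivAt_fderiv_param (g := fun p => a - (c (X p) (a p.2)).comp (B p)) hΩ hB hBd hp u
      have k1' := hasDerivAt_fderiv_param (g := fun p => a - (c (X p) (a p.2)).comp (B p)) hΩ hB hBd hp w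
      have hQ : HasDerivAt (fun s => c (X (s, x))) (fderiv ℝ c (X (s, x)) (ρ (X (s, x)) (a x))) s :=
        hasDerivAt_comp_curve (c := c) (c' := fderiv ℝ c (X (s, x))) (γ := fun s => X (s, x)) (hcd (X (s, x)) (hqO (s, x) hp))
          (hXd (s, x) hp)
      have hb : ∀ v, HasDerivAt (fun s => B (s, x) v)
          ((a - (c (X (s, x)) (a x)).comp (B (s, x))) v) s := fun v =>
        (ContinuousLinearMap.apply ℝ R v).hasFDerivAt.comp_hasDerivAt s (hBd (s, x) hp)
      have k3 := hasDerivAt_bilin hQ (hb u) (hb w)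
      have hCx : HasFDerivAt (fun x => c (X (s, x)))
          ((fderiv ℝ c (X (s, x))).comp (fderiv ℝ (fun x => X (s, x)) x)) x :=
        hasFDerivAt_comp_map (c := c) (c' := fderiv ℝ c (X (s, x))) (X := fun x => X (s, x))
          (hcd (X (s, x)) (hqO (s, x) hp)) (hXx (s, x) hp)

      have k4 := (((k1.clm_apply (hasDerivAt_const s w)).sub
        (k1'.clm_apply (hasDerivAt_const s u))).add k3)
      refine k4.congr_deriv ?_
      rw [fderiv_const_sub_comp_apply hCx (hBx _ hp), fderiv_const_sub_comp_apply hCx (hBx _ hp)]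
      have hO' := hqO _ hp
      have j := hjac _ hO' (a x) (B (s, x) u) (B (s, x) w)
      have hXu := hXX x hx s hs u
      have hXw := hXX x hx s hs w
      have a1 := hanti _ hO' (a w) (B (s, x) u)
      have a2 := hanti _ hO' (B (s, x) w) (c (X (s, x)) (a x) (B (s, x) u))
      have a3 := hanti _ hO' (B (s, x) w) (a x)
      simp only [ContinuousLinearMap.comp_apply, map_sub, sub_apply, map_zero,
        add_zero, neg_apply, hXu, hXw, map_add]
      have a4 := congrArg (c (X (s, x)) (B (s, x) u)) a3
      rw [map_neg] at a4
      have a5 := hanti' _ hO' (ρ (X (s, x)) (B (s, x) u)) (a x) (B (s, x) w)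
      linear_combination (norm := module) j - a5 + a1 - a2 - a4
    · simp [hB0' x hx, hB0 x hx]
  refine ⟨δ / 2, by positivity, δ, hδ, fun x => X (δ / 2, x), fun x => B (δ / 2, x), ?_, ?_, ?_, ?_, ?_⟩
  all_goals have hh : δ / 2 ∈ J := ⟨by linarith, by linarith⟩
  · exact hX.comp (contDiff_prodMk_right _).contDiffOn fun x hx => ⟨hh, hx⟩
  · exact hB.comp (contDiff_prodMk_right _).contDiffOn fun x hx => ⟨hh, hx⟩
  · have h0 : (0 : D) ∈ N := Metric.mem_ball_self hδ
    have := linear_ode_eq_zero (δ := δ) (u := fun s => X (s, 0) - y₀) (Λ := fun _ => 0)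
      continuousOn_const (fun s hs => by
        simpa using (hXd (s, 0) ⟨hs, h0⟩).sub_const y₀) (by simp [hX0 0 h0]) _ hh
    exact sub_eq_zero.1 this
  · have h0 : (0 : D) ∈ N := Metric.mem_ball_self hδ
    have := linear_ode_eq_zero (δ := δ) (u := fun s => B (s, 0) - s • a) (Λ := fun _ => 0)
      continuousOn_const (fun s hs => by
        refine ((hBd (s, 0) ⟨hs, h0⟩).sub ((hasDerivAt_id s).smul_const a)).congr_deriv ?_
        simp)
      (by simp [hB0 0 h0]) _ hh
    exact sub_eq_zero.1 this
  · exact fun x hx => ⟨hqO (δ / 2, x) ⟨hh, hx⟩, hXX x hx _ hh, hFF x hx _ hh⟩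

end LocalSolution

/-! ### Sections, frames and the bracket in components -/

section Algebroid

variable {m : ℕ} {M : Type*} [TopologicalSpace M] [T2Space M]
  [ChartedSpace (EuclideanSpace ℝ (Fin m)) M] [IsManifold (𝓡 m) ∞ M]
  {F : Type*} [NormedAddCommGroup F] [NormedSpace ℝ F]
  {E : M → Type*} [TopologicalSpace (TotalSpace F E)] [∀ x, TopologicalSpace (E x)]
  [∀ x, AddCommGroup (E x)] [∀ x, Module ℝ (E x)] [FiberBundle F E] [VectorBundle ℝ F E]

lemma Frame.sum_comp (b : Frame m M F E) {x : M} (hx : x ∈ b.dom) (e : E x) :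
    ∑ i, b.comp i x e • b.sec i x = e := by
  simp only [Frame.comp, IsLocalFrameOn.coeff, hx, dite_true]
  have := (b.isFrame.toBasisAt hx).sum_repr e
  simpa using this

lemma Frame.comp_sec (b : Frame m M F E) {x : M} (hx : x ∈ b.dom) (i j : Fin (finrank ℝ F)) :
    b.comp i x (b.sec j x) = if j = i then 1 else 0 := by
  simp only [Frame.comp, IsLocalFrameOn.coeff, hx, dite_true]
  have := b.isFrame.toBasisAt_coe hx j
  rw [← this, Basis.coord_apply, Basis.repr_self, Finsupp.single_apply]

lemma Frame.ext_comp (b : Frame m M F E) {x : M} (hx : x ∈ b.dom) {e e' : E x}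
    (h : ∀ i, b.comp i x e = b.comp i x e') : e = e' := by
  rw [← b.sum_comp hx e, ← b.sum_comp hx e']
  simp [h]

lemma exists_bump {U : Set M} {x : M} (hU : U ∈ 𝓝 x) :
    ∃ χ : M → ℝ, ContMDiff (𝓡 m) 𝓘(ℝ, ℝ) ∞ χ ∧ χ =ᶠ[𝓝 x] 1 ∧ tsupport χ ⊆ U := by
  obtain ⟨f, -, hf⟩ := (SmoothBumpFunction.nhds_basis_tsupport (I := 𝓡 m) x).mem_iff.1 hU
  exact ⟨f, f.contMDiff, f.eventuallyEq_one, hf⟩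

lemma exists_contMDiff_eventuallyEq {U : Set M} (hU : IsOpen U) {f : M → ℝ}
    (hf : ContMDiffOn (𝓡 m) 𝓘(ℝ, ℝ) ∞ f U) {x : M} (hx : x ∈ U) :
    ∃ f' : M → ℝ, ContMDiff (𝓡 m) 𝓘(ℝ, ℝ) ∞ f' ∧ f' =ᶠ[𝓝 x] f := by
  obtain ⟨χ, hχ, hχ1, hχU⟩ := exists_bump (m := m) (hU.mem_nhds hx)
  refine ⟨fun y => χ y * f y, ?_, ?_⟩
  · apply contMDiff_of_tsupport
    intro y hy
    have hy' : y ∈ U := hχU (tsupport_mul_subset_left hy)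
    exact hχ.contMDiffAt.mul (hf.contMDiffAt (hU.mem_nhds hy'))
  · filter_upwards [hχ1] with y hy
    rw [hy, Pi.one_apply, one_mul]

lemma exists_sec_eventuallyEq {U : Set M} (hU : IsOpen U) {s : ∀ x, E x}
    (hs : ContMDiffOn (𝓡 m) ((𝓡 m).prod 𝓘(ℝ, F)) ∞ (fun x => (⟨x, s x⟩ : TotalSpace F E)) U)
    {x : M} (hx : x ∈ U) : ∃ σ : Sec m M F E, ∀ᶠ y in 𝓝 x, σ y = s y := by
  obtain ⟨χ, hχ, hχ1, hχU⟩ := exists_bump (m := m) (hU.mem_nhds hx)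
  refine ⟨⟨χ • s, hχ.contMDiffOn.smul_section_of_tsupport hU hχU hs⟩, ?_⟩
  filter_upwards [hχ1] with y hy
  change χ y • s y = s y
  rw [hy, Pi.one_apply, one_smul]

/-- The section `f a`. -/
def smulSec (f : M → ℝ) (hf : ContMDiff (𝓡 m) 𝓘(ℝ, ℝ) ∞ f) (a : Sec m M F E) : Sec m M F E :=
  ⟨f • ⇑a, hf.smul_section a.contMDiff⟩

@[simp] lemma smulSec_apply (f : M → ℝ) (hf : ContMDiff (𝓡 m) 𝓘(ℝ, ℝ) ∞ f) (a : Sec m M F E)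
    (x : M) : smulSec f hf a x = f x • a x := rfl

lemma sec_sum_apply {ι : Type*} (s : Finset ι) (a : ι → Sec m M F E) (x : M) :
    (∑ i ∈ s, a i) x = ∑ i ∈ s, a i x := by
  classical
  induction s using Finset.induction_on with
  | empty => simp
  | insert i s hi h => rw [Finset.sum_insert hi, Finset.sum_insert hi, ContMDiffSection.coe_add, Pi.add_apply, h]

lemma LieAlgebroid.bracket_antisymm (L : LieAlgebroid m M F E) (a b : Sec m M F E) :
    L.bracket a b = - L.bracket b a := by
  have h := L.bracket_self (a + b)
  simp only [map_add, LinearMap.add_apply, L.bracket_self, zero_add, add_zero] at h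
  exact eq_neg_of_add_eq_zero_right h

lemma LieAlgebroid.bracket_smulSec (L : LieAlgebroid m M F E) (a b : Sec m M F E) (f : M → ℝ)
    (hf : ContMDiff (𝓡 m) 𝓘(ℝ, ℝ) ∞ f) (x : M) :
    L.bracket a (smulSec f hf b) x
      = f x • L.bracket a b x + mvfderiv (𝓡 m) f x (L.anchor x (a x)) • b x :=
  L.leibniz a b _ f hf (fun _ => rfl) x

/-- The bracket is local in its second argument. -/
lemma LieAlgebroid.bracket_congr (L : LieAlgebroid m M F E) (a : Sec m M F E) {b b' : Sec m M F E}
    {x : M} (h : ∀ᶠ y in 𝓝 x, b y = b' y) : L.bracket a b x = L.bracket a b' x := by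
  obtain ⟨χ, hχ, hχ1, hχU⟩ := exists_bump (m := m) h
  have h0 : smulSec χ hχ (b - b') = 0 := by
    ext y
    rw [smulSec_apply]
    by_cases hy : y ∈ tsupport χ
    · have : b y = b' y := hχU hy
      simp [this]
    · simp [image_eq_zero_of_notMem_tsupport hy]
  have h1 := L.bracket_smulSec a (b - b') χ hχ x
  have hx : b x = b' x := h.self_of_nhds
  rw [h0, hχ1.eq_of_nhds] at h1
  simp only [map_zero, ContMDiffSection.coe_zero, Pi.zero_apply, Pi.one_apply, one_smul, map_sub,
    ContMDiffSection.coe_sub, Pi.sub_apply, hx, sub_self, smul_zero, add_zero] at h1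
  exact sub_eq_zero.1 h1.symm

section Smooth

variable [FiniteDimensional ℝ F] [ContMDiffVectorBundle ∞ F E (𝓡 m)]

/-- The components of a vector in a local basis depend smoothly on the vector. -/
lemma Frame.contMDiffAt_comp_totalSpace (b : Frame m M F E) (i : Fin (finrank ℝ F))
    {q : TotalSpace F E} (hq : q.1 ∈ b.dom) :
    ContMDiffAt ((𝓡 m).prod 𝓘(ℝ, F)) 𝓘(ℝ, ℝ) ∞ (fun q : TotalSpace F E => b.comp i q.1 q.2) q := by
  let e := trivializationAt F E q.1
  let r := finrank ℝ F
  have hqe : q.1 ∈ e.baseSet := FiberBundle.mem_baseSet_trivializationAt' q.1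
  -- the local basis, read in the trivialization
  let Ψ : M → (Fin r → ℝ) →L[ℝ] F := fun y =>
    ∑ j, (ContinuousLinearMap.proj (R := ℝ) (φ := fun _ : Fin r => ℝ) j).smulRight (e ⟨y, b.sec j y⟩).2
  have hΨe : ∀ y ∈ e.baseSet, ∀ v : Fin r → ℝ, Ψ y v = (e ⟨y, ∑ j, v j • b.sec j y⟩).2 := by
    intro y hy v
    have h1 : ∀ w : E y, (e ⟨y, w⟩).2 = e.linearMapAt ℝ y w := fun w => by
      rw [e.coe_linearMapAt_of_mem hy]
    rw [h1, map_sum]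
    simp only [Ψ, sum_apply]
    refine Finset.sum_congr rfl fun j _ => ?_
    rw [map_smul, ← h1]
    simp
  have hΨc : ∀ y ∈ e.baseSet ∩ b.dom, ∀ w : E y,
      Ψ y (fun j => b.comp j y w) = (e ⟨y, w⟩).2 := by
    intro y hy w
    rw [hΨe y hy.1, b.sum_comp hy.2]
  have hinj : ∀ y ∈ e.baseSet ∩ b.dom, Function.Injective (Ψ y) := by
    intro y hy
    rw [injective_iff_map_eq_zero]
    intro v hv
    rw [hΨe y hy.1] at hv
    have h1 : e.linearEquivAt ℝ y hy.1 (∑ j, v j • b.sec j y) = 0 := by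
      rw [e.linearEquivAt_apply, hv]
    have h2 := (LinearEquiv.map_eq_zero_iff _).1 h1
    have := Fintype.linearIndependent_iff.1 (b.isFrame.linearIndependent hy.2) v h2
    exact funext this
  have heq : ∀ y ∈ e.baseSet ∩ b.dom, ∃ L : (Fin r → ℝ) ≃L[ℝ] F, (L : (Fin r → ℝ) →L[ℝ] F) = Ψ y := by
    intro y hy
    refine ⟨(LinearEquiv.ofInjectiveOfFinrankEq (Ψ y : (Fin r → ℝ) →ₗ[ℝ] F) (hinj y hy)
      (by simp [r])).toContinuousLinearEquiv, ?_⟩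
    ext1 v
    rfl
  have hΨs : ContMDiffAt (𝓡 m) 𝓘(ℝ, (Fin r → ℝ) →L[ℝ] F) ∞ Ψ q.1 := by
    apply contMDiffAt_finsetSum
    intro j _
    have h1 : ContMDiffAt (𝓡 m) 𝓘(ℝ, F) ∞ (fun y => (e ⟨y, b.sec j y⟩).2) q.1 :=
      (contMDiffAt_section _).1 ((b.sec j).contMDiff.contMDiffAt)
    exact ((ContinuousLinearMap.smulRightL ℝ (Fin r → ℝ) F
      (ContinuousLinearMap.proj (R := ℝ) (φ := fun _ : Fin r => ℝ) j)).contDiff.contMDiff).contMDiffAt.comp _ h1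
  have hinv : ContMDiffAt (𝓡 m) 𝓘(ℝ, F →L[ℝ] (Fin r → ℝ)) ∞
      (fun y => ContinuousLinearMap.inverse (Ψ y)) q.1 := by
    obtain ⟨L, hL⟩ := heq q.1 ⟨hqe, hq⟩
    have h1 := contDiffAt_map_inverse (n := ∞) L
    rw [hL] at h1
    exact h1.contMDiffAt.comp q.1 hΨs
  have hproj : ContMDiffAt ((𝓡 m).prod 𝓘(ℝ, F)) (𝓡 m) ∞ (fun q : TotalSpace F E => q.1) q :=
    (contMDiff_proj E).contMDiffAt
  have hfib : ContMDiffAt ((𝓡 m).prod 𝓘(ℝ, F)) 𝓘(ℝ, F) ∞ (fun q : TotalSpace F E => (e q).2) q := by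
    have := (contMDiffAt_totalSpace (IM := (𝓡 m).prod 𝓘(ℝ, F)) (n := ∞) (f := fun q : TotalSpace F E => q) (x₀ := q)).1 contMDiffAt_id
    exact this.2
  have hfin := ContMDiffAt.clm_apply (ContMDiffAt.comp q hinv hproj) hfib
  have hi : ContMDiffAt ((𝓡 m).prod 𝓘(ℝ, F)) 𝓘(ℝ, ℝ) ∞
      (fun q : TotalSpace F E => (ContinuousLinearMap.inverse (Ψ q.1)) (e q).2 i) q :=
    ((ContinuousLinearMap.proj (R := ℝ) (φ := fun _ : Fin r => ℝ) i).contDiff.contMDiff).contMDiffAt.comp q hfin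
  refine hi.congr_of_eventuallyEq ?_
  have hopen : IsOpen (e.baseSet ∩ b.dom) := e.open_baseSet.inter b.isOpen_dom
  filter_upwards [hproj.continuousAt.preimage_mem_nhds (hopen.mem_nhds ⟨hqe, hq⟩)] with p hp
  obtain ⟨L, hL⟩ := heq p.1 hp
  have h1 := hΨc p.1 hp p.2
  rw [← hL] at h1 ⊢
  rw [ContinuousLinearMap.inverse_equiv]
  have h2 : L (fun j => b.comp j p.1 p.2) = (e p).2 := h1
  rw [← h2]
  simp

end Smooth

end Algebroid

section Derivative

variable {m : ℕ} {M : Type*} [TopologicalSpace M]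
  [ChartedSpace (EuclideanSpace ℝ (Fin m)) M]

lemma mvfderiv_congr {f g : M → ℝ} {x : M} (h : f =ᶠ[𝓝 x] g) :
    mvfderiv (𝓡 m) f x = mvfderiv (𝓡 m) g x := by
  have h1 : mfderiv (𝓡 m) 𝓘(ℝ, ℝ) f x = mfderiv (𝓡 m) 𝓘(ℝ, ℝ) g x := h.mfderiv_eq
  ext v
  exact congrArg (fun (A : TangentSpace (𝓡 m) x →L[ℝ] ℝ) => A v) h1

lemma mvfderiv_mul_apply {f g : M → ℝ} {x : M} (hf : MDifferentiableAt (𝓡 m) 𝓘(ℝ, ℝ) f x)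
    (hg : MDifferentiableAt (𝓡 m) 𝓘(ℝ, ℝ) g x) (v : TangentSpace (𝓡 m) x) :
    mvfderiv (𝓡 m) (fun y => f y * g y) x v
      = f x * mvfderiv (𝓡 m) g x v + g x * mvfderiv (𝓡 m) f x v := by
  rw [mvfderiv_fun_mul hf hg]
  rfl

lemma mvfderiv_sum_apply {ι : Type*} (s : Finset ι) {f : ι → M → ℝ} {x : M}
    (hf : ∀ i ∈ s, MDifferentiableAt (𝓡 m) 𝓘(ℝ, ℝ) (f i) x) (v : TangentSpace (𝓡 m) x) :
    mvfderiv (𝓡 m) (fun y => ∑ i ∈ s, f i y) x v = ∑ i ∈ s, mvfderiv (𝓡 m) (f i) x v := by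
  classical
  have h2 : ∀ s' ⊆ s, MDifferentiableAt (𝓡 m) 𝓘(ℝ, ℝ) (fun y => ∑ i ∈ s', f i y) x ∧
      mvfderiv (𝓡 m) (fun y => ∑ i ∈ s', f i y) x v = ∑ i ∈ s', mvfderiv (𝓡 m) (f i) x v := by
    intro s'
    induction s' using Finset.induction_on with
    | empty =>
      intro _
      simp only [Finset.sum_empty]
      exact ⟨mdifferentiableAt_const, by rw [mvfderiv_const]; rfl⟩
    | insert i s' hi ih =>
      intro hs
      obtain ⟨h3, h4⟩ := ih ((Finset.subset_insert i s').trans hs)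
      have h5 := hf i (hs (Finset.mem_insert_self i s'))
      simp only [Finset.sum_insert hi]
      refine ⟨h5.add h3, ?_⟩
      have := congrArg (fun (A : TangentSpace (𝓡 m) x →L[ℝ] ℝ) => A v) (mvfderiv_add h5 h3)
      rw [← h4]
      exact this
  exact (h2 s subset_rfl).2

end Derivative

section Algebroid

variable {m : ℕ} {M : Type*} [TopologicalSpace M] [T2Space M]
  [ChartedSpace (EuclideanSpace ℝ (Fin m)) M] [IsManifold (𝓡 m) ∞ M]
  {F : Type*} [NormedAddCommGroup F] [NormedSpace ℝ F] [FiniteDimensional ℝ F]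
  {E : M → Type*} [TopologicalSpace (TotalSpace F E)] [∀ x, TopologicalSpace (E x)]
  [∀ x, AddCommGroup (E x)] [∀ x, Module ℝ (E x)] [FiberBundle F E] [VectorBundle ℝ F E]
  [ContMDiffVectorBundle ∞ F E (𝓡 m)]

lemma exists_frame (x₀ : M) : ∃ b : Frame m M F E, x₀ ∈ b.dom := by
  let e := trivializationAt F E x₀
  let β := finBasis ℝ F
  have hx₀ : x₀ ∈ e.baseSet := FiberBundle.mem_baseSet_trivializationAt' x₀
  have hfr := e.isLocalFrameOn_localFrame_baseSet (𝓡 m) (∞ : WithTop ℕ∞) β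
  choose σ hσ using fun i => exists_sec_eventuallyEq e.open_baseSet (hfr.contMDiffOn i) hx₀
  obtain ⟨U, hU, hUo, hxU⟩ := eventually_nhds_iff.1
    (((eventually_all (l := 𝓝 x₀)).2 hσ).and (e.open_baseSet.eventually_mem hx₀))
  refine ⟨⟨σ, U, hUo, ?_⟩, hxU⟩
  exact (hfr.mono fun y hy => (hU y hy).2).congr fun i y hy => ((hU y hy).1 i).symm

lemma Frame.contMDiffAt_comp (b : Frame m M F E) (i : Fin (finrank ℝ F))
    {G H N : Type*} [NormedAddCommGroup G] [NormedSpace ℝ G] [TopologicalSpace H]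
    [TopologicalSpace N] [ChartedSpace H N] {J : ModelWithCorners ℝ G H}
    {p : N → TotalSpace F E} {z : N} (hp : ContMDiffAt J ((𝓡 m).prod 𝓘(ℝ, F)) ∞ p z)
    (hz : (p z).1 ∈ b.dom) :
    ContMDiffAt J 𝓘(ℝ, ℝ) ∞ (fun z => b.comp i (p z).1 (p z).2) z :=
  (b.contMDiffAt_comp_totalSpace i hz).comp z hp

lemma Frame.contMDiffAt_comp_sec (b : Frame m M F E) (i : Fin (finrank ℝ F)) (s : Sec m M F E)
    {x : M} (hx : x ∈ b.dom) :
    ContMDiffAt (𝓡 m) 𝓘(ℝ, ℝ) ∞ (fun y => b.comp i y (s y)) x :=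
  b.contMDiffAt_comp i s.contMDiff.contMDiffAt hx

lemma Frame.exists_eq_sum (b : Frame m M F E) (s : Sec m M F E) {x : M} (hx : x ∈ b.dom) :
    ∃ (f : Fin (finrank ℝ F) → M → ℝ) (hf : ∀ i, ContMDiff (𝓡 m) 𝓘(ℝ, ℝ) ∞ (f i)),
      (∀ i, f i =ᶠ[𝓝 x] fun y => b.comp i y (s y)) ∧
      ∀ᶠ y in 𝓝 x, s y = (∑ i, smulSec (f i) (hf i) (b.sec i)) y := by
  choose f hf hf' using fun i => exists_contMDiff_eventuallyEq (m := m) b.isOpen_dom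
    (fun y hy => (b.contMDiffAt_comp_sec i s hy).contMDiffWithinAt) hx
  refine ⟨f, hf, hf', ?_⟩
  filter_upwards [(eventually_all (l := 𝓝 x)).2 hf', b.isOpen_dom.mem_nhds hx] with y hy hyd
  rw [sec_sum_apply]
  simp only [smulSec_apply, hy]
  exact (b.sum_comp hyd _).symm

/-- The Leibniz rule in components. -/
lemma LieAlgebroid.comp_bracket_right (L : LieAlgebroid m M F E) (b : Frame m M F E)
    (a s : Sec m M F E) {x : M} (hx : x ∈ b.dom) (k : Fin (finrank ℝ F)) :
    b.comp k x (L.bracket a s x)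
      = ∑ j, b.comp j x (s x) * b.comp k x (L.bracket a (b.sec j) x)
        + mvfderiv (𝓡 m) (fun y => b.comp k y (s y)) x (L.anchor x (a x)) := by
  obtain ⟨f, hf, hf', hs⟩ := b.exists_eq_sum s hx
  rw [L.bracket_congr a hs, map_sum, sec_sum_apply, map_sum, ← mvfderiv_congr (hf' k)]
  simp only [L.bracket_smulSec, map_add, map_smul, b.comp_sec hx, smul_eq_mul,
    Finset.sum_add_distrib, mul_ite, mul_one, mul_zero, Finset.sum_ite_eq', Finset.mem_univ,
    if_true]
  congr 1
  exact Finset.sum_congr rfl fun j _ => by rw [(hf' j).eq_of_nhds]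

/-- The bracket in components:
`[a, s]^K = c_{IJ}^K a^I s^J + ρ(a) s^K - ρ(s) a^K`. -/
lemma LieAlgebroid.comp_bracket (L : LieAlgebroid m M F E) (b : Frame m M F E)
    (a s : Sec m M F E) {x : M} (hx : x ∈ b.dom) (k : Fin (finrank ℝ F)) :
    b.comp k x (L.bracket a s x)
      = ∑ i, ∑ j, L.structureFun b i j k x * b.comp i x (a x) * b.comp j x (s x)
        + mvfderiv (𝓡 m) (fun y => b.comp k y (s y)) x (L.anchor x (a x))
        - mvfderiv (𝓡 m) (fun y => b.comp k y (a y)) x (L.anchor x (s x)) := by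
  have h1 : ∀ j, b.comp k x (L.bracket a (b.sec j) x)
      = ∑ i, L.structureFun b i j k x * b.comp i x (a x)
        - mvfderiv (𝓡 m) (fun y => b.comp k y (a y)) x (L.anchor x (b.sec j x)) := by
    intro j
    rw [L.bracket_antisymm, ContMDiffSection.coe_neg, Pi.neg_apply, map_neg,
      L.comp_bracket_right b _ _ hx, neg_add, ← sub_eq_add_neg, ← Finset.sum_neg_distrib]
    congr 1
    refine Finset.sum_congr rfl fun i _ => ?_
    rw [L.bracket_antisymm, ContMDiffSection.coe_neg, Pi.neg_apply, map_neg,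
      LieAlgebroid.structureFun]
    ring
  rw [L.comp_bracket_right b _ _ hx]
  simp only [h1, mul_sub, Finset.sum_sub_distrib]
  have h2 : mvfderiv (𝓡 m) (fun y => b.comp k y (a y)) x (L.anchor x (s x))
      = ∑ j, b.comp j x (s x)
        * mvfderiv (𝓡 m) (fun y => b.comp k y (a y)) x (L.anchor x (b.sec j x)) := by
    conv_lhs => rw [← b.sum_comp hx (s x)]
    simp [map_sum]
  rw [h2, Finset.sum_comm]
  simp only [Finset.mul_sum]
  have h3 : ∀ i j, b.comp j x (s x) * (L.structureFun b i j k x * b.comp i x (a x))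
    = L.structureFun b i j k x * b.comp i x (a x) * b.comp j x (s x) := fun i j => by ring
  simp only [h3]
  ring

lemma LieAlgebroid.contMDiff_anchor_apply (L : LieAlgebroid m M F E) (a : Sec m M F E) :
    ContMDiff (𝓡 m) (𝓡 m).tangent ∞
      (fun x => (⟨x, L.anchor x (a x)⟩ : TangentBundle (𝓡 m) M)) :=
  L.anchor_smooth.comp a.contMDiff

lemma contMDiff_mvfderiv_apply {f : M → ℝ} (hf : ContMDiff (𝓡 m) 𝓘(ℝ, ℝ) ∞ f)
    {V : ∀ x : M, TangentSpace (𝓡 m) x}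
    (hV : ContMDiff (𝓡 m) (𝓡 m).tangent ∞ (fun x => (⟨x, V x⟩ : TangentBundle (𝓡 m) M))) :
    ContMDiff (𝓡 m) 𝓘(ℝ, ℝ) ∞ (fun x => mvfderiv (𝓡 m) f x (V x)) := by
  have h1 := (hf.contMDiff_tangentMap (m := ∞) (by simp)).comp hV
  exact contMDiff_snd_tangentBundle_modelSpace (n := ∞) ℝ 𝓘(ℝ, ℝ) |>.comp h1

/-- The anchor is a homomorphism of Lie algebras: this follows from the Jacobi identity for
`a`, `b` and `f c`, where `c` does not vanish at the point under consideration. -/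
lemma LieAlgebroid.anchor_bracket (L : LieAlgebroid m M F E) (a b c : Sec m M F E) {x : M}
    (hc : c x ≠ 0) {f : M → ℝ} (hf : ContMDiff (𝓡 m) 𝓘(ℝ, ℝ) ∞ f) :
    mvfderiv (𝓡 m) f x (L.anchor x (L.bracket a b x))
      = mvfderiv (𝓡 m) (fun y => mvfderiv (𝓡 m) f y (L.anchor y (b y))) x (L.anchor x (a x))
        - mvfderiv (𝓡 m) (fun y => mvfderiv (𝓡 m) f y (L.anchor y (a y))) x (L.anchor x (b x)) := by
  have ha := contMDiff_mvfderiv_apply hf (L.contMDiff_anchor_apply a)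
  have hb := contMDiff_mvfderiv_apply hf (L.contMDiff_anchor_apply b)
  have key : ∀ (s : Sec m M F E) (hs : ContMDiff (𝓡 m) 𝓘(ℝ, ℝ) ∞
      (fun y => mvfderiv (𝓡 m) f y (L.anchor y (s y)))),
      L.bracket s (smulSec f hf c) = smulSec f hf (L.bracket s c) + smulSec _ hs c := by
    intro s hs
    ext y
    rw [L.bracket_smulSec]
    rfl
  have hj := congrArg (fun s : Sec m M F E => s x) (L.jacobi a b (smulSec f hf c))
  have hj0 := congrArg (fun s : Sec m M F E => s x) (L.jacobi a b c)
  rw [key b hb, key a ha, map_add, map_add] at hj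
  simp only [ContMDiffSection.coe_add, Pi.add_apply, L.bracket_smulSec] at hj hj0
  rw [hj0] at hj
  have h2 : (mvfderiv (𝓡 m) (fun y => mvfderiv (𝓡 m) f y (L.anchor y (b y))) x (L.anchor x (a x))
        - mvfderiv (𝓡 m) (fun y => mvfderiv (𝓡 m) f y (L.anchor y (a y))) x (L.anchor x (b x))
        - mvfderiv (𝓡 m) f x (L.anchor x (L.bracket a b x))) • c x = 0 := by
    linear_combination (norm := module) hj
  rcases smul_eq_zero.1 h2 with h3 | h3
  · linarith
  · exact absurd h3 hc

end Algebroid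

/-! ### Coordinate expressions on the tangent bundle -/

section Chart

variable {d : ℕ} {W : Type*} [TopologicalSpace W] [ChartedSpace (EuclideanSpace ℝ (Fin d)) W]
  [IsManifold (𝓡 d) ∞ W]

lemma contMDiffAt_chart {x₀ p : W} (hp : p ∈ (extChartAt (𝓡 d) x₀).source) :
    ContMDiffAt (𝓡 d) 𝓘(ℝ, EuclideanSpace ℝ (Fin d)) ∞ (extChartAt (𝓡 d) x₀) p :=
  contMDiffAt_extChartAt' (by rwa [extChartAt_source] at hp)

lemma contMDiffAt_chart_symm {x₀ : W} {y : EuclideanSpace ℝ (Fin d)}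
    (hy : y ∈ (extChartAt (𝓡 d) x₀).target) :
    ContMDiffAt 𝓘(ℝ, EuclideanSpace ℝ (Fin d)) (𝓡 d) ∞ (extChartAt (𝓡 d) x₀).symm y :=
  (contMDiffOn_extChartAt_symm x₀).contMDiffAt ((isOpen_extChartAt_target x₀).mem_nhds hy)

lemma mfderiv_chart_coordVec {x₀ : W} {y : EuclideanSpace ℝ (Fin d)}
    (hy : y ∈ (extChartAt (𝓡 d) x₀).target) (u : EuclideanSpace ℝ (Fin d)) :
    mfderiv (𝓡 d) 𝓘(ℝ, EuclideanSpace ℝ (Fin d)) (extChartAt (𝓡 d) x₀)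
      ((extChartAt (𝓡 d) x₀).symm y) (coordVec x₀ y u) = u := by
  have h := mfderiv_extChartAt_comp_mfderivWithin_extChartAt_symm (I := 𝓡 d) hy
  simp only [modelWithCornersSelf_coe, range_id, mfderivWithin_univ] at h
  exact congrArg (fun A : EuclideanSpace ℝ (Fin d) →L[ℝ] EuclideanSpace ℝ (Fin d) => A u) h

lemma coordVec_mfderiv_chart {x₀ : W} {y : EuclideanSpace ℝ (Fin d)}
    (hy : y ∈ (extChartAt (𝓡 d) x₀).target)
    (v : TangentSpace (𝓡 d) ((extChartAt (𝓡 d) x₀).symm y)) :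
    coordVec x₀ y (mfderiv (𝓡 d) 𝓘(ℝ, EuclideanSpace ℝ (Fin d)) (extChartAt (𝓡 d) x₀)
      ((extChartAt (𝓡 d) x₀).symm y) v) = v := by
  have h := mfderivWithin_extChartAt_symm_comp_mfderiv_extChartAt (I := 𝓡 d) hy
  simp only [modelWithCornersSelf_coe, range_id, mfderivWithin_univ] at h
  exact congrArg (fun A : EuclideanSpace ℝ (Fin d) →L[ℝ] EuclideanSpace ℝ (Fin d) => A v) h

lemma mfderiv_chart_self (x : W) (u : TangentSpace (𝓡 d) x) :
    mfderiv (𝓡 d) 𝓘(ℝ, EuclideanSpace ℝ (Fin d)) (extChartAt (𝓡 d) x) x u = u := by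
  rw [mfderiv_extChartAt_self]
  rfl

/-- In the chart at `x`, a tangent vector at `x` is its own coordinate expression. -/
lemma apply_coordVec_self {α : Type*} (x : W) (f : ∀ p : W, TangentSpace (𝓡 d) p → α)
    (u : EuclideanSpace ℝ (Fin d)) :
    f _ (coordVec x (extChartAt (𝓡 d) x x) u) = f x u := by
  have hy := mem_extChartAt_target (I := 𝓡 d) x
  have h1 := mfderiv_chart_coordVec hy u
  generalize coordVec x (extChartAt (𝓡 d) x x) u = v at h1
  have key : ∀ (p : W) (hp : p = x) (v : TangentSpace (𝓡 d) p),
      mfderiv (𝓡 d) 𝓘(ℝ, EuclideanSpace ℝ (Fin d)) (extChartAt (𝓡 d) x) p v = u →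
      f p v = f x u := by
    intro p hp v hv
    subst hp
    rw [mfderiv_chart_self] at hv
    exact congrArg (f p) hv
  exact key _ (extChartAt_to_inv (I := 𝓡 d) x) v h1

/-- A map to the tangent bundle is smooth if and only if its coordinate expression is. -/
lemma contMDiffAt_tangent_iff {G H N : Type*} [NormedAddCommGroup G] [NormedSpace ℝ G]
    [TopologicalSpace H] [TopologicalSpace N] [ChartedSpace H N] {J : ModelWithCorners ℝ G H}
    {p : N → TangentBundle (𝓡 d) W} {z : N} {x₀ : W}
    (hz : (p z).1 ∈ (extChartAt (𝓡 d) x₀).source) :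
    ContMDiffAt J (𝓡 d).tangent ∞ p z ↔ ContMDiffAt J (𝓡 d) ∞ (fun z => (p z).1) z ∧
      ContMDiffAt J 𝓘(ℝ, EuclideanSpace ℝ (Fin d)) ∞
        (fun z => mfderiv (𝓡 d) 𝓘(ℝ, EuclideanSpace ℝ (Fin d)) (extChartAt (𝓡 d) x₀)
          (p z).1 (p z).2) z := by
  rw [extChartAt_source] at hz
  let e := trivializationAt (EuclideanSpace ℝ (Fin d)) (TangentSpace (𝓡 d)) x₀
  have hze : p z ∈ e.source := by
    rw [e.mem_source]
    exact hz
  rw [Bundle.Trivialization.contMDiffAt_iff (e := e) hze]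
  refine and_congr_right fun h1 => ?_
  have h2 : (fun z => (e (p z)).2) =ᶠ[𝓝 z] fun z =>
      (mfderiv (𝓡 d) 𝓘(ℝ, EuclideanSpace ℝ (Fin d)) (extChartAt (𝓡 d) x₀)
          (p z).1 (p z).2 : EuclideanSpace ℝ (Fin d)) := by
    filter_upwards [h1.continuousAt.preimage_mem_nhds
      ((chartAt (EuclideanSpace ℝ (Fin d)) x₀).open_source.mem_nhds hz)] with q hq
    have h3 := TangentBundle.continuousLinearMapAt_trivializationAt (I := 𝓡 d) (x := (p q).1) hq
    have h4 := congrArg (fun A : EuclideanSpace ℝ (Fin d) →L[ℝ] EuclideanSpace ℝ (Fin d) =>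
      A (p q).2) h3
    refine Eq.trans ?_ h4
    have := e.coe_linearMapAt_of_mem (R := ℝ) (b := (p q).1) hq
    exact (congrFun this (p q).2).symm
  exact h2.contMDiffAt_iff

/-- The tangent vector with given coordinates depends smoothly on its coordinates and on those of
its base point. -/
lemma contMDiffAt_coordVec {x₀ : W} {y : EuclideanSpace ℝ (Fin d)}
    (hy : y ∈ (extChartAt (𝓡 d) x₀).target) (u : EuclideanSpace ℝ (Fin d)) :
    ContMDiffAt 𝓘(ℝ, EuclideanSpace ℝ (Fin d) × EuclideanSpace ℝ (Fin d)) (𝓡 d).tangent ∞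
      (fun q : EuclideanSpace ℝ (Fin d) × EuclideanSpace ℝ (Fin d) =>
        (⟨(extChartAt (𝓡 d) x₀).symm q.1, coordVec x₀ q.1 q.2⟩ : TangentBundle (𝓡 d) W)) (y, u) := by
  rw [contMDiffAt_tangent_iff (x₀ := x₀) ((extChartAt (𝓡 d) x₀).map_target hy)]
  constructor
  · exact ContMDiffAt.comp (g := (extChartAt (𝓡 d) x₀).symm) (y, u) (contMDiffAt_chart_symm hy)
      contDiff_fst.contMDiff.contMDiffAt
  · refine contDiff_snd.contMDiff.contMDiffAt.congr_of_eventuallyEq ?_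
    filter_upwards [continuous_fst.continuousAt.preimage_mem_nhds
      ((isOpen_extChartAt_target (I := 𝓡 d) x₀).mem_nhds (x := (y, u).1) hy)] with q hq
    exact mfderiv_chart_coordVec hq q.2

end Chart

section Target

variable {d : ℕ} {W : Type*} [TopologicalSpace W] [ChartedSpace (EuclideanSpace ℝ (Fin d)) W]
  [IsManifold (𝓡 d) ∞ W]
  {m : ℕ} {M : Type*} [TopologicalSpace M]
  [ChartedSpace (EuclideanSpace ℝ (Fin m)) M] [IsManifold (𝓡 m) ∞ M]
  {F : Type*} [NormedAddCommGroup F] [NormedSpace ℝ F]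
  {E : M → Type*} [TopologicalSpace (TotalSpace F E)] [∀ x, TopologicalSpace (E x)]
  [∀ x, AddCommGroup (E x)] [∀ x, Module ℝ (E x)] [FiberBundle F E] [VectorBundle ℝ F E]

lemma FieldConfig.contMDiff_base (φ : FieldConfig d W m M F E) :
    ContMDiff (𝓡 d) (𝓡 m) ∞ φ.base :=
  (contMDiff_proj E).comp (φ.smooth.comp
    (contMDiff_zeroSection ℝ (TangentSpace (𝓡 d) : W → Type _)))

lemma hasFDerivAt_comp_chart_symm {f : M → ℝ} {X : W → M} {x₀ : W}
    {y : EuclideanSpace ℝ (Fin d)} (hy : y ∈ (extChartAt (𝓡 d) x₀).target)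
    (hX : MDifferentiableAt (𝓡 d) (𝓡 m) X ((extChartAt (𝓡 d) x₀).symm y))
    (hf : MDifferentiableAt (𝓡 m) 𝓘(ℝ, ℝ) f (X ((extChartAt (𝓡 d) x₀).symm y)))
    (u : EuclideanSpace ℝ (Fin d)) :
    DifferentiableAt ℝ (fun z => f (X ((extChartAt (𝓡 d) x₀).symm z))) y ∧
    fderiv ℝ (fun z => f (X ((extChartAt (𝓡 d) x₀).symm z))) y u
      = mvfderiv (𝓡 m) f (X ((extChartAt (𝓡 d) x₀).symm y))
        (mfderiv (𝓡 d) (𝓡 m) X ((extChartAt (𝓡 d) x₀).symm y) (coordVec x₀ y u)) := by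
  have hs := (contMDiffAt_chart_symm hy).mdifferentiableAt (by simp)
  have h := hf.hasMFDerivAt.comp y (hX.hasMFDerivAt.comp y hs.hasMFDerivAt)
  refine ⟨h.mdifferentiableAt.differentiableAt, ?_⟩
  have h2 := h.mfderiv
  rw [mfderiv_eq_fderiv] at h2
  exact congrArg (fun A : EuclideanSpace ℝ (Fin d) →L[ℝ] ℝ => A u) h2

end Target

/-! ### The algebroid in coordinates -/

section Calculus

lemma contDiffAt_sum_proj_smulRight {Y Z : Type*} [NormedAddCommGroup Y] [NormedSpace ℝ Y]
    [NormedAddCommGroup Z] [NormedSpace ℝ Z] {r : ℕ} {v : Fin r → Y → Z} {y : Y}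
    (hv : ∀ i, ContDiffAt ℝ ∞ (v i) y) :
    ContDiffAt ℝ ∞ (fun z => ∑ i,
      (ContinuousLinearMap.proj (R := ℝ) (φ := fun _ : Fin r => ℝ) i).smulRight (v i z)) y :=
  ContDiffAt.sum fun i _ => ((ContinuousLinearMap.smulRightL ℝ (Fin r → ℝ) Z
    (ContinuousLinearMap.proj (R := ℝ) (φ := fun _ : Fin r => ℝ) i)).contDiff).contDiffAt.comp y
      (hv i)

lemma fderiv_apply_const {Y R Z : Type*} [NormedAddCommGroup Y] [NormedSpace ℝ Y]
    [NormedAddCommGroup R] [NormedSpace ℝ R] [NormedAddCommGroup Z] [NormedSpace ℝ Z]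
    {c : Y → R →L[ℝ] Z} {y : Y} (hc : DifferentiableAt ℝ c y) (η : R) (l : Z →L[ℝ] ℝ) (v : Y) :
    DifferentiableAt ℝ (fun z => l (c z η)) y ∧
      fderiv ℝ (fun z => l (c z η)) y v = l (fderiv ℝ c y v η) := by
  have h := l.hasFDerivAt.comp y (hc.hasFDerivAt.clm_apply (hasFDerivAt_const η y))
  refine ⟨h.differentiableAt, ?_⟩
  have h2 := h.fderiv
  rw [Function.comp_def] at h2
  rw [h2]
  simp

lemma fderiv_apply_apply_const {Y R Z : Type*} [NormedAddCommGroup Y] [NormedSpace ℝ Y]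
    [NormedAddCommGroup R] [NormedSpace ℝ R] [NormedAddCommGroup Z] [NormedSpace ℝ Z]
    {c : Y → R →L[ℝ] R →L[ℝ] Z} {y : Y} (hc : DifferentiableAt ℝ c y) (η ζ : R) (l : Z →L[ℝ] ℝ)
    (v : Y) :
    DifferentiableAt ℝ (fun z => l (c z η ζ)) y ∧
      fderiv ℝ (fun z => l (c z η ζ)) y v = l (fderiv ℝ c y v η ζ) := by
  have h1 := hc.hasFDerivAt.clm_apply (hasFDerivAt_const η y)
  have h := fderiv_apply_const h1.differentiableAt ζ l v
  refine ⟨h.1, ?_⟩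
  rw [h.2, h1.fderiv]
  simp

end Calculus

section Target

variable {m : ℕ} {M : Type*} [TopologicalSpace M] [T2Space M]
  [ChartedSpace (EuclideanSpace ℝ (Fin m)) M] [IsManifold (𝓡 m) ∞ M]
  {F : Type*} [NormedAddCommGroup F] [NormedSpace ℝ F]
  {E : M → Type*} [TopologicalSpace (TotalSpace F E)] [∀ x, TopologicalSpace (E x)]
  [∀ x, AddCommGroup (E x)] [∀ x, Module ℝ (E x)] [FiberBundle F E] [VectorBundle ℝ F E]

/-- The section `ξ^I b_I` with constant components. -/
def Frame.constSec (b : Frame m M F E) (ξ : Fin (finrank ℝ F) → ℝ) : Sec m M F E :=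
  ∑ i, ξ i • b.sec i

lemma Frame.constSec_apply (b : Frame m M F E) (ξ : Fin (finrank ℝ F) → ℝ) (x : M) :
    b.constSec ξ x = ∑ i, ξ i • b.sec i x := by
  rw [Frame.constSec, sec_sum_apply]
  rfl

lemma Frame.comp_sum (b : Frame m M F E) {x : M} (hx : x ∈ b.dom) (ξ : Fin (finrank ℝ F) → ℝ)
    (k : Fin (finrank ℝ F)) : b.comp k x (∑ i, ξ i • b.sec i x) = ξ k := by
  simp [b.comp_sec hx]

/-- The domain of a local basis in the coordinates around `x₀`. -/
def Frame.coordDom (b : Frame m M F E) (x₀ : M) : Set (EuclideanSpace ℝ (Fin m)) :=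
  (extChartAt (𝓡 m) x₀).target ∩ (extChartAt (𝓡 m) x₀).symm ⁻¹' b.dom

lemma Frame.isOpen_coordDom (b : Frame m M F E) (x₀ : M) : IsOpen (b.coordDom x₀) :=
  (continuousOn_extChartAt_symm x₀).isOpen_inter_preimage (isOpen_extChartAt_target x₀) b.isOpen_dom

/-- The anchor in coordinates: `ξ ↦ ρ_I^i ξ^I`. -/
def LieAlgebroid.anchorCoord (L : LieAlgebroid m M F E) (b : Frame m M F E) (x₀ : M)
    (y : EuclideanSpace ℝ (Fin m)) : (Fin (finrank ℝ F) → ℝ) →L[ℝ] EuclideanSpace ℝ (Fin m) :=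
  ∑ i, (ContinuousLinearMap.proj (R := ℝ) (φ := fun _ : Fin (finrank ℝ F) => ℝ) i).smulRight
    (mfderiv (𝓡 m) 𝓘(ℝ, EuclideanSpace ℝ (Fin m)) (extChartAt (𝓡 m) x₀)
      ((extChartAt (𝓡 m) x₀).symm y) (L.anchor _ (b.sec i ((extChartAt (𝓡 m) x₀).symm y))) :
      EuclideanSpace ℝ (Fin m))

/-- The structure functions in coordinates: `(ξ, η) ↦ c_{JK}^I ξ^J η^K`. -/
def LieAlgebroid.structCoord (L : LieAlgebroid m M F E) (b : Frame m M F E) (x₀ : M)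
    (y : EuclideanSpace ℝ (Fin m)) :
    (Fin (finrank ℝ F) → ℝ) →L[ℝ] (Fin (finrank ℝ F) → ℝ) →L[ℝ] (Fin (finrank ℝ F) → ℝ) :=
  ∑ i, (ContinuousLinearMap.proj (R := ℝ) (φ := fun _ : Fin (finrank ℝ F) => ℝ) i).smulRight
    (∑ j, (ContinuousLinearMap.proj (R := ℝ) (φ := fun _ : Fin (finrank ℝ F) => ℝ) j).smulRight
      (fun k => L.structureFun b i j k ((extChartAt (𝓡 m) x₀).symm y)))

lemma LieAlgebroid.anchorCoord_apply (L : LieAlgebroid m M F E) (b : Frame m M F E) (x₀ : M)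
    (y : EuclideanSpace ℝ (Fin m)) (ξ : Fin (finrank ℝ F) → ℝ) :
    L.anchorCoord b x₀ y ξ = mfderiv (𝓡 m) 𝓘(ℝ, EuclideanSpace ℝ (Fin m)) (extChartAt (𝓡 m) x₀)
      ((extChartAt (𝓡 m) x₀).symm y) (L.anchor _ (b.constSec ξ ((extChartAt (𝓡 m) x₀).symm y))) := by
  rw [b.constSec_apply, map_sum, map_sum]
  simp only [LieAlgebroid.anchorCoord, sum_apply, map_smul]
  rfl

lemma LieAlgebroid.structCoord_apply_eq_sum (L : LieAlgebroid m M F E) (b : Frame m M F E) (x₀ : M)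
    (y : EuclideanSpace ℝ (Fin m)) (ξ η : Fin (finrank ℝ F) → ℝ) (k : Fin (finrank ℝ F)) :
    L.structCoord b x₀ y ξ η k
      = ∑ i, ∑ j, L.structureFun b i j k ((extChartAt (𝓡 m) x₀).symm y) * ξ i * η j := by
  simp only [LieAlgebroid.structCoord, sum_apply, Finset.sum_apply,
    ContinuousLinearMap.smulRight_apply, ContinuousLinearMap.proj_apply, smul_apply,
    Pi.smul_apply, smul_eq_mul, Finset.mul_sum]
  exact Finset.sum_congr rfl fun i _ => Finset.sum_congr rfl fun j _ => by ring

lemma LieAlgebroid.structCoord_apply (L : LieAlgebroid m M F E) (b : Frame m M F E) (x₀ : M)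
    (y : EuclideanSpace ℝ (Fin m)) (ξ η : Fin (finrank ℝ F) → ℝ) (k : Fin (finrank ℝ F)) :
    L.structCoord b x₀ y ξ η k = b.comp k ((extChartAt (𝓡 m) x₀).symm y)
      (L.bracket (b.constSec ξ) (b.constSec η) ((extChartAt (𝓡 m) x₀).symm y)) := by
  rw [L.structCoord_apply_eq_sum]
  simp only [Frame.constSec, map_sum, map_smul, LinearMap.sum_apply, LinearMap.smul_apply]
  rw [sec_sum_apply, map_sum]
  rw [Finset.sum_comm]
  refine Finset.sum_congr rfl fun j _ => ?_
  rw [ContMDiffSection.coe_smul, Pi.smul_apply, sec_sum_apply, map_smul, map_sum, smul_eq_mul,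
    Finset.mul_sum]
  refine Finset.sum_congr rfl fun i _ => ?_
  rw [ContMDiffSection.coe_smul, Pi.smul_apply, map_smul, smul_eq_mul, LieAlgebroid.structureFun]
  ring

lemma mvfderiv_comp_chart {x₀ : M} {y : EuclideanSpace ℝ (Fin m)}
    (hy : y ∈ (extChartAt (𝓡 m) x₀).target) {G : EuclideanSpace ℝ (Fin m) → ℝ}
    (hG : DifferentiableAt ℝ G y) (V : TangentSpace (𝓡 m) ((extChartAt (𝓡 m) x₀).symm y)) :
    mvfderiv (𝓡 m) (fun q => G (extChartAt (𝓡 m) x₀ q)) ((extChartAt (𝓡 m) x₀).symm y) V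
      = fderiv ℝ G y (mfderiv (𝓡 m) 𝓘(ℝ, EuclideanSpace ℝ (Fin m)) (extChartAt (𝓡 m) x₀)
          ((extChartAt (𝓡 m) x₀).symm y) V) := by
  have h1 := (contMDiffAt_chart ((extChartAt (𝓡 m) x₀).map_target hy)).mdifferentiableAt (by simp)
  have h3 := (extChartAt (𝓡 m) x₀).right_inv hy
  have h2 : HasMFDerivAt 𝓘(ℝ, EuclideanSpace ℝ (Fin m)) 𝓘(ℝ, ℝ) G
      (extChartAt (𝓡 m) x₀ ((extChartAt (𝓡 m) x₀).symm y)) (fderiv ℝ G y) := by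
    rw [h3]; exact hG.hasFDerivAt.hasMFDerivAt
  have h4 := (h2.comp _ h1.hasMFDerivAt).mfderiv
  exact congrArg (fun A : EuclideanSpace ℝ (Fin m) →L[ℝ] ℝ => A V) h4

variable [FiniteDimensional ℝ F] [ContMDiffVectorBundle ∞ F E (𝓡 m)]

lemma LieAlgebroid.contDiffOn_anchorCoord (L : LieAlgebroid m M F E) (b : Frame m M F E) (x₀ : M) :
    ContDiffOn ℝ ∞ (L.anchorCoord b x₀) (b.coordDom x₀) := by
  intro y hy
  refine (contDiffAt_sum_proj_smulRight fun i => ?_).contDiffWithinAt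
  have h1 := (contMDiffAt_tangent_iff (x₀ := x₀) ((extChartAt (𝓡 m) x₀).map_target hy.1)).1
    (L.contMDiff_anchor_apply (b.sec i)).contMDiffAt
  exact (h1.2.comp y (contMDiffAt_chart_symm hy.1)).contDiffAt

lemma LieAlgebroid.contDiffOn_structCoord (L : LieAlgebroid m M F E) (b : Frame m M F E) (x₀ : M) :
    ContDiffOn ℝ ∞ (L.structCoord b x₀) (b.coordDom x₀) := by
  intro y hy
  refine (contDiffAt_sum_proj_smulRight fun i => contDiffAt_sum_proj_smulRight fun j =>
    contDiffAt_pi.2 fun k => ?_).contDiffWithinAt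
  exact ((b.contMDiffAt_comp_sec k (L.bracket (b.sec i) (b.sec j)) hy.2).comp y
    (contMDiffAt_chart_symm hy.1)).contDiffAt

lemma LieAlgebroid.structCoord_antisymm (L : LieAlgebroid m M F E) (b : Frame m M F E) (x₀ : M)
    (y : EuclideanSpace ℝ (Fin m)) (ξ η : Fin (finrank ℝ F) → ℝ) :
    L.structCoord b x₀ y ξ η = - L.structCoord b x₀ y η ξ := by
  ext k
  rw [Pi.neg_apply, L.structCoord_apply, L.structCoord_apply, L.bracket_antisymm,
    ContMDiffSection.coe_neg, Pi.neg_apply, map_neg]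

lemma LieAlgebroid.comp_bracket_bracket (L : LieAlgebroid m M F E) (b : Frame m M F E) {x₀ : M}
    {y : EuclideanSpace ℝ (Fin m)} (hy : y ∈ b.coordDom x₀) (ξ η ζ : Fin (finrank ℝ F) → ℝ)
    (k : Fin (finrank ℝ F)) :
    b.comp k ((extChartAt (𝓡 m) x₀).symm y)
        (L.bracket (b.constSec ξ) (L.bracket (b.constSec η) (b.constSec ζ))
          ((extChartAt (𝓡 m) x₀).symm y))
      = (fderiv ℝ (L.structCoord b x₀) y (L.anchorCoord b x₀ y ξ) η ζ
        + L.structCoord b x₀ y ξ (L.structCoord b x₀ y η ζ)) k := by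
  have hc : DifferentiableAt ℝ (L.structCoord b x₀) y :=
    ((L.contDiffOn_structCoord b x₀).contDiffAt ((b.isOpen_coordDom x₀).mem_nhds hy)).differentiableAt
      (by simp)
  rw [L.comp_bracket_right b _ _ hy.2, Pi.add_apply, add_comm]
  congr 1
  · have h1 : (fun q => b.comp k q (L.bracket (b.constSec η) (b.constSec ζ) q))
        =ᶠ[𝓝 ((extChartAt (𝓡 m) x₀).symm y)]
        fun q => L.structCoord b x₀ (extChartAt (𝓡 m) x₀ q) η ζ k := by
      filter_upwards [(isOpen_extChartAt_source (I := 𝓡 m) x₀).mem_nhds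
        ((extChartAt (𝓡 m) x₀).map_target hy.1)] with q hq
      rw [L.structCoord_apply, (extChartAt (𝓡 m) x₀).left_inv hq]
    have h2 := fderiv_apply_apply_const hc η ζ
      (ContinuousLinearMap.proj (R := ℝ) (φ := fun _ : Fin (finrank ℝ F) => ℝ) k)
      (L.anchorCoord b x₀ y ξ)
    rw [mvfderiv_congr h1]
    refine (mvfderiv_comp_chart hy.1 h2.1 _).trans ?_
    rw [← L.anchorCoord_apply]
    exact h2.2
  · simp only [← L.structCoord_apply b x₀ y η ζ]
    rw [L.structCoord_apply b x₀ y ξ]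
    conv_rhs => rw [Frame.constSec.eq_def b (L.structCoord b x₀ y η ζ)]
    rw [map_sum, sec_sum_apply, map_sum]
    refine Finset.sum_congr rfl fun j _ => ?_
    rw [map_smul, ContMDiffSection.coe_smul, Pi.smul_apply, map_smul, smul_eq_mul]

/-- The Jacobi identity in coordinates. -/
lemma LieAlgebroid.structCoord_jacobi (L : LieAlgebroid m M F E) (b : Frame m M F E) {x₀ : M}
    {y : EuclideanSpace ℝ (Fin m)} (hy : y ∈ b.coordDom x₀) (ξ η ζ : Fin (finrank ℝ F) → ℝ) :
    fderiv ℝ (L.structCoord b x₀) y (L.anchorCoord b x₀ y ξ) η ζ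
      + fderiv ℝ (L.structCoord b x₀) y (L.anchorCoord b x₀ y η) ζ ξ
      + fderiv ℝ (L.structCoord b x₀) y (L.anchorCoord b x₀ y ζ) ξ η
      + L.structCoord b x₀ y ξ (L.structCoord b x₀ y η ζ)
      + L.structCoord b x₀ y η (L.structCoord b x₀ y ζ ξ)
      + L.structCoord b x₀ y ζ (L.structCoord b x₀ y ξ η) = 0 := by
  ext k
  have h1 := L.comp_bracket_bracket b hy ξ η ζ k
  have h2 := L.comp_bracket_bracket b hy η ζ ξ k
  have h3 := L.comp_bracket_bracket b hy ζ ξ η k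
  have hj := L.jacobi (b.constSec ξ) (b.constSec η) (b.constSec ζ)
  rw [L.bracket_antisymm (L.bracket (b.constSec ξ) (b.constSec η)),
    L.bracket_antisymm (b.constSec ξ) (b.constSec ζ), map_neg] at hj
  have hk := congrArg (fun s : Sec m M F E => b.comp k ((extChartAt (𝓡 m) x₀).symm y)
    (s ((extChartAt (𝓡 m) x₀).symm y))) hj
  simp only [ContMDiffSection.coe_add, ContMDiffSection.coe_neg, Pi.add_apply, Pi.neg_apply,
    map_add, map_neg] at hk
  rw [h1, h2, h3] at hk
  simp only [Pi.add_apply, Pi.zero_apply] at hk ⊢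
  linarith

/-- In coordinates, the anchor is a homomorphism of Lie algebras. -/
lemma LieAlgebroid.anchorCoord_structCoord (L : LieAlgebroid m M F E) (b : Frame m M F E) {x₀ : M}
    {y : EuclideanSpace ℝ (Fin m)} (hy : y ∈ b.coordDom x₀) (ξ η : Fin (finrank ℝ F) → ℝ) :
    fderiv ℝ (L.anchorCoord b x₀) y (L.anchorCoord b x₀ y ξ) η
      - fderiv ℝ (L.anchorCoord b x₀) y (L.anchorCoord b x₀ y η) ξ
      = L.anchorCoord b x₀ y (L.structCoord b x₀ y ξ η) := by
  rcases isEmpty_or_nonempty (Fin (finrank ℝ F)) with hr | ⟨⟨j⟩⟩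
  · have h0 : ∀ ζ : Fin (finrank ℝ F) → ℝ, ζ = 0 := fun ζ => funext fun i => hr.elim i
    rw [h0 ξ, h0 η, sub_self, h0 (L.structCoord b x₀ y 0 0), map_zero]
  set κ := extChartAt (𝓡 m) x₀
  have hne : b.sec j (κ.symm y) ≠ 0 := (b.isFrame.linearIndependent hy.2).ne_zero j
  have hρ : DifferentiableAt ℝ (L.anchorCoord b x₀) y :=
    ((L.contDiffOn_anchorCoord b x₀).contDiffAt ((b.isOpen_coordDom x₀).mem_nhds hy)).differentiableAt
      (by simp)
  ext k
  have hsrc : IsOpen κ.source := isOpen_extChartAt_source x₀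
  have hp : κ.symm y ∈ κ.source := κ.map_target hy.1
  obtain ⟨f, hf, hfκ⟩ := exists_contMDiff_eventuallyEq (m := m) (f := fun q => κ q k) hsrc
    (fun q hq => ((EuclideanSpace.proj (𝕜 := ℝ) k).contDiff.contMDiff.contMDiffAt.comp q
      (contMDiffAt_chart hq)).contMDiffWithinAt) hp
  have h1 : ∀ z ∈ κ.target, ∀ V, mvfderiv (𝓡 m) (fun q => κ q k) (κ.symm z) V
      = EuclideanSpace.proj (𝕜 := ℝ) k
        (mfderiv (𝓡 m) 𝓘(ℝ, EuclideanSpace ℝ (Fin m)) κ (κ.symm z) V) := by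
    intro z hz V
    refine (mvfderiv_comp_chart hz (EuclideanSpace.proj (𝕜 := ℝ) k).differentiableAt V).trans ?_
    rw [ContinuousLinearMap.fderiv]
  have h2 : ∀ θ : Fin (finrank ℝ F) → ℝ,
      (fun q => mvfderiv (𝓡 m) f q (L.anchor q (b.constSec θ q)))
        =ᶠ[𝓝 (κ.symm y)] fun q => (L.anchorCoord b x₀ (κ q) θ) k := by
    intro θ
    filter_upwards [hfκ.eventuallyEq_nhds, hsrc.mem_nhds hp] with q hq hqs
    rw [mvfderiv_congr hq]
    refine Eq.trans ?_
      (congrArg (EuclideanSpace.proj (𝕜 := ℝ) k) (L.anchorCoord_apply b x₀ (κ q) θ)).symm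
    refine Eq.trans ?_
      (h1 (κ q) (κ.map_source hqs) (L.anchor _ (b.constSec θ (κ.symm (κ q)))))
    rw [κ.left_inv hqs]
  have h3 : ∀ θ ζ : Fin (finrank ℝ F) → ℝ,
      mvfderiv (𝓡 m) (fun q => mvfderiv (𝓡 m) f q (L.anchor q (b.constSec θ q))) (κ.symm y)
        (L.anchor _ (b.constSec ζ (κ.symm y)))
      = (fderiv ℝ (L.anchorCoord b x₀) y (L.anchorCoord b x₀ y ζ) θ) k := by
    intro θ ζ
    have h4 := fderiv_apply_const hρ θ (EuclideanSpace.proj (𝕜 := ℝ) k) (L.anchorCoord b x₀ y ζ)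
    rw [mvfderiv_congr (h2 θ)]
    refine (mvfderiv_comp_chart hy.1 h4.1 _).trans ?_
    rw [← L.anchorCoord_apply]
    exact h4.2
  have h5 := L.anchor_bracket (b.constSec ξ) (b.constSec η) (b.sec j) hne hf
  rw [h3, h3, mvfderiv_congr hfκ, h1 y hy.1] at h5
  have h6 : L.bracket (b.constSec ξ) (b.constSec η) (κ.symm y)
      = b.constSec (L.structCoord b x₀ y ξ η) (κ.symm y) :=
    b.ext_comp hy.2 fun i => by
      rw [b.constSec_apply, b.comp_sum hy.2, L.structCoord_apply]
  rw [PiLp.sub_apply, ← h5]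
  refine Eq.trans ?_ (congrArg (EuclideanSpace.proj (𝕜 := ℝ) k)
    (L.anchorCoord_apply b x₀ y (L.structCoord b x₀ y ξ η))).symm
  rw [h6]

end Target

/-! ### Fields in components -/

section Fields

variable {d : ℕ} {W : Type*} [TopologicalSpace W] [ChartedSpace (EuclideanSpace ℝ (Fin d)) W]
  [IsManifold (𝓡 d) ∞ W]
  {m : ℕ} {M : Type*} [TopologicalSpace M] [T2Space M]
  [ChartedSpace (EuclideanSpace ℝ (Fin m)) M] [IsManifold (𝓡 m) ∞ M]
  {F : Type*} [NormedAddCommGroup F] [NormedSpace ℝ F]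
  {E : M → Type*} [TopologicalSpace (TotalSpace F E)] [∀ x, TopologicalSpace (E x)]
  [∀ x, AddCommGroup (E x)] [∀ x, Module ℝ (E x)] [FiberBundle F E] [VectorBundle ℝ F E]

/-- A map to `E` is smooth if its base map and its components in a local basis are. -/
lemma Frame.contMDiffAt_of_comp (b : Frame m M F E)
    {G H N : Type*} [NormedAddCommGroup G] [NormedSpace ℝ G] [TopologicalSpace H]
    [TopologicalSpace N] [ChartedSpace H N] {J : ModelWithCorners ℝ G H}
    {p : N → TotalSpace F E} {z : N} (hz : (p z).1 ∈ b.dom)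
    (hbase : ContMDiffAt J (𝓡 m) ∞ (fun z => (p z).1) z)
    (hcomp : ∀ i, ContMDiffAt J 𝓘(ℝ, ℝ) ∞ (fun z => b.comp i (p z).1 (p z).2) z) :
    ContMDiffAt J ((𝓡 m).prod 𝓘(ℝ, F)) ∞ p z := by
  rw [contMDiffAt_totalSpace]
  refine ⟨hbase, ?_⟩
  let e := trivializationAt F E (p z).1
  have hze : (p z).1 ∈ e.baseSet := FiberBundle.mem_baseSet_trivializationAt' _
  have h1 : ∀ i, ContMDiffAt (𝓡 m) 𝓘(ℝ, F) ∞ (fun y => (e ⟨y, b.sec i y⟩).2) (p z).1 :=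
    fun i => (contMDiffAt_section _).1 ((b.sec i).contMDiff.contMDiffAt)
  have h2 : ContMDiffAt J 𝓘(ℝ, F) ∞ (fun z => ∑ i, b.comp i (p z).1 (p z).2 •
      (e ⟨(p z).1, b.sec i (p z).1⟩).2) z :=
    contMDiffAt_finsetSum fun i _ => (hcomp i).smul
      (ContMDiffAt.comp (g := fun y => (e ⟨y, b.sec i y⟩).2) z (h1 i) hbase)
  refine h2.congr_of_eventuallyEq ?_
  filter_upwards [hbase.continuousAt.preimage_mem_nhds
    ((e.open_baseSet.inter b.isOpen_dom).mem_nhds ⟨hze, hz⟩)] with q hq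
  have h3 : ∀ w : E (p q).1, (e ⟨(p q).1, w⟩).2 = e.linearMapAt ℝ (p q).1 w := fun w => by
    rw [e.coe_linearMapAt_of_mem hq.1]
  have h4 := h3 (p q).2
  rw [← b.sum_comp hq.2 (p q).2, map_sum] at h4
  simp only [map_smul] at h4
  simp only [← h3] at h4
  rw [b.sum_comp hq.2] at h4
  exact h4

variable [FiniteDimensional ℝ F] [ContMDiffVectorBundle ∞ F E (𝓡 m)]

lemma FieldConfig.contDiffAt_comp_coordVec (φ : FieldConfig d W m M F E) (b : Frame m M F E)
    (i : Fin (finrank ℝ F)) {x₀ : W} {y : EuclideanSpace ℝ (Fin d)}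
    (hy : y ∈ (extChartAt (𝓡 d) x₀).target)
    (hb : φ.base ((extChartAt (𝓡 d) x₀).symm y) ∈ b.dom) (u : EuclideanSpace ℝ (Fin d)) :
    ContDiffAt ℝ ∞ (fun q : EuclideanSpace ℝ (Fin d) × EuclideanSpace ℝ (Fin d) =>
      φ.comp b i ((extChartAt (𝓡 d) x₀).symm q.1) (coordVec x₀ q.1 q.2)) (y, u) := by
  have h1 := (φ.smooth.contMDiffAt).comp (y, u) (contMDiffAt_coordVec hy u)
  exact (b.contMDiffAt_comp i h1 hb).contDiffAt

lemma FieldConfig.contDiffAt_chartComp (φ : FieldConfig d W m M F E) (b : Frame m M F E)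
    (i : Fin (finrank ℝ F)) {x₀ : W} {y : EuclideanSpace ℝ (Fin d)}
    (hy : y ∈ (extChartAt (𝓡 d) x₀).target)
    (hb : φ.base ((extChartAt (𝓡 d) x₀).symm y) ∈ b.dom) (u : EuclideanSpace ℝ (Fin d)) :
    ContDiffAt ℝ ∞ (φ.chartComp b i x₀ u) y :=
  (φ.contDiffAt_comp_coordVec b i hy hb u).comp y (contDiffAt_id.prodMk contDiffAt_const)

lemma Frame.comp_eq_sum (b b' : Frame m M F E) {x : M} (hx : x ∈ b.dom) (e : E x)
    (i : Fin (finrank ℝ F)) :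
    b'.comp i x e = ∑ j, b'.comp i x (b.sec j x) * b.comp j x e := by
  conv_lhs => rw [← b.sum_comp hx e]
  simp [map_sum, mul_comm]

/-- If the first field equation holds, then the second one, at a given point, does not depend on
the local basis. -/
lemma FieldConfig.curvature_eq_zero_of_frame (L : LieAlgebroid m M F E)
    (φ : FieldConfig d W m M F E) {x : W}
    (h1 : ∀ u : TangentSpace (𝓡 d) x,
      mfderiv (𝓡 d) (𝓡 m) φ.base x u = L.anchor (φ.base x) (φ.form x u))
    (b b' : Frame m M F E) (hb : φ.base x ∈ b.dom) (hb' : φ.base x ∈ b'.dom)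
    (u w : EuclideanSpace ℝ (Fin d))
    (h2 : ∀ i, fderiv ℝ (φ.chartComp b i x w) (extChartAt (𝓡 d) x x) u
        - fderiv ℝ (φ.chartComp b i x u) (extChartAt (𝓡 d) x x) w
        + ∑ j, ∑ k, L.structureFun b j k i (φ.base x)
            * φ.comp b j x u * φ.comp b k x w = 0) (i : Fin (finrank ℝ F)) :
    fderiv ℝ (φ.chartComp b' i x w) (extChartAt (𝓡 d) x x) u
        - fderiv ℝ (φ.chartComp b' i x u) (extChartAt (𝓡 d) x x) w
        + ∑ j, ∑ k, L.structureFun b' j k i (φ.base x)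
            * φ.comp b' j x u * φ.comp b' k x w = 0 := by
  set y := extChartAt (𝓡 d) x x with hy
  have hyt : y ∈ (extChartAt (𝓡 d) x).target := mem_extChartAt_target x
  have hyx : (extChartAt (𝓡 d) x).symm y = x := extChartAt_to_inv x
  -- sections with constant components in `b`, through the values of the form
  let σ : EuclideanSpace ℝ (Fin d) → Sec m M F E := fun v => b.constSec fun j => φ.comp b j x v
  have hσ : ∀ v : EuclideanSpace ℝ (Fin d), σ v (φ.base x) = φ.form x v := fun v => by
    rw [b.constSec_apply]; exact b.sum_comp hb _
  have hσc : ∀ v : EuclideanSpace ℝ (Fin d), ∀ q ∈ b.dom, ∀ j,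
      b.comp j q (σ v q) = φ.comp b j x v := fun v q hq j => by
    rw [b.constSec_apply, b.comp_sum hq]
  have hX : ContMDiffAt (𝓡 d) (𝓡 m) ∞ φ.base x := φ.contMDiff_base.contMDiffAt
  have hN : ∀ j, ContMDiffAt (𝓡 m) 𝓘(ℝ, ℝ) ∞ (fun q => b'.comp i q (b.sec j q)) (φ.base x) :=
    fun j => b'.contMDiffAt_comp_sec i (b.sec j) hb'
  have hNd : ∀ j, ∀ v : EuclideanSpace ℝ (Fin d),
      DifferentiableAt ℝ (fun z => b'.comp i (φ.base ((extChartAt (𝓡 d) x).symm z))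
        (b.sec j (φ.base ((extChartAt (𝓡 d) x).symm z)))) y ∧
      fderiv ℝ (fun z => b'.comp i (φ.base ((extChartAt (𝓡 d) x).symm z))
        (b.sec j (φ.base ((extChartAt (𝓡 d) x).symm z)))) y v
      = mvfderiv (𝓡 m) (fun q => b'.comp i q (b.sec j q)) (φ.base x)
          (L.anchor (φ.base x) (φ.form x v)) := by
    intro j v
    have h := hasFDerivAt_comp_chart_symm (f := fun q => b'.comp i q (b.sec j q)) hyt
      (by rw [hyx]; exact hX.mdifferentiableAt (by simp))
      (by rw [hyx]; exact (hN j).mdifferentiableAt (by simp)) v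
    refine ⟨h.1, h.2.trans (Eq.trans ?_ (congrArg (mvfderiv (𝓡 m)
      (fun q => b'.comp i q (b.sec j q)) (φ.base x)) (h1 v)))⟩
    exact apply_coordVec_self x (fun p v' => mvfderiv (𝓡 m) (fun q => b'.comp i q (b.sec j q))
      (φ.base p) (mfderiv (𝓡 d) (𝓡 m) φ.base p v')) v
  have hbe : φ.base ((extChartAt (𝓡 d) x).symm y) ∈ b.dom := by rw [hyx]; exact hb
  have hAd : ∀ j, ∀ v : EuclideanSpace ℝ (Fin d),
      DifferentiableAt ℝ (φ.chartComp b j x v) y := fun j v =>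
    (φ.contDiffAt_chartComp b j hyt hbe v).differentiableAt (by simp)
  have hself : ∀ j, ∀ v : EuclideanSpace ℝ (Fin d), φ.chartComp b j x v y = φ.comp b j x v :=
    fun j v => apply_coordVec_self x (fun p v' => φ.comp b j p v') v
  have key : ∀ v v' : EuclideanSpace ℝ (Fin d), fderiv ℝ (φ.chartComp b' i x v') y v
      = mvfderiv (𝓡 m) (fun q => b'.comp i q (σ v' q)) (φ.base x)
          (L.anchor (φ.base x) (φ.form x v))
        + ∑ j, b'.comp i (φ.base x) (b.sec j (φ.base x))
          * fderiv ℝ (φ.chartComp b j x v') y v := by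
    intro v v'
    have e1 : φ.chartComp b' i x v' =ᶠ[𝓝 y] fun z => ∑ j,
        b'.comp i (φ.base ((extChartAt (𝓡 d) x).symm z))
          (b.sec j (φ.base ((extChartAt (𝓡 d) x).symm z))) * φ.chartComp b j x v' z := by
      have hc : ContinuousAt (fun z => φ.base ((extChartAt (𝓡 d) x).symm z)) y := by
        refine ContinuousAt.comp (g := φ.base) ?_ (contMDiffAt_chart_symm hyt).continuousAt
        rw [hyx]; exact hX.continuousAt
      filter_upwards [hc.preimage_mem_nhds (b.isOpen_dom.mem_nhds hbe)] with z hz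
      exact Frame.comp_eq_sum b b' hz _ i
    rw [e1.fderiv_eq, fderiv_fun_sum fun j _ => (hNd j v).1.fun_mul (hAd j v')]
    have e2 : mvfderiv (𝓡 m) (fun q => b'.comp i q (σ v' q)) (φ.base x)
          (L.anchor (φ.base x) (φ.form x v))
        = ∑ j, φ.comp b j x v' * mvfderiv (𝓡 m) (fun q => b'.comp i q (b.sec j q)) (φ.base x)
          (L.anchor (φ.base x) (φ.form x v)) := by
      have e3 : (fun q => b'.comp i q (σ v' q)) = fun q => ∑ j, φ.comp b j x v'
          * b'.comp i q (b.sec j q) := by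
        funext q
        simp [σ, b.constSec_apply, map_sum]
      rw [e3]
      refine (mvfderiv_sum_apply (f := fun j q => φ.comp b j x v' * b'.comp i q (b.sec j q))
        Finset.univ (fun j _ => (contMDiffAt_const.mul (hN j)).mdifferentiableAt (by simp))
        _).trans ?_
      refine Finset.sum_congr rfl fun j _ => ?_
      rw [mvfderiv_mul_apply mdifferentiableAt_const ((hN j).mdifferentiableAt (by simp)),
        mvfderiv_const]
      simp
    rw [e2, ← Finset.sum_add_distrib, sum_apply]
    refine Finset.sum_congr rfl fun j _ => ?_
    rw [fderiv_fun_mul (hNd j v).1 (hAd j v'), add_apply, smul_apply, smul_apply, (hNd j v).2,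
      hself, hyx, smul_eq_mul, smul_eq_mul, add_comm]
  have hb1 := L.comp_bracket b' (σ u) (σ w) hb' i
  have hb2 : ∀ j, b.comp j (φ.base x) (L.bracket (σ u) (σ w) (φ.base x))
      = ∑ k, ∑ l, L.structureFun b k l j (φ.base x) * φ.comp b k x u * φ.comp b l x w := by
    intro j
    rw [L.comp_bracket b (σ u) (σ w) hb j]
    have hz : ∀ v : EuclideanSpace ℝ (Fin d), ∀ V,
        mvfderiv (𝓡 m) (fun q => b.comp j q (σ v q)) (φ.base x) V = 0 := by
      intro v V
      have : (fun q => b.comp j q (σ v q)) =ᶠ[𝓝 (φ.base x)] fun _ => φ.comp b j x v := by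
        filter_upwards [b.isOpen_dom.mem_nhds hb] with q hq using hσc v q hq j
      rw [mvfderiv_congr this, mvfderiv_const]
      rfl
    rw [hz, hz, add_zero, sub_zero]
    simp only [hσc _ _ hb]
  rw [hσ, hσ] at hb1
  have hb3 := Frame.comp_eq_sum b b' hb (L.bracket (σ u) (σ w) (φ.base x)) i
  have hb4 : ∑ j, b'.comp i (φ.base x) (b.sec j (φ.base x)) * fderiv ℝ (φ.chartComp b j x w) y u
      - ∑ j, b'.comp i (φ.base x) (b.sec j (φ.base x)) * fderiv ℝ (φ.chartComp b j x u) y w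
      + b'.comp i (φ.base x) (L.bracket (σ u) (σ w) (φ.base x)) = 0 := by
    rw [hb3, ← Finset.sum_sub_distrib, ← Finset.sum_add_distrib]
    refine Finset.sum_eq_zero fun j _ => ?_
    rw [hb2 j]
    linear_combination (b'.comp i (φ.base x) (b.sec j (φ.base x))) * h2 j
  rw [key, key]
  have hb5 : b'.comp i (φ.base x) (L.bracket (σ u) (σ w) (φ.base x))
    = (∑ j, ∑ k, L.structureFun b' j k i (φ.base x) * φ.comp b' j x u * φ.comp b' k x w)
      + mvfderiv (𝓡 m) (fun q => b'.comp i q (σ w q)) (φ.base x)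
          (L.anchor (φ.base x) (φ.form x u))
      - mvfderiv (𝓡 m) (fun q => b'.comp i q (σ u q)) (φ.base x)
          (L.anchor (φ.base x) (φ.form x w)) := hb1
  linarith

end Fields

set_option maxSynthPendingDepth 3

/-! ### Non-degenerate solutions on `ℝᵈ` -/

section Pullback

variable {D : Type*} [NormedAddCommGroup D] [InnerProductSpace ℝ D] [FiniteDimensional ℝ D]

/-- A smooth open embedding of the whole space into a small ball. -/
lemma exists_contDiff_into_ball {r : ℝ} (hr : 0 < r) :
    ∃ ψ : D → D, ContDiff ℝ ∞ ψ ∧ ψ 0 = 0 ∧ (∀ x, ψ x ∈ Metric.ball (0 : D) r) ∧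
      ∀ x, Function.Injective (fderiv ℝ ψ x) := by
  let f : OpenPartialHomeomorph D D := OpenPartialHomeomorph.univUnitBall
  have hf : ContDiff ℝ ∞ f := OpenPartialHomeomorph.contDiff_univUnitBall
  have hfb : ∀ x, f x ∈ Metric.ball (0 : D) 1 := fun x => f.map_source (mem_univ x)
  refine ⟨fun x => r • f x, contDiff_const.smul hf, ?_, fun x => ?_, fun x => ?_⟩
  · simp [f]
  · have := hfb x
    rw [mem_ball_zero_iff] at this ⊢
    rw [norm_smul, Real.norm_of_nonneg hr.le]
    nlinarith
  · have hfd : DifferentiableAt ℝ f x := hf.differentiable (by simp) x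
    have hg : DifferentiableAt ℝ f.symm (f x) :=
      (OpenPartialHomeomorph.contDiffOn_univUnitBall_symm (n := ⊤)).contDiffAt
        (Metric.isOpen_ball.mem_nhds (hfb x)) |>.differentiableAt (by simp)
    have h1 : HasFDerivAt (fun z => f.symm (f z)) ((fderiv ℝ f.symm (f x)).comp (fderiv ℝ f x)) x :=
      hg.hasFDerivAt.comp x hfd.hasFDerivAt
    have h2 : (fun z => f.symm (f z)) = id := funext fun z => f.left_inv (mem_univ z)
    rw [h2] at h1
    have h3 := h1.unique (hasFDerivAt_id x)
    rw [fderiv_fun_const_smul hfd]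
    intro u v huv
    have h4 : fderiv ℝ f x u = fderiv ℝ f x v := by
      have : r • fderiv ℝ f x u = r • fderiv ℝ f x v := huv
      exact smul_right_injective D hr.ne' this
    have h5 := congrArg (fderiv ℝ f.symm (f x)) h4
    have h6 : ∀ w, fderiv ℝ f.symm (f x) (fderiv ℝ f x w) = w := fun w =>
      congrArg (fun T : D →L[ℝ] D => T w) h3
    rwa [h6, h6] at h5

/-- A solution of the field equations on a ball can be pulled back to the whole space. -/
lemma exists_pullback_flat_field {Y R : Type*} [NormedAddCommGroup Y] [NormedSpace ℝ Y]
    [NormedAddCommGroup R] [NormedSpace ℝ R] {ρ : Y → R →L[ℝ] Y} {c : Y → R →L[ℝ] R →L[ℝ] R}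
    {r : ℝ} (hr : 0 < r) {X : D → Y} {A : D → D →L[ℝ] R}
    (hX : ContDiffOn ℝ ∞ X (Metric.ball 0 r)) (hA : ContDiffOn ℝ ∞ A (Metric.ball 0 r))
    (h1 : ∀ x ∈ Metric.ball (0 : D) r, ∀ u, fderiv ℝ X x u = ρ (X x) (A x u))
    (h2 : ∀ x ∈ Metric.ball (0 : D) r, ∀ u w,
      fderiv ℝ A x u w - fderiv ℝ A x w u + c (X x) (A x u) (A x w) = 0) :
    ∃ (X' : D → Y) (A' : D → D →L[ℝ] R), ContDiff ℝ ∞ X' ∧ ContDiff ℝ ∞ A' ∧ X' 0 = X 0 ∧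
      (∀ x, ∃ z ∈ Metric.ball (0 : D) r, ∃ T : D →L[ℝ] D, Function.Injective T ∧
        X' x = X z ∧ A' x = (A z).comp T) ∧
      (∀ x u, fderiv ℝ X' x u = ρ (X' x) (A' x u)) ∧
      ∀ x u w, fderiv ℝ A' x u w - fderiv ℝ A' x w u + c (X' x) (A' x u) (A' x w) = 0 := by
  obtain ⟨ψ, hψ, hψ0, hψb, hψi⟩ := exists_contDiff_into_ball (D := D) hr
  have hψ' : ContDiff ℝ ∞ (fderiv ℝ ψ) := hψ.fderiv_right (by simp)
  have hXs : ContDiff ℝ ∞ (fun x => X (ψ x)) := contDiff_iff_contDiffAt.2 fun x =>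
    (hX.contDiffAt (Metric.isOpen_ball.mem_nhds (hψb x))).comp x hψ.contDiffAt
  have hAs : ContDiff ℝ ∞ (fun x => A (ψ x)) := contDiff_iff_contDiffAt.2 fun x =>
    (hA.contDiffAt (Metric.isOpen_ball.mem_nhds (hψb x))).comp x hψ.contDiffAt
  have hXd : ∀ x, DifferentiableAt ℝ X (ψ x) := fun x =>
    (hX.contDiffAt (Metric.isOpen_ball.mem_nhds (hψb x))).differentiableAt (by simp)
  have hAd : ∀ x, DifferentiableAt ℝ A (ψ x) := fun x =>
    (hA.contDiffAt (Metric.isOpen_ball.mem_nhds (hψb x))).differentiableAt (by simp)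
  have hψd : ∀ x, DifferentiableAt ℝ ψ x := hψ.differentiable (by simp)
  refine ⟨fun x => X (ψ x), fun x => (A (ψ x)).comp (fderiv ℝ ψ x), hXs, hAs.clm_comp hψ',
    by simp only [hψ0], fun x => ⟨ψ x, hψb x, fderiv ℝ ψ x, hψi x, rfl, rfl⟩, ?_, ?_⟩
  · intro x u
    have hX1 : HasFDerivAt (fun x => X (ψ x)) ((fderiv ℝ X (ψ x)).comp (fderiv ℝ ψ x)) x :=
      (hXd x).hasFDerivAt.comp x (hψd x).hasFDerivAt
    rw [hX1.fderiv]
    exact h1 _ (hψb x) _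
  · intro x u w
    have hA1 : HasFDerivAt (fun x => A (ψ x)) ((fderiv ℝ A (ψ x)).comp (fderiv ℝ ψ x)) x :=
      (hAd x).hasFDerivAt.comp x (hψd x).hasFDerivAt
    have hψ2 : HasFDerivAt (fderiv ℝ ψ) (fderiv ℝ (fderiv ℝ ψ) x) x :=
      (hψ'.differentiable (by simp) x).hasFDerivAt
    have hd : ∀ u w, fderiv ℝ (fun x => (A (ψ x)).comp (fderiv ℝ ψ x)) x u w
        = fderiv ℝ A (ψ x) (fderiv ℝ ψ x u) (fderiv ℝ ψ x w)
          + A (ψ x) (fderiv ℝ (fderiv ℝ ψ) x u w) := by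
      intro u w
      rw [(hA1.clm_comp hψ2).fderiv]
      simp [add_comm]
    have hsymm : fderiv ℝ (fderiv ℝ ψ) x u w = fderiv ℝ (fderiv ℝ ψ) x w u :=
      (hψ.contDiffAt.isSymmSndFDerivAt (by simp; exact two_le_infty)).eq u w
    rw [hd, hd, hsymm]
    have := h2 (ψ x) (hψb x) (fderiv ℝ ψ x u) (fderiv ℝ ψ x w)
    simp only [ContinuousLinearMap.comp_apply]
    rw [← this]
    abel

end Pullback

section Existence

variable {d m : ℕ} {M : Type*} [TopologicalSpace M] [T2Space M]
  [ChartedSpace (EuclideanSpace ℝ (Fin m)) M] [IsManifold (𝓡 m) ∞ M]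
  {F : Type*} [NormedAddCommGroup F] [NormedSpace ℝ F]
  {E : M → Type*} [TopologicalSpace (TotalSpace F E)] [∀ x, TopologicalSpace (E x)]
  [∀ x, AddCommGroup (E x)] [∀ x, Module ℝ (E x)] [FiberBundle F E] [VectorBundle ℝ F E]

lemma chartComp_model (φ : FieldConfig d (EuclideanSpace ℝ (Fin d)) m M F E) (b : Frame m M F E)
    (i : Fin (finrank ℝ F)) (x₀ u y : EuclideanSpace ℝ (Fin d)) :
    φ.chartComp b i x₀ u y = φ.comp b i y u := by
  have key : ∀ e : PartialEquiv (EuclideanSpace ℝ (Fin d)) (EuclideanSpace ℝ (Fin d)),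
      e = PartialEquiv.refl _ → φ.comp b i (e.symm y)
        (mfderiv 𝓘(ℝ, EuclideanSpace ℝ (Fin d)) (𝓡 d) e.symm y u) = φ.comp b i y u := by
    rintro e rfl
    refine congrArg (φ.comp b i y) ?_
    rw [mfderiv_eq_fderiv]
    exact congrArg (fun T : EuclideanSpace ℝ (Fin d) →L[ℝ] EuclideanSpace ℝ (Fin d) => T u)
      (fderiv_id (𝕜 := ℝ) (x := y))
  exact key _ (by simp only [extChartAt_model_space_eq_id])

/-- A symmetric bilinear form of rank `d` is non-degenerate on a `d`-dimensional complement of its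
kernel. -/
lemma exists_complement {V : Type*} [AddCommGroup V] [Module ℝ V] [FiniteDimensional ℝ V]
    (B : V →ₗ[ℝ] V →ₗ[ℝ] ℝ) (hB : ∀ a b, B a b = B b a)
    (hd : finrank ℝ (LinearMap.range B) = d) :
    ∃ T : EuclideanSpace ℝ (Fin d) →ₗ[ℝ] V,
      (∀ u, (∀ w, B (T u) (T w) = 0) → u = 0) ∧ ∀ v, ∃ u, B (v - T u) = 0 := by
  obtain ⟨C, hC⟩ := Submodule.exists_isCompl (LinearMap.ker B)
  have hCd : finrank ℝ C = finrank ℝ (EuclideanSpace ℝ (Fin d)) := by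
    have h1 := Submodule.finrank_add_eq_of_isCompl hC
    have h2 := LinearMap.finrank_range_add_finrank_ker B
    rw [finrank_euclideanSpace_fin]
    omega
  let e : EuclideanSpace ℝ (Fin d) ≃ₗ[ℝ] C := LinearEquiv.ofFinrankEq _ _ hCd.symm
  have hsplit : ∀ v, ∃ u, B (v - e u) = 0 := by
    intro v
    obtain ⟨k, hk, c, hc, hkc⟩ := Submodule.mem_sup.1
      (show v ∈ LinearMap.ker B ⊔ C by rw [hC.sup_eq_top]; trivial)
    refine ⟨e.symm ⟨c, hc⟩, ?_⟩
    rw [e.apply_symm_apply, ← hkc, add_sub_cancel_right]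
    exact hk
  refine ⟨C.subtype ∘ₗ e, fun u hu => ?_, hsplit⟩
  have h1 : B (e u) = 0 := by
    ext v
    obtain ⟨w, hw⟩ := hsplit v
    have h2 : B (e u) v = B (e u) (v - e w) + B (e u) (e w) := by
      rw [← map_add, sub_add_cancel]
    rw [h2, hB (e u) (v - e w), hw]
    have := hu w
    simpa using this
  have h3 : (e u : V) ∈ LinearMap.ker B ⊓ C := ⟨h1, (e u).2⟩
  rw [hC.inf_eq_bot] at h3
  have h4 : e u = 0 := Subtype.ext h3
  simpa using h4

/-- Non-degeneracy of a bilinear form is an open condition. -/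
lemma eventually_nondegenerate {D Z : Type*} [NormedAddCommGroup D] [NormedSpace ℝ D]
    [FiniteDimensional ℝ D] [TopologicalSpace Z] {G : Z → D →L[ℝ] D →L[ℝ] ℝ} {z : Z}
    (hG : ContinuousAt G z) (h0 : ∀ u, (∀ w, G z u w = 0) → u = 0) :
    ∀ᶠ x in 𝓝 z, ∀ u, (∀ w, G x u w = 0) → u = 0 := by
  have hinj : Function.Injective (G z) := by
    rw [injective_iff_map_eq_zero]
    intro u hu
    exact h0 u fun w => by rw [hu]; rfl
  have hfin : finrank ℝ D = finrank ℝ (D →L[ℝ] ℝ) := by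
    rw [← (LinearMap.toContinuousLinearMap (𝕜 := ℝ) (E := D) (F' := ℝ)).finrank_eq]
    exact (Subspace.dual_finrank_eq (K := ℝ) (V := D)).symm
  let L : D ≃L[ℝ] (D →L[ℝ] ℝ) := (LinearEquiv.ofInjectiveOfFinrankEq
    (G z : D →ₗ[ℝ] (D →L[ℝ] ℝ)) hinj hfin).toContinuousLinearEquiv
  have hL : (L : D →L[ℝ] (D →L[ℝ] ℝ)) = G z := by ext1 u; rfl
  have h1 := L.nhds
  rw [hL] at h1
  filter_upwards [hG h1] with x hx
  obtain ⟨L', hL'⟩ := hx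
  intro u hu
  have h2 : L' u = 0 := by
    ext w
    have := hu w
    rw [← hL'] at this
    exact this
  simpa using h2

variable [FiniteDimensional ℝ F] [ContMDiffVectorBundle ∞ F E (𝓡 m)]

lemma sum_smulRight_apply {ι V U : Type*} [Fintype ι] [AddCommGroup V] [Module ℝ V]
    [AddCommGroup U] [Module ℝ U] (f : ι → V →ₗ[ℝ] ℝ) (e : ι → U) (v : V) :
    (∑ i, (f i).smulRight (e i)) v = ∑ i, f i v • e i := by
  simp

lemma continuousAt_sum_smul_smulRight {ι D Z : Type*} [Fintype ι] [NormedAddCommGroup D]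
    [NormedSpace ℝ D] [TopologicalSpace Z] {s : ι → ι → Z → ℝ} {α : ι → Z → D →L[ℝ] ℝ} {z : Z}
    (hs : ∀ i j, ContinuousAt (s i j) z) (hα : ∀ i, ContinuousAt (α i) z) :
    ContinuousAt (fun z => ∑ i, ∑ j, s i j z • (α i z).smulRight (α j z)) z := by
  exact tendsto_finsetSum _ fun i _ => tendsto_finsetSum _ fun j _ => (hs i j).smul
    ((((ContinuousLinearMap.smulRightL ℝ D (D →L[ℝ] ℝ)).continuous.continuousAt).comp
        (hα i)).clm_apply (hα j))

theorem exists_nondegenerate_solution (L : LieAlgebroid m M F E) (S : SymTensor m M F E)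
    (hrank : ∀ x : M, finrank ℝ (LinearMap.range (S.form x)) = d) :
    HasNonDegenerateSolutions d L S := by
  intro X₀
  obtain ⟨b, hb⟩ := exists_frame (m := m) (F := F) (E := E) X₀
  set κ := extChartAt (𝓡 m) X₀ with hκ
  have hy₀ : κ X₀ ∈ b.coordDom X₀ := ⟨mem_extChartAt_target X₀, by
    rw [mem_preimage, extChartAt_to_inv]; exact hb⟩
  let D := EuclideanSpace ℝ (Fin d)
  let R := Fin (finrank ℝ F) → ℝ
  have : FiniteDimensional ℝ (E X₀) :=
    .of_basis (b.isFrame.toBasisAt hb)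
  obtain ⟨T, hT, -⟩ := exists_complement (S.form X₀) (S.symm X₀) (hrank X₀)
  let a : D →L[ℝ] R := LinearMap.toContinuousLinearMap (LinearMap.pi fun i => b.comp i X₀ ∘ₗ T)
  obtain ⟨s₀, hs₀, r, hr, X, A, hX, hA, hX0, hA0, hXA⟩ := exists_flat_field (b.isOpen_coordDom X₀)
    (L.contDiffOn_anchorCoord b X₀) (L.contDiffOn_structCoord b X₀)
    (fun y _ ξ η => L.structCoord_antisymm b X₀ y ξ η)
    (fun y hy ξ η => L.anchorCoord_structCoord b hy ξ η)
    (fun y hy ξ η ζ => L.structCoord_jacobi b hy ξ η ζ) hy₀ a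
  -- the metric on the ball
  let P : Fin (finrank ℝ F) → R →L[ℝ] ℝ :=
    fun i => ContinuousLinearMap.proj (R := ℝ) (φ := fun _ : Fin (finrank ℝ F) => ℝ) i
  let G : D → D →L[ℝ] D →L[ℝ] ℝ := fun z => ∑ i, ∑ j, S.comp b i j (κ.symm (X z)) •
    ((P i).comp (A z)).smulRight ((P j).comp (A z))
  have hGS : ∀ z u w, G z u w = S.form (κ.symm (X z)) (b.constSec (A z u) (κ.symm (X z)))
      (b.constSec (A z w) (κ.symm (X z))) := by
    intro z u w
    rw [b.constSec_apply, b.constSec_apply]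
    simp only [G, P, map_sum, map_smul, LinearMap.sum_apply, LinearMap.smul_apply, smul_eq_mul,
      sum_apply, smul_apply, ContinuousLinearMap.smulRight_apply, ContinuousLinearMap.comp_apply,
      Finset.mul_sum, SymTensor.comp]
    rw [Finset.sum_comm]
    refine Finset.sum_congr rfl fun j _ => Finset.sum_congr rfl fun i _ => ?_
    change _ * (A z u i * A z w j) = A z w j * (A z u i * _)
    ring
  have h0b : (0 : D) ∈ Metric.ball (0 : D) r := Metric.mem_ball_self hr
  have hGc : ContinuousAt G 0 := by
    have hXc : ContinuousAt X 0 := (hX.contDiffAt (Metric.isOpen_ball.mem_nhds h0b)).continuousAt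
    have hAc : ContinuousAt A 0 := (hA.contDiffAt (Metric.isOpen_ball.mem_nhds h0b)).continuousAt
    have hκc : ContinuousAt κ.symm (X 0) := by
      rw [hX0]; exact (contMDiffAt_chart_symm hy₀.1).continuousAt
    refine continuousAt_sum_smul_smulRight (fun i j => ?_) fun i => ?_
    · exact ContinuousAt.comp (g := fun z => S.comp b i j (κ.symm z)) (ContinuousAt.comp
        (g := S.comp b i j) (S.smooth (b.sec i) (b.sec j)).continuous.continuousAt hκc) hXc
    · exact (ContinuousLinearMap.compL ℝ D R ℝ (P i)).continuous.continuousAt.comp hAc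
  have haT : ∀ u, b.constSec (a u) X₀ = T u := fun u => by
    rw [b.constSec_apply]; exact b.sum_comp hb (T u)
  have hG0 : ∀ u, (∀ w, G 0 u w = 0) → u = 0 := by
    intro u hu
    refine hT u fun w => ?_
    have h1 := hu w
    have h2 : ∀ v, b.constSec ((s₀ • a) v) X₀ = s₀ • T v := fun v => by
      rw [← haT, b.constSec_apply, b.constSec_apply, Finset.smul_sum]
      exact Finset.sum_congr rfl fun i _ => by rw [smul_smul]; rfl
    rw [hGS, hX0, hA0, extChartAt_to_inv, h2, h2] at h1
    simpa [hs₀] using h1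
  obtain ⟨r', hr', hrG⟩ := Metric.eventually_nhds_iff_ball.1
    ((eventually_nondegenerate hGc hG0).and (Metric.isOpen_ball.eventually_mem h0b))
  obtain ⟨X', A', hX', hA', hX'0, hXA', hf1, hf2⟩ := exists_pullback_flat_field (D := D) hr'
    (hX.mono fun z hz => (hrG z hz).2) (hA.mono fun z hz => (hrG z hz).2)
    (fun z hz => (hXA z (hrG z hz).2).2.1) (fun z hz => (hXA z (hrG z hz).2).2.2)
  have hXO : ∀ x, X' x ∈ b.coordDom X₀ := fun x => by
    obtain ⟨z, hz, -, -, h, -⟩ := hXA' x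
    rw [h]; exact (hXA z (hrG z hz).2).1
  have hbase : ContMDiff (𝓡 d) (𝓡 m) ∞ (fun x => κ.symm (X' x)) := fun x =>
    (contMDiffAt_chart_symm (hXO x).1).comp x hX'.contMDiff.contMDiffAt
  let φ : FieldConfig d D m M F E :=
    { base := fun x => κ.symm (X' x)
      form := fun x => ∑ i, LinearMap.smulRight (((P i).comp (A' x)) : D →ₗ[ℝ] ℝ)
        (b.sec i (κ.symm (X' x)))
      smooth := by
        intro p
        refine b.contMDiffAt_of_comp (hXO p.1).2 ?_ fun i => ?_
        · exact hbase.contMDiffAt.comp p (contMDiff_proj (TangentSpace (𝓡 d))).contMDiffAt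
        · have h1 : ContMDiff (𝓡 d).tangent 𝓘(ℝ, D) ∞ (fun p : TangentBundle (𝓡 d) D => p.1) :=
            contMDiff_proj (TangentSpace (𝓡 d))
          have h2 : ContMDiff (𝓡 d).tangent 𝓘(ℝ, D) ∞ (fun p : TangentBundle (𝓡 d) D => (p.2 : D)) :=
            contMDiff_snd_tangentBundle_modelSpace D (𝓡 d)
          have h3 := (P i).contDiff.contMDiff.comp ((hA'.contMDiff.comp h1).clm_apply h2)
          refine (h3 p).congr_of_eventuallyEq (Eventually.of_forall fun q => ?_)
          have h4 := b.comp_sum (hXO q.1).2 (A' q.1 q.2) i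
          refine Eq.trans ?_ h4
          exact congrArg (b.comp i (κ.symm (X' q.1))) (sum_smulRight_apply
            (fun i => (((P i).comp (A' q.1)) : D →ₗ[ℝ] ℝ)) (fun i => b.sec i (κ.symm (X' q.1))) q.2) }
  have hform : ∀ x (u : D), φ.form x u = b.constSec (A' x u) (κ.symm (X' x)) := by
    intro x u
    rw [b.constSec_apply]
    exact sum_smulRight_apply (fun i => (((P i).comp (A' x)) : D →ₗ[ℝ] ℝ))
      (fun i => b.sec i (κ.symm (X' x))) u
  have hcomp : ∀ i x (u : D), φ.comp b i x u = A' x u i := by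
    intro i x u
    refine (congrArg (b.comp i (κ.symm (X' x))) (hform x u)).trans ?_
    rw [b.constSec_apply, b.comp_sum (hXO x).2]
  have heq1 : ∀ (x : D) (u : TangentSpace (𝓡 d) x),
      mfderiv (𝓡 d) (𝓡 m) φ.base x u = L.anchor (φ.base x) (φ.form x u) := by
    intro x (u : D)
    have h1 := ((contMDiffAt_chart_symm (hXO x).1).mdifferentiableAt (by simp)).hasMFDerivAt.comp x
      (hX'.differentiable (by simp) x).hasFDerivAt.hasMFDerivAt
    have h2 : mfderiv (𝓡 d) (𝓡 m) φ.base x u = coordVec X₀ (X' x) (fderiv ℝ X' x u) :=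
      congrArg (fun T : D →L[ℝ] EuclideanSpace ℝ (Fin m) => T u) h1.mfderiv
    rw [h2, hf1, L.anchorCoord_apply, coordVec_mfderiv_chart (hXO x).1]
    exact congrArg (L.anchor (κ.symm (X' x))) (hform x u).symm
  refine ⟨φ, ⟨heq1, ?_⟩, ?_, ⟨0, ?_⟩⟩
  · intro b' x hb' i u w
    refine φ.curvature_eq_zero_of_frame L (heq1 x) b b' (hXO x).2 hb' u w (fun k => ?_) i
    have h1 : ∀ w : D, φ.chartComp b k x w = fun z => P k (A' z w) := fun w => by
      funext z; rw [chartComp_model, hcomp]; rfl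
    have h2 : ∀ u w : D, fderiv ℝ (φ.chartComp b k x w) (extChartAt (𝓡 d) x x) u
        = fderiv ℝ A' x u w k := by
      intro u w
      rw [h1, extChartAt_model_space_eq_id]
      exact (fderiv_apply_const (hA'.differentiable (by simp) x) w (P k) u).2
    rw [h2, h2]
    have h3 := congrFun (hf2 x u w) k
    rw [Pi.add_apply, Pi.sub_apply, L.structCoord_apply_eq_sum] at h3
    simp only [hcomp]
    exact h3
  · intro x (v : D) hv
    obtain ⟨z, hz, T', hT', hXz, hAz⟩ := hXA' x
    have hsurj : Function.Surjective T' :=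
      (LinearMap.injective_iff_surjective (f := (T' : D →ₗ[ℝ] D))).1 hT'
    have h1 : T' v = 0 := by
      refine (hrG z hz).1 _ fun w => ?_
      obtain ⟨w', rfl⟩ := hsurj w
      have h2 := hv w'
      rw [hGS, ← hXz]
      have h3 : ∀ v : D, b.constSec (A z (T' v)) (κ.symm (X' x)) = φ.form x v := fun v => by
        rw [hform, hAz]; rfl
      rw [h3, h3]
      exact h2
    exact hT' (h1.trans (map_zero T').symm)
  · change κ.symm (X' 0) = X₀
    rw [hX'0, hX0]
    exact extChartAt_to_inv X₀

end Existence


/-! ### Linear algebra of the form `S` and sections of its kernel -/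

section LinearAlgebra

/-- If a symmetric form of rank `d` is non-degenerate on the image of a `d`-dimensional space, then
the orthogonal complement of this image is the kernel of the form. -/
lemma eq_zero_of_orthogonal {D V : Type*} [AddCommGroup D] [Module ℝ D] [FiniteDimensional ℝ D]
    [AddCommGroup V] [Module ℝ V] [FiniteDimensional ℝ V] {B : V →ₗ[ℝ] V →ₗ[ℝ] ℝ}
    (hB : ∀ a b, B a b = B b a) (hd : finrank ℝ (LinearMap.range B) = finrank ℝ D)
    (T : D →ₗ[ℝ] V) (hT : ∀ u, (∀ w, B (T u) (T w) = 0) → u = 0) {v : V}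
    (hv : ∀ w, B v (T w) = 0) : B v = 0 := by
  let f : D →ₗ[ℝ] LinearMap.range B := B.rangeRestrict ∘ₗ T
  have hinj : Function.Injective f := by
    rw [injective_iff_map_eq_zero]
    intro u hu
    refine hT u fun w => ?_
    have h1 : B (T u) = 0 := congrArg Subtype.val hu
    rw [h1, LinearMap.zero_apply]
  have hsurj : Function.Surjective f :=
    (LinearMap.injective_iff_surjective_of_finrank_eq_finrank hd.symm).1 hinj
  ext v'
  obtain ⟨u, hu⟩ := hsurj ⟨B v', v', rfl⟩
  have h2 : B (T u) = B v' := congrArg Subtype.val hu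
  rw [hB, ← h2, hB, hv, LinearMap.zero_apply]

/-- The bilinear form with matrix `s`. -/
def bilinOfMatrix {d : ℕ} (s : Fin d → Fin d → ℝ) :
    EuclideanSpace ℝ (Fin d) →L[ℝ] EuclideanSpace ℝ (Fin d) →L[ℝ] ℝ :=
  ∑ i, ∑ j, s i j • (EuclideanSpace.proj (𝕜 := ℝ) i).smulRight (EuclideanSpace.proj (𝕜 := ℝ) j)

/-- The linear form with matrix `s`. -/
def linOfVector {d : ℕ} (s : Fin d → ℝ) : EuclideanSpace ℝ (Fin d) →L[ℝ] ℝ :=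
  ∑ j, s j • EuclideanSpace.proj (𝕜 := ℝ) j

lemma linOfVector_apply {d : ℕ} (l : EuclideanSpace ℝ (Fin d) →ₗ[ℝ] ℝ)
    (w : EuclideanSpace ℝ (Fin d)) :
    linOfVector (fun i => l (EuclideanSpace.single i 1)) w = l w := by
  have hw := (EuclideanSpace.basisFun (Fin d) ℝ).sum_repr w
  conv_rhs => rw [← hw, map_sum]
  simp [linOfVector, mul_comm]

lemma bilinOfMatrix_apply {d : ℕ}
    (B : EuclideanSpace ℝ (Fin d) →ₗ[ℝ] EuclideanSpace ℝ (Fin d) →ₗ[ℝ] ℝ)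
    (u w : EuclideanSpace ℝ (Fin d)) :
    bilinOfMatrix (fun i j => B (EuclideanSpace.single i 1) (EuclideanSpace.single j 1)) u w
      = B u w := by
  have h1 : ∀ i, B (EuclideanSpace.single i 1) w
      = ∑ j, B (EuclideanSpace.single i 1) (EuclideanSpace.single j 1) * w j := fun i => by
    rw [← linOfVector_apply (B (EuclideanSpace.single i 1)) w]
    simp [linOfVector]
  have h2 : B u w = ∑ i, B (EuclideanSpace.single i 1) w * u i := by
    have := linOfVector_apply (B.flip w) u
    simp only [linOfVector, LinearMap.flip_apply] at this
    rw [← this]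
    simp
  rw [h2]
  simp only [h1, bilinOfMatrix, sum_apply, smul_apply, ContinuousLinearMap.smulRight_apply,
    smul_eq_mul, Finset.sum_mul]
  refine Finset.sum_congr rfl fun i _ => Finset.sum_congr rfl fun j _ => ?_
  change _ * (u i * w j) = _
  ring

section SmoothFamily

variable {G H N : Type*} [NormedAddCommGroup G] [NormedSpace ℝ G] [TopologicalSpace H]
  [TopologicalSpace N] [ChartedSpace H N] {J : ModelWithCorners ℝ G H} {d : ℕ}

lemma contMDiffAt_bilinOfMatrix {s : Fin d → Fin d → N → ℝ} {z : N}
    (hs : ∀ i j, ContMDiffAt J 𝓘(ℝ, ℝ) ∞ (s i j) z) :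
    ContMDiffAt J 𝓘(ℝ, EuclideanSpace ℝ (Fin d) →L[ℝ] EuclideanSpace ℝ (Fin d) →L[ℝ] ℝ) ∞
      (fun z => bilinOfMatrix fun i j => s i j z) z :=
  contMDiffAt_finsetSum fun i _ => contMDiffAt_finsetSum fun j _ =>
    (hs i j).smul contMDiffAt_const

lemma contMDiffAt_linOfVector {s : Fin d → N → ℝ} {z : N}
    (hs : ∀ j, ContMDiffAt J 𝓘(ℝ, ℝ) ∞ (s j) z) :
    ContMDiffAt J 𝓘(ℝ, EuclideanSpace ℝ (Fin d) →L[ℝ] ℝ) ∞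
      (fun z => linOfVector fun j => s j z) z :=
  contMDiffAt_finsetSum fun j _ => (hs j).smul contMDiffAt_const

variable {D : Type*} [NormedAddCommGroup D] [NormedSpace ℝ D] [FiniteDimensional ℝ D]

lemma exists_equiv_of_nondegenerate {B : D →L[ℝ] D →L[ℝ] ℝ}
    (hB : ∀ u, (∀ w, B u w = 0) → u = 0) :
    ∃ e : D ≃L[ℝ] (D →L[ℝ] ℝ), (e : D →L[ℝ] (D →L[ℝ] ℝ)) = B := by
  have hinj : Function.Injective B := by
    rw [injective_iff_map_eq_zero]
    intro u hu
    exact hB u fun w => by rw [hu]; rfl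
  have hfin : finrank ℝ D = finrank ℝ (D →L[ℝ] ℝ) := by
    rw [← (LinearMap.toContinuousLinearMap (𝕜 := ℝ) (E := D) (F' := ℝ)).finrank_eq]
    exact (Subspace.dual_finrank_eq (K := ℝ) (V := D)).symm
  exact ⟨(LinearEquiv.ofInjectiveOfFinrankEq
    (B : D →ₗ[ℝ] (D →L[ℝ] ℝ)) hinj hfin).toContinuousLinearEquiv, by ext1 u; rfl⟩

lemma apply_inverse_of_nondegenerate {B : D →L[ℝ] D →L[ℝ] ℝ}
    (hB : ∀ u, (∀ w, B u w = 0) → u = 0) (l : D →L[ℝ] ℝ) :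
    B (ContinuousLinearMap.inverse B l) = l := by
  obtain ⟨e, rfl⟩ := exists_equiv_of_nondegenerate hB
  rw [ContinuousLinearMap.inverse_equiv]
  simp

lemma contMDiffAt_inverse_apply {B : N → D →L[ℝ] D →L[ℝ] ℝ} {l : N → D →L[ℝ] ℝ} {z : N}
    (hBs : ContMDiffAt J 𝓘(ℝ, D →L[ℝ] D →L[ℝ] ℝ) ∞ B z)
    (hl : ContMDiffAt J 𝓘(ℝ, D →L[ℝ] ℝ) ∞ l z) (hB : ∀ u, (∀ w, B z u w = 0) → u = 0) :
    ContMDiffAt J 𝓘(ℝ, D) ∞ (fun z => ContinuousLinearMap.inverse (B z) (l z)) z := by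
  obtain ⟨e, he⟩ := exists_equiv_of_nondegenerate hB
  have : CompleteSpace D := FiniteDimensional.complete ℝ D
  have h1 := contDiffAt_map_inverse (n := ∞) e
  rw [he] at h1
  exact (h1.contMDiffAt.comp z hBs).clm_apply hl

end SmoothFamily

end LinearAlgebra

section Kernel

variable {m : ℕ} {M : Type*} [TopologicalSpace M] [T2Space M]
  [ChartedSpace (EuclideanSpace ℝ (Fin m)) M] [IsManifold (𝓡 m) ∞ M]
  {F : Type*} [NormedAddCommGroup F] [NormedSpace ℝ F]
  {E : M → Type*} [TopologicalSpace (TotalSpace F E)] [∀ x, TopologicalSpace (E x)]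
  [∀ x, AddCommGroup (E x)] [∀ x, Module ℝ (E x)] [FiberBundle F E] [VectorBundle ℝ F E]

lemma SymTensor.form_eq_sum (S : SymTensor m M F E) (b : Frame m M F E) {x : M} (hx : x ∈ b.dom)
    (e e' : E x) : S.form x e e' = ∑ i, ∑ j, S.comp b i j x * b.comp i x e * b.comp j x e' := by
  conv_lhs => rw [← b.sum_comp hx e, ← b.sum_comp hx e']
  simp only [map_sum, map_smul, LinearMap.sum_apply, LinearMap.smul_apply, smul_eq_mul,
    Finset.mul_sum, SymTensor.comp]
  rw [Finset.sum_comm]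
  exact Finset.sum_congr rfl fun i _ => Finset.sum_congr rfl fun j _ => by ring

variable [FiniteDimensional ℝ F] [ContMDiffVectorBundle ∞ F E (𝓡 m)]

lemma SymTensor.contMDiffAt_form (S : SymTensor m M F E)
    {G H N : Type*} [NormedAddCommGroup G] [NormedSpace ℝ G] [TopologicalSpace H]
    [TopologicalSpace N] [ChartedSpace H N] {J : ModelWithCorners ℝ G H}
    {X : N → M} {a b : ∀ z, E (X z)} {z : N}
    (ha : ContMDiffAt J ((𝓡 m).prod 𝓘(ℝ, F)) ∞ (fun z => (⟨X z, a z⟩ : TotalSpace F E)) z)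
    (hb : ContMDiffAt J ((𝓡 m).prod 𝓘(ℝ, F)) ∞ (fun z => (⟨X z, b z⟩ : TotalSpace F E)) z) :
    ContMDiffAt J 𝓘(ℝ, ℝ) ∞ (fun z => S.form (X z) (a z) (b z)) z := by
  obtain ⟨β, hβ⟩ := exists_frame (m := m) (F := F) (E := E) (X z)
  have hX : ContMDiffAt J (𝓡 m) ∞ X z := (contMDiff_proj E).contMDiffAt.comp z ha
  have h1 : ContMDiffAt J 𝓘(ℝ, ℝ) ∞ (fun z => ∑ i, ∑ j, S.comp β i j (X z)
      * β.comp i (X z) (a z) * β.comp j (X z) (b z)) z :=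
    contMDiffAt_finsetSum fun i _ => contMDiffAt_finsetSum fun j _ =>
      ((ContMDiffAt.comp z (S.smooth (β.sec i) (β.sec j)).contMDiffAt hX).mul
        (β.contMDiffAt_comp i ha hβ)).mul (β.contMDiffAt_comp j hb hβ)
  refine h1.congr_of_eventuallyEq ?_
  filter_upwards [hX.continuousAt.preimage_mem_nhds (β.isOpen_dom.mem_nhds hβ)] with q hq
  exact S.form_eq_sum β hq _ _

/-- As `S` has constant rank, every vector in the kernel of `S` extends to a section of the kernel:
a section through the vector is projected along a complement of the kernel. -/
lemma SymTensor.exists_kernel_sec {d : ℕ} (S : SymTensor m M F E)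
    (hrank : ∀ x : M, finrank ℝ (LinearMap.range (S.form x)) = d) {p : M} {e₀ : E p}
    (he₀ : S.form p e₀ = 0) :
    ∃ ψ : Sec m M F E, ψ p = e₀ ∧ ∀ q, S.form q (ψ q) = 0 := by
  have hfd : ∀ q : M, FiniteDimensional ℝ (E q) := fun q =>
    ((trivializationAt F E q).linearEquivAt ℝ q
      (FiberBundle.mem_baseSet_trivializationAt' q)).symm.finiteDimensional
  obtain ⟨b, hb⟩ := exists_frame (m := m) (F := F) (E := E) p
  obtain ⟨T, hT, -⟩ := exists_complement (S.form p) (S.symm p) (hrank p)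
  let η : Sec m M F E := b.constSec fun i => b.comp i p e₀
  have hη : η p = e₀ := by rw [b.constSec_apply]; exact b.sum_comp hb _
  let τ : Fin d → Sec m M F E := fun a => b.constSec fun i => b.comp i p (T (EuclideanSpace.single a 1))
  let τL : ∀ q : M, EuclideanSpace ℝ (Fin d) →ₗ[ℝ] E q := fun q =>
    ∑ a, LinearMap.smulRight ((EuclideanSpace.proj (𝕜 := ℝ) a : EuclideanSpace ℝ (Fin d) →L[ℝ] ℝ) :
      EuclideanSpace ℝ (Fin d) →ₗ[ℝ] ℝ) (τ a q)
  have hτL : ∀ q u, τL q u = ∑ a, u a • τ a q := fun q u => sum_smulRight_apply _ _ _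
  have hτs : ∀ q a, τL q (EuclideanSpace.single a 1) = τ a q := fun q a => by
    rw [hτL]; simp
  have hτp : τL p = T := by
    refine (EuclideanSpace.basisFun (Fin d) ℝ).toBasis.ext fun a => ?_
    simp only [OrthonormalBasis.coe_toBasis, EuclideanSpace.basisFun_apply, hτs]
    change b.constSec _ p = _
    rw [b.constSec_apply]
    exact b.sum_comp hb _
  let Q : M → EuclideanSpace ℝ (Fin d) →L[ℝ] EuclideanSpace ℝ (Fin d) →L[ℝ] ℝ := fun q =>
    bilinOfMatrix fun a a' => S.form q (τ a q) (τ a' q)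
  let l : M → EuclideanSpace ℝ (Fin d) →L[ℝ] ℝ := fun q => linOfVector fun a => S.form q (η q) (τ a q)
  have hQ : ∀ q u w, Q q u w = S.form q (τL q u) (τL q w) := fun q u w => by
    have := bilinOfMatrix_apply ((S.form q).compl₁₂ (τL q) (τL q)) u w
    simp only [LinearMap.compl₁₂_apply, hτs] at this
    exact this
  have hl : ∀ q w, l q w = S.form q (η q) (τL q w) := fun q w => by
    have := linOfVector_apply ((S.form q (η q)).comp (τL q)) w
    simp only [LinearMap.comp_apply, hτs] at this
    exact this
  have hQs : ContMDiff (𝓡 m) 𝓘(ℝ, EuclideanSpace ℝ (Fin d) →L[ℝ] EuclideanSpace ℝ (Fin d) →L[ℝ] ℝ)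
      ∞ Q := fun q => contMDiffAt_bilinOfMatrix fun a a' => (S.smooth (τ a) (τ a')).contMDiffAt
  have hls : ContMDiff (𝓡 m) 𝓘(ℝ, EuclideanSpace ℝ (Fin d) →L[ℝ] ℝ) ∞ l :=
    fun q => contMDiffAt_linOfVector fun a => (S.smooth η (τ a)).contMDiffAt
  have hQp : ∀ u, (∀ w, Q p u w = 0) → u = 0 := fun u hu => hT u fun w => by
    rw [← hτp, ← hQ]; exact hu w
  obtain ⟨U, hU, hUo, hpU⟩ := eventually_nhds_iff.1
    (eventually_nondegenerate hQs.continuous.continuousAt hQp)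
  let c : M → EuclideanSpace ℝ (Fin d) := fun q => ContinuousLinearMap.inverse (Q q) (l q)
  let s : ∀ q, E q := fun q => η q - ∑ a, c q a • τ a q
  have hs : ContMDiffOn (𝓡 m) ((𝓡 m).prod 𝓘(ℝ, F)) ∞ (fun q => (⟨q, s q⟩ : TotalSpace F E)) U := by
    intro q hq
    have hc := contMDiffAt_inverse_apply hQs.contMDiffAt hls.contMDiffAt (hU q hq)
    refine ContMDiffAt.contMDiffWithinAt (ContMDiffAt.sub_section η.contMDiff.contMDiffAt
      (ContMDiffAt.sum_section fun a _ => ContMDiffAt.smul_section ?_ (τ a).contMDiff.contMDiffAt))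
    exact (EuclideanSpace.proj (𝕜 := ℝ) a).contDiff.contMDiff.contMDiffAt.comp q hc
  have hsker : ∀ q ∈ U, S.form q (s q) = 0 := by
    intro q hq
    refine eq_zero_of_orthogonal (S.symm q) (by rw [hrank q, finrank_euclideanSpace_fin]) (τL q)
      (fun u hu => hU q hq u fun w => by rw [hQ]; exact hu w) fun w => ?_
    have h1 := congrArg (fun f : EuclideanSpace ℝ (Fin d) →L[ℝ] ℝ => f w)
      (apply_inverse_of_nondegenerate (hU q hq) (l q))
    rw [hQ, hl] at h1
    simp only [s, ← hτL]
    rw [map_sub, LinearMap.sub_apply, ← h1, sub_self]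
  obtain ⟨χ, hχ, hχ1, hχU⟩ := exists_bump (m := m) (hUo.mem_nhds hpU)
  refine ⟨⟨χ • s, hχ.contMDiffOn.smul_section_of_tsupport hUo hχU hs⟩, ?_, fun q => ?_⟩
  · change χ p • s p = e₀
    have hlp : l p = 0 := by
      ext w
      rw [hl, hη, he₀]
      rfl
    simp [hχ1.eq_of_nhds, s, c, hlp, hη]
  · change S.form q (χ q • s q) = 0
    by_cases hq : q ∈ tsupport χ
    · rw [map_smul, hsker q (hχU hq), smul_zero]
    · rw [image_eq_zero_of_notMem_tsupport hq, zero_smul, map_zero]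

end Kernel


/-! ### Gauge transformations along the kernel of `S` -/

section Derivative

variable {m : ℕ} {M : Type*} [TopologicalSpace M]
  [ChartedSpace (EuclideanSpace ℝ (Fin m)) M]

lemma mvfderiv_sum_mul_apply {ι : Type*} [Fintype ι] {s f : ι → M → ℝ} {x : M}
    (hs : ∀ i, MDifferentiableAt (𝓡 m) 𝓘(ℝ, ℝ) (s i) x)
    (hf : ∀ i, MDifferentiableAt (𝓡 m) 𝓘(ℝ, ℝ) (f i) x) (v : TangentSpace (𝓡 m) x) :
    mvfderiv (𝓡 m) (fun z => ∑ i, s i z * f i z) x v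
      = ∑ i, (s i x * mvfderiv (𝓡 m) (f i) x v + f i x * mvfderiv (𝓡 m) (s i) x v) := by
  refine (mvfderiv_sum_apply (f := fun i z => s i z * f i z) Finset.univ
    (fun i _ => (hs i).mul (hf i)) v).trans ?_
  exact Finset.sum_congr rfl fun i _ => mvfderiv_mul_apply (hs i) (hf i) v

end Derivative

section Kernel

variable {d : ℕ} {W : Type*} [TopologicalSpace W] [ChartedSpace (EuclideanSpace ℝ (Fin d)) W]
  [IsManifold (𝓡 d) ∞ W]
  {m : ℕ} {M : Type*} [TopologicalSpace M] [T2Space M]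
  [ChartedSpace (EuclideanSpace ℝ (Fin m)) M] [IsManifold (𝓡 m) ∞ M]
  {F : Type*} [NormedAddCommGroup F] [NormedSpace ℝ F]
  {E : M → Type*} [TopologicalSpace (TotalSpace F E)] [∀ x, TopologicalSpace (E x)]
  [∀ x, AddCommGroup (E x)] [∀ x, Module ℝ (E x)] [FiberBundle F E] [VectorBundle ℝ F E]

lemma Frame.mvfderiv_comp_constSec (b : Frame m M F E) (ξ : Fin (finrank ℝ F) → ℝ) {x : M}
    (hx : x ∈ b.dom) (i : Fin (finrank ℝ F)) (V : TangentSpace (𝓡 m) x) :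
    mvfderiv (𝓡 m) (fun q => b.comp i q (b.constSec ξ q)) x V = 0 := by
  have : (fun q => b.comp i q (b.constSec ξ q)) =ᶠ[𝓝 x] fun _ => ξ i := by
    filter_upwards [b.isOpen_dom.mem_nhds hx] with q hq
    rw [b.constSec_apply, b.comp_sum hq]
  rw [mvfderiv_congr this, mvfderiv_const]
  rfl

lemma SymTensor.contMDiff_comp (S : SymTensor m M F E) (b : Frame m M F E)
    (i j : Fin (finrank ℝ F)) : ContMDiff (𝓡 m) 𝓘(ℝ, ℝ) ∞ (S.comp b i j) :=
  S.smooth (b.sec i) (b.sec j)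

lemma SymTensor.comp_symm (S : SymTensor m M F E) (b : Frame m M F E)
    (i j : Fin (finrank ℝ F)) (x : M) : S.comp b i j x = S.comp b j i x :=
  S.symm x _ _

lemma SymTensor.form_sec_eq_sum (S : SymTensor m M F E) (b : Frame m M F E) {x : M}
    (hx : x ∈ b.dom) (e : E x) (j : Fin (finrank ℝ F)) :
    S.form x e (b.sec j x) = ∑ i, S.comp b i j x * b.comp i x e := by
  conv_lhs => rw [← b.sum_comp hx e]
  simp [SymTensor.comp, mul_comm]

/-- The derivative of `S` on sections with constant components. -/
lemma SymTensor.mvfderiv_form_constSec (S : SymTensor m M F E) (b : Frame m M F E) {x : M}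
    (ξ η : Fin (finrank ℝ F) → ℝ) (V : TangentSpace (𝓡 m) x) :
    mvfderiv (𝓡 m) (fun q => S.form q (b.constSec ξ q) (b.constSec η q)) x V
      = ∑ i, ∑ j, mvfderiv (𝓡 m) (S.comp b i j) x V * ξ i * η j := by
  have h1 : (fun q => S.form q (b.constSec ξ q) (b.constSec η q))
      = fun q => ∑ i, ∑ j, S.comp b i j q * (ξ i * η j) := by
    funext q
    rw [b.constSec_apply, b.constSec_apply]
    simp only [map_sum, map_smul, LinearMap.sum_apply, LinearMap.smul_apply, smul_eq_mul,
      Finset.mul_sum, SymTensor.comp]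
    rw [Finset.sum_comm]
    exact Finset.sum_congr rfl fun i _ => Finset.sum_congr rfl fun j _ => by ring
  have hS : ∀ i j, MDifferentiableAt (𝓡 m) 𝓘(ℝ, ℝ) (S.comp b i j) x := fun i j =>
    (S.contMDiff_comp b i j).contMDiffAt.mdifferentiableAt (by simp)
  rw [h1]
  refine (mvfderiv_sum_apply (f := fun i q => ∑ j, S.comp b i j q * (ξ i * η j)) Finset.univ
    (fun i _ => (contMDiffAt_finsetSum fun j _ => (S.contMDiff_comp b i j).contMDiffAt.mul
      contMDiffAt_const).mdifferentiableAt (n := ∞) (by simp)) V).trans ?_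
  refine Finset.sum_congr rfl fun i _ => ?_
  refine (mvfderiv_sum_mul_apply (s := fun j => S.comp b i j) (f := fun j _ => ξ i * η j)
    (hS i) (fun j => mdifferentiableAt_const) V).trans ?_
  refine Finset.sum_congr rfl fun j _ => ?_
  rw [mvfderiv_const]
  change S.comp b i j x * 0 + _ = _
  ring

/-- The variation of the metric with the sums arranged. -/
lemma FieldConfig.metricVar_eq (L : LieAlgebroid m M F E) (S : SymTensor m M F E)
    (φ : FieldConfig d W m M F E) (ε : ∀ x, E (φ.base x)) (b : Frame m M F E) (x : W)
    (u w : TangentSpace (𝓡 d) x) :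
    φ.metricVar L S ε b x u w
      = ∑ i, ∑ j, mvfderiv (𝓡 m) (S.comp b i j) (φ.base x) (L.anchor (φ.base x) (ε x))
          * φ.comp b i x u * φ.comp b j x w
        + ∑ j, (∑ i, S.comp b i j (φ.base x) * φ.gaugeVar L ε b i x u) * φ.comp b j x w
        + ∑ j, (∑ i, S.comp b i j (φ.base x) * φ.gaugeVar L ε b i x w) * φ.comp b j x u := by
  simp only [FieldConfig.metricVar, Finset.sum_add_distrib, Finset.sum_mul]
  congr 1
  · congr 1
    exact Finset.sum_comm
  · refine Finset.sum_congr rfl fun i _ => Finset.sum_congr rfl fun j _ => ?_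
    rw [S.comp_symm b i j]
    ring

variable [FiniteDimensional ℝ F] [ContMDiffVectorBundle ∞ F E (𝓡 m)]

/-- A gauge parameter in the kernel of `S` leaves the metric invariant. If `ψ` is a section of the
kernel through `ε x`, then differentiating `S(ε, b_J) = 0` and `S(ψ, b_J) = 0` shows that the
derivatives of `ε` may be replaced by those of `ψ`, so that `δ_ε g = (L_ψ S)(A, A)`. -/
lemma FieldConfig.metricVar_eq_zero_of_kernel (L : LieAlgebroid m M F E) (S : SymTensor m M F E)
    {r : ℕ} (hrank : ∀ x : M, finrank ℝ (LinearMap.range (S.form x)) = r)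
    (hinv : L.KernelInvariant S) (φ : FieldConfig d W m M F E) {x : W}
    (h1 : ∀ u : TangentSpace (𝓡 d) x,
      mfderiv (𝓡 d) (𝓡 m) φ.base x u = L.anchor (φ.base x) (φ.form x u))
    (ε : ∀ x, E (φ.base x)) (hε : ∀ z, S.form (φ.base z) (ε z) = 0)
    (b : Frame m M F E) (hb : φ.base x ∈ b.dom)
    (hεd : ∀ i, MDifferentiableAt (𝓡 d) 𝓘(ℝ, ℝ) (fun z => b.comp i (φ.base z) (ε z)) x)
    (u w : TangentSpace (𝓡 d) x) : φ.metricVar L S ε b x u w = 0 := by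
  obtain ⟨ψ, hψx, hψ⟩ := S.exists_kernel_sec hrank (hε x)
  have hX : MDifferentiableAt (𝓡 d) (𝓡 m) φ.base x :=
    φ.contMDiff_base.contMDiffAt.mdifferentiableAt (by simp)
  have hS : ∀ i j, MDifferentiableAt (𝓡 m) 𝓘(ℝ, ℝ) (S.comp b i j) (φ.base x) := fun i j =>
    (S.contMDiff_comp b i j).contMDiffAt.mdifferentiableAt (by simp)
  have hψd : ∀ i, MDifferentiableAt (𝓡 m) 𝓘(ℝ, ℝ) (fun q => b.comp i q (ψ q)) (φ.base x) :=
    fun i => (b.contMDiffAt_comp_sec i ψ hb).mdifferentiableAt (by simp)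
  have k1 : ∀ j (v : TangentSpace (𝓡 d) x), ∑ i, (S.comp b i j (φ.base x)
        * mvfderiv (𝓡 d) (fun z => b.comp i (φ.base z) (ε z)) x v
      + b.comp i (φ.base x) (ε x) * mvfderiv (𝓡 m) (S.comp b i j) (φ.base x)
          (L.anchor (φ.base x) (φ.form x v))) = 0 := by
    intro j v
    have e1 := mvfderiv_sum_mul_apply (s := fun i z => S.comp b i j (φ.base z))
      (f := fun i z => b.comp i (φ.base z) (ε z)) (fun i => (hS i j).comp x hX) hεd v
    have e2 : (fun z => ∑ i, S.comp b i j (φ.base z) * b.comp i (φ.base z) (ε z))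
        =ᶠ[𝓝 x] fun _ => (0 : ℝ) := by
      filter_upwards [hX.continuousAt.preimage_mem_nhds (b.isOpen_dom.mem_nhds hb)] with z hz
      rw [← S.form_sec_eq_sum b hz, hε, LinearMap.zero_apply]
    rw [mvfderiv_congr e2, mvfderiv_const] at e1
    refine Eq.trans (Finset.sum_congr rfl fun i _ => ?_) e1.symm
    rw [← h1 v]
    congr 2
    exact (mvfderiv_comp_apply x (hS i j) hX v).symm
  have k2 : ∀ j (V : TangentSpace (𝓡 m) (φ.base x)), ∑ i, (S.comp b i j (φ.base x)
        * mvfderiv (𝓡 m) (fun q => b.comp i q (ψ q)) (φ.base x) V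
      + b.comp i (φ.base x) (ε x) * mvfderiv (𝓡 m) (S.comp b i j) (φ.base x) V) = 0 := by
    intro j V
    have e1 := mvfderiv_sum_mul_apply (s := fun i => S.comp b i j)
      (f := fun i q => b.comp i q (ψ q)) (fun i => hS i j) hψd V
    have e2 : (fun q => ∑ i, S.comp b i j q * b.comp i q (ψ q))
        =ᶠ[𝓝 (φ.base x)] fun _ => (0 : ℝ) := by
      filter_upwards [b.isOpen_dom.mem_nhds hb] with q hq
      rw [← S.form_sec_eq_sum b hq, hψ, LinearMap.zero_apply]
    rw [mvfderiv_congr e2, mvfderiv_const, hψx] at e1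
    exact e1.symm
  let σ : TangentSpace (𝓡 d) x → Sec m M F E := fun v => b.constSec fun j => φ.comp b j x v
  have hσ : ∀ v, σ v (φ.base x) = φ.form x v := fun v => by
    rw [b.constSec_apply]; exact b.sum_comp hb _
  have k3 : ∀ j v, ∑ i, S.comp b i j (φ.base x) * φ.gaugeVar L ε b i x v
      = S.form (φ.base x) (L.bracket (σ v) ψ (φ.base x)) (b.sec j (φ.base x)) := by
    intro j v
    rw [S.form_sec_eq_sum b hb, ← sub_eq_zero, ← Finset.sum_sub_distrib]
    have e3 := k1 j v
    rw [← k2 j (L.anchor (φ.base x) (φ.form x v)), ← sub_eq_zero, ← Finset.sum_sub_distrib] at e3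
    rw [← e3]
    refine Finset.sum_congr rfl fun i _ => ?_
    rw [L.comp_bracket b (σ v) ψ hb, b.mvfderiv_comp_constSec _ hb, hσ, hψx]
    simp only [FieldConfig.gaugeVar, FieldConfig.comp]
    ring
  have k4 : ∀ v v', ∑ j, (∑ i, S.comp b i j (φ.base x) * φ.gaugeVar L ε b i x v)
      * φ.comp b j x v' = S.form (φ.base x) (L.bracket (σ v) ψ (φ.base x)) (σ v' (φ.base x)) := by
    intro v v'
    simp only [k3]
    conv_rhs => rw [b.constSec_apply]
    simp [map_sum, mul_comm]
  have k5 := hinv ψ hψ (σ u) (σ w) (φ.base x)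
  rw [LieAlgebroid.lieDeriv, S.mvfderiv_form_constSec b, hψx, L.bracket_antisymm ψ (σ u),
    L.bracket_antisymm ψ (σ w), S.symm _ (σ u (φ.base x))] at k5
  simp only [ContMDiffSection.coe_neg, Pi.neg_apply, map_neg, LinearMap.neg_apply] at k5
  rw [φ.metricVar_eq L S, k4, k4]
  linarith

/-- The variation of the metric is additive in the gauge parameter. -/
lemma FieldConfig.metricVar_add (L : LieAlgebroid m M F E) (S : SymTensor m M F E)
    (φ : FieldConfig d W m M F E) {x : W} (ε ε' : ∀ x, E (φ.base x)) (b : Frame m M F E)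
    (hεd : ∀ i, MDifferentiableAt (𝓡 d) 𝓘(ℝ, ℝ) (fun z => b.comp i (φ.base z) (ε z)) x)
    (hεd' : ∀ i, MDifferentiableAt (𝓡 d) 𝓘(ℝ, ℝ) (fun z => b.comp i (φ.base z) (ε' z)) x)
    (u w : TangentSpace (𝓡 d) x) :
    φ.metricVar L S (fun z => ε z + ε' z) b x u w
      = φ.metricVar L S ε b x u w + φ.metricVar L S ε' b x u w := by
  have h1 : ∀ i (v : TangentSpace (𝓡 d) x), φ.gaugeVar L (fun z => ε z + ε' z) b i x v
      = φ.gaugeVar L ε b i x v + φ.gaugeVar L ε' b i x v := by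
    intro i v
    simp only [FieldConfig.gaugeVar, map_add, mul_add, Finset.sum_add_distrib]
    rw [mvfderiv_fun_add (hεd i) (hεd' i)]
    rw [add_apply]
    ring
  simp only [FieldConfig.metricVar, h1, map_add, ← Finset.sum_add_distrib]
  exact Finset.sum_congr rfl fun i _ => Finset.sum_congr rfl fun j _ => by ring

end Kernel


/-! ### Gauge transformations along the spacetime -/

section Calculus

lemma hasDerivAt_sum_mul_mul {ι κ : Type*} [Fintype ι] [Fintype κ] {s : ι → κ → ℝ → ℝ}
    {f : ι → ℝ → ℝ} {g : κ → ℝ → ℝ} {s' : ι → κ → ℝ} {f' : ι → ℝ} {g' : κ → ℝ} {t : ℝ}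
    (hs : ∀ i j, HasDerivAt (s i j) (s' i j) t) (hf : ∀ i, HasDerivAt (f i) (f' i) t)
    (hg : ∀ j, HasDerivAt (g j) (g' j) t) :
    HasDerivAt (fun r => ∑ i, ∑ j, s i j r * f i r * g j r)
      (∑ i, ∑ j, (s' i j * f i t * g j t + s i j t * f' i * g j t + s i j t * f i t * g' j)) t := by
  refine HasDerivAt.fun_sum fun i _ => HasDerivAt.fun_sum fun j _ => ?_
  refine (((hs i j).mul (hf i)).mul (hg j)).congr_deriv ?_
  simp only [Pi.mul_apply]
  ring

lemma fderiv_sum_mul_mul {ι κ V : Type*} [Fintype ι] [Fintype κ] [NormedAddCommGroup V]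
    [NormedSpace ℝ V] {s : ι → κ → V → ℝ} {f : ι → V → ℝ} {g : κ → V → ℝ} {y : V}
    (hs : ∀ i j, DifferentiableAt ℝ (s i j) y) (hf : ∀ i, DifferentiableAt ℝ (f i) y)
    (hg : ∀ j, DifferentiableAt ℝ (g j) y) (η : V) :
    fderiv ℝ (fun z => ∑ i, ∑ j, s i j z * f i z * g j z) y η
      = ∑ i, ∑ j, (fderiv ℝ (s i j) y η * f i y * g j y + s i j y * fderiv ℝ (f i) y η * g j y
        + s i j y * f i y * fderiv ℝ (g j) y η) := by
  have hl : HasDerivAt (fun t : ℝ => y + t • η) η 0 := by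
    simpa using ((hasDerivAt_id (0 : ℝ)).smul_const η).const_add y
  have h0 : y + (0 : ℝ) • η = y := by simp
  have hc : ∀ {F : V → ℝ}, DifferentiableAt ℝ F y →
      HasDerivAt (fun t : ℝ => F (y + t • η)) (fderiv ℝ F y η) 0 := by
    intro F hF
    rw [← h0] at hF
    have := hF.hasFDerivAt.comp_hasDerivAt (0 : ℝ) hl
    rwa [h0] at this
  have h1 := hasDerivAt_sum_mul_mul (fun i j => hc (hs i j)) (fun i => hc (hf i))
    (fun j => hc (hg j))
  have h2 : DifferentiableAt ℝ (fun z => ∑ i, ∑ j, s i j z * f i z * g j z) y :=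
    DifferentiableAt.fun_sum fun i _ => DifferentiableAt.fun_sum fun j _ =>
      ((hs i j).fun_mul (hf i)).fun_mul (hg j)
  rw [(hc h2).unique h1]
  simp only [h0]

lemma fderiv_comp_linear_snd {V : Type*} [NormedAddCommGroup V] [NormedSpace ℝ V]
    {P : V × V → ℝ} (hP : ∀ z u u', P (z, u + u') = P (z, u) + P (z, u'))
    (hP' : ∀ z (r : ℝ) u, P (z, r • u) = r * P (z, u)) {f : V → V} {y : V}
    (hf : DifferentiableAt ℝ f y) (hd : DifferentiableAt ℝ P (y, f y)) (u : V) :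
    DifferentiableAt ℝ (fun z => P (z, f z)) y ∧
    fderiv ℝ (fun z => P (z, f z)) y u
      = fderiv ℝ (fun z => P (z, f y)) y u + P (y, fderiv ℝ f y u) := by
  have h1 : HasFDerivAt (fun z => P (z, f z))
      ((fderiv ℝ P (y, f y)).comp ((ContinuousLinearMap.id ℝ V).prod (fderiv ℝ f y))) y :=
    hd.hasFDerivAt.comp (f := fun z => (z, f z)) y ((hasFDerivAt_id y).prodMk hf.hasFDerivAt)
  have h2 : HasFDerivAt (fun z => P (z, f y))
      ((fderiv ℝ P (y, f y)).comp ((ContinuousLinearMap.id ℝ V).prod 0)) y :=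
    hd.hasFDerivAt.comp (f := fun z => (z, f y)) y ((hasFDerivAt_id y).prodMk (hasFDerivAt_const _ _))
  have h3 : fderiv ℝ P (y, f y) (0, fderiv ℝ f y u) = P (y, fderiv ℝ f y u) := by
    have hl : HasDerivAt (fun t : ℝ => (y, f y + t • fderiv ℝ f y u)) (0, fderiv ℝ f y u) 0 := by
      refine (hasDerivAt_const _ _).prodMk ?_
      simpa using ((hasDerivAt_id (0 : ℝ)).smul_const (fderiv ℝ f y u)).const_add (f y)
    have h0 : f y + (0 : ℝ) • fderiv ℝ f y u = f y := by simp
    have h4 : HasDerivAt (fun t : ℝ => P (y, f y + t • fderiv ℝ f y u))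
        (fderiv ℝ P (y, f y) (0, fderiv ℝ f y u)) 0 := by
      rw [← h0] at hd
      have := hd.hasFDerivAt.comp_hasDerivAt (0 : ℝ) hl
      rwa [h0] at this
    simp only [hP, hP'] at h4
    have h5 : HasDerivAt (fun t : ℝ => P (y, f y) + t * P (y, fderiv ℝ f y u))
        (P (y, fderiv ℝ f y u)) 0 := by
      simpa using ((hasDerivAt_id (0 : ℝ)).mul_const (P (y, fderiv ℝ f y u))).const_add (P (y, f y))
    exact h4.unique h5
  refine ⟨h1.differentiableAt, ?_⟩
  rw [h1.fderiv, h2.fderiv, ← h3]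
  simp only [ContinuousLinearMap.comp_apply, ContinuousLinearMap.prod_apply, ← map_add]
  simp

end Calculus

section Diffeo

variable {d : ℕ} {W : Type*} [TopologicalSpace W] [ChartedSpace (EuclideanSpace ℝ (Fin d)) W]
  [IsManifold (𝓡 d) ∞ W]

lemma coordVec_add (x₀ : W) (y u u' : EuclideanSpace ℝ (Fin d)) :
    coordVec x₀ y (u + u') = coordVec x₀ y u + coordVec x₀ y u' :=
  map_add (mfderiv 𝓘(ℝ, EuclideanSpace ℝ (Fin d)) (𝓡 d) (extChartAt (𝓡 d) x₀).symm y) u u'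

lemma coordVec_smul (x₀ : W) (y u : EuclideanSpace ℝ (Fin d)) (r : ℝ) :
    coordVec x₀ y (r • u) = r • coordVec x₀ y u :=
  map_smul (mfderiv 𝓘(ℝ, EuclideanSpace ℝ (Fin d)) (𝓡 d) (extChartAt (𝓡 d) x₀).symm y) r u

lemma chartField_self (v : ∀ x : W, TangentSpace (𝓡 d) x) (x : W) :
    chartField v x (extChartAt (𝓡 d) x x) = v x := by
  have h : (extChartAt (𝓡 d) x).symm (extChartAt (𝓡 d) x x) = x := extChartAt_to_inv x
  unfold chartField
  rw [h]
  exact mfderiv_chart_self x (v x)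

lemma coordVec_chartField (v : ∀ x : W, TangentSpace (𝓡 d) x) {x₀ : W}
    {y : EuclideanSpace ℝ (Fin d)} (hy : y ∈ (extChartAt (𝓡 d) x₀).target) :
    coordVec x₀ y (chartField v x₀ y) = v ((extChartAt (𝓡 d) x₀).symm y) :=
  coordVec_mfderiv_chart hy _

lemma mvfderiv_comp_chart_self {x : W} {f : EuclideanSpace ℝ (Fin d) → ℝ}
    (hf : DifferentiableAt ℝ f (extChartAt (𝓡 d) x x)) (u : TangentSpace (𝓡 d) x) :
    MDifferentiableAt (𝓡 d) 𝓘(ℝ, ℝ) (fun z => f (extChartAt (𝓡 d) x z)) x ∧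
    mvfderiv (𝓡 d) (fun z => f (extChartAt (𝓡 d) x z)) x u
      = fderiv ℝ f (extChartAt (𝓡 d) x x) u := by
  have h1 := (contMDiffAt_chart (mem_extChartAt_source (I := 𝓡 d) x)).mdifferentiableAt (by simp)
  have h2 := hf.hasFDerivAt.hasMFDerivAt.comp x h1.hasMFDerivAt
  refine ⟨h2.mdifferentiableAt, ?_⟩
  have h3 : mfderiv (𝓡 d) 𝓘(ℝ, ℝ) (fun z => f (extChartAt (𝓡 d) x z)) x u
      = fderiv ℝ f (extChartAt (𝓡 d) x x)
        (mfderiv (𝓡 d) 𝓘(ℝ, EuclideanSpace ℝ (Fin d)) (extChartAt (𝓡 d) x) x u) :=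
    congrArg (fun A : EuclideanSpace ℝ (Fin d) →L[ℝ] ℝ => A u) h2.mfderiv
  rw [mfderiv_chart_self] at h3
  exact h3

variable {m : ℕ} {M : Type*} [TopologicalSpace M] [T2Space M]
  [ChartedSpace (EuclideanSpace ℝ (Fin m)) M] [IsManifold (𝓡 m) ∞ M]
  {F : Type*} [NormedAddCommGroup F] [NormedSpace ℝ F]
  {E : M → Type*} [TopologicalSpace (TotalSpace F E)] [∀ x, TopologicalSpace (E x)]
  [∀ x, AddCommGroup (E x)] [∀ x, Module ℝ (E x)] [FiberBundle F E] [VectorBundle ℝ F E]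
  [FiniteDimensional ℝ F] [ContMDiffVectorBundle ∞ F E (𝓡 m)]

/-- The gauge parameter `A(v)` acts on `A` by the Lie derivative along `v`, in coordinates
`(L_v A)_u = ∂_v A_u + A(∂_u v)`, because the field strength vanishes. -/
lemma FieldConfig.gaugeVar_form_apply (L : LieAlgebroid m M F E) (φ : FieldConfig d W m M F E)
    (hφ : φ.IsSolution L) (b : Frame m M F E) {x : W} (hb : φ.base x ∈ b.dom)
    {v : ∀ x : W, TangentSpace (𝓡 d) x}
    (hv : DifferentiableAt ℝ (chartField v x) (extChartAt (𝓡 d) x x))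
    (i : Fin (finrank ℝ F)) (u : EuclideanSpace ℝ (Fin d)) :
    MDifferentiableAt (𝓡 d) 𝓘(ℝ, ℝ) (fun z => b.comp i (φ.base z) (φ.form z (v z))) x ∧
    φ.gaugeVar L (fun z => φ.form z (v z)) b i x u
      = fderiv ℝ (φ.chartComp b i x u) (extChartAt (𝓡 d) x x) (v x)
        + φ.comp b i x (fderiv ℝ (chartField v x) (extChartAt (𝓡 d) x x) u) := by
  set y := extChartAt (𝓡 d) x x with hy
  have hyt : y ∈ (extChartAt (𝓡 d) x).target := mem_extChartAt_target x
  have hyx : (extChartAt (𝓡 d) x).symm y = x := extChartAt_to_inv x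
  have hbe : φ.base ((extChartAt (𝓡 d) x).symm y) ∈ b.dom := by rw [hyx]; exact hb
  let P : EuclideanSpace ℝ (Fin d) × EuclideanSpace ℝ (Fin d) → ℝ := fun q =>
    φ.comp b i ((extChartAt (𝓡 d) x).symm q.1) (coordVec x q.1 q.2)
  have hP := fderiv_comp_linear_snd (P := P)
    (fun z u u' => by simp only [P, FieldConfig.comp, coordVec_add, map_add])
    (fun z r u => by simp only [P, FieldConfig.comp, coordVec_smul, map_smul, smul_eq_mul]) hv
    ((φ.contDiffAt_comp_coordVec b i hyt hbe _).differentiableAt (by simp)) u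
  have h1 : (fun z => b.comp i (φ.base z) (φ.form z (v z)))
      =ᶠ[𝓝 x] fun z => P (extChartAt (𝓡 d) x z, chartField v x (extChartAt (𝓡 d) x z)) := by
    filter_upwards [extChartAt_source_mem_nhds (I := 𝓡 d) x] with z hz
    simp only [P]
    rw [coordVec_chartField v ((extChartAt (𝓡 d) x).map_source hz),
      (extChartAt (𝓡 d) x).left_inv hz]
    rfl
  have h2 := mvfderiv_comp_chart_self (x := x)
    (f := fun y => P (y, chartField v x y)) hP.1 u
  refine ⟨h2.1.congr_of_eventuallyEq h1, ?_⟩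
  have h3 := hφ.2 b x hb i u (chartField v x y)
  have h4 : φ.chartComp b i x (fderiv ℝ (chartField v x) y u) y
      = φ.comp b i x (fderiv ℝ (chartField v x) y u) :=
    apply_coordVec_self x (fun p v' => φ.comp b i p v') _
  have h5 := h2.2.trans hP.2
  rw [← mvfderiv_congr h1] at h5
  have h6 : P (y, fderiv ℝ (chartField v x) y u) = φ.comp b i x (fderiv ℝ (chartField v x) y u) :=
    h4
  have h7 : (fun z => P (z, chartField v x y)) = φ.chartComp b i x (chartField v x y) := rfl
  dsimp only at h3
  rw [h6, h7] at h5
  have h8 : chartField v x y = v x := chartField_self v x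
  rw [h8] at h3 h5
  unfold FieldConfig.gaugeVar
  rw [h5]
  have h9 : ∀ k, φ.comp b k x (v x) = b.comp k (φ.base x) (φ.form x (v x)) := fun k => rfl
  simp only [h9] at h3
  linarith

lemma FieldConfig.chartForm_eq_sum (S : SymTensor m M F E) (φ : FieldConfig d W m M F E)
    (b : Frame m M F E) {x : W} {y : EuclideanSpace ℝ (Fin d)}
    (hb : φ.base ((extChartAt (𝓡 d) x).symm y) ∈ b.dom) (u w : EuclideanSpace ℝ (Fin d)) :
    chartForm (φ.metric S) x y u w
      = ∑ i, ∑ j, S.comp b i j (φ.base ((extChartAt (𝓡 d) x).symm y))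
          * φ.chartComp b i x u y * φ.chartComp b j x w y :=
  S.form_eq_sum b hb _ _

/-- The gauge parameter `A(v)` acts on the metric by the Lie derivative along `v`. -/
lemma FieldConfig.metricVar_form_apply (L : LieAlgebroid m M F E) (S : SymTensor m M F E)
    (φ : FieldConfig d W m M F E)
    (hφ : φ.IsSolution L) (b : Frame m M F E) {x : W} (hb : φ.base x ∈ b.dom)
    {v : ∀ x : W, TangentSpace (𝓡 d) x}
    (hv : DifferentiableAt ℝ (chartField v x) (extChartAt (𝓡 d) x x))
    (u w : EuclideanSpace ℝ (Fin d)) :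
    φ.metricVar L S (fun z => φ.form z (v z)) b x u w
      = lieDerivMetric v (φ.metric S) x u w := by
  set y := extChartAt (𝓡 d) x x with hy
  have hyt : y ∈ (extChartAt (𝓡 d) x).target := mem_extChartAt_target x
  have hyx : (extChartAt (𝓡 d) x).symm y = x := extChartAt_to_inv x
  have hbe : φ.base ((extChartAt (𝓡 d) x).symm y) ∈ b.dom := by rw [hyx]; exact hb
  have hX : ContMDiffAt (𝓡 d) (𝓡 m) ∞ φ.base x := φ.contMDiff_base.contMDiffAt
  have hself : ∀ i, ∀ v : EuclideanSpace ℝ (Fin d), φ.chartComp b i x v y = φ.comp b i x v :=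
    fun i v => apply_coordVec_self x (fun p v' => φ.comp b i p v') v
  have hAd : ∀ i, ∀ v : EuclideanSpace ℝ (Fin d),
      DifferentiableAt ℝ (φ.chartComp b i x v) y := fun i v =>
    (φ.contDiffAt_chartComp b i hyt hbe v).differentiableAt (by simp)
  have hSd : ∀ i j, ∀ V : EuclideanSpace ℝ (Fin d),
      DifferentiableAt ℝ (fun z => S.comp b i j (φ.base ((extChartAt (𝓡 d) x).symm z))) y ∧
      fderiv ℝ (fun z => S.comp b i j (φ.base ((extChartAt (𝓡 d) x).symm z))) y V
      = mvfderiv (𝓡 m) (S.comp b i j) (φ.base x) (L.anchor (φ.base x) (φ.form x V)) := by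
    intro i j V
    have h := hasFDerivAt_comp_chart_symm (f := S.comp b i j) (X := φ.base) hyt
      (by rw [hyx]; exact hX.mdifferentiableAt (by simp))
      ((S.contMDiff_comp b i j).contMDiffAt.mdifferentiableAt (by simp)) V
    refine ⟨h.1, h.2.trans (Eq.trans ?_ (congrArg (mvfderiv (𝓡 m)
      (S.comp b i j) (φ.base x)) (hφ.1 x V)))⟩
    exact apply_coordVec_self x (fun p v' => mvfderiv (𝓡 m) (S.comp b i j)
      (φ.base p) (mfderiv (𝓡 d) (𝓡 m) φ.base p v')) V
  have e1 : (fun z => chartForm (φ.metric S) x z u w) =ᶠ[𝓝 y] fun z => ∑ i, ∑ j,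
      S.comp b i j (φ.base ((extChartAt (𝓡 d) x).symm z))
          * φ.chartComp b i x u z * φ.chartComp b j x w z := by
    have hc : ContinuousAt (fun z => φ.base ((extChartAt (𝓡 d) x).symm z)) y := by
      refine ContinuousAt.comp (g := φ.base) ?_ (contMDiffAt_chart_symm hyt).continuousAt
      rw [hyx]; exact hX.continuousAt
    filter_upwards [hc.preimage_mem_nhds (b.isOpen_dom.mem_nhds hbe)] with z hz
    exact φ.chartForm_eq_sum S b hz u w
  have hg := fun i u => (φ.gaugeVar_form_apply L hφ b hb hv i u).2
  unfold lieDerivMetric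
  dsimp only
  rw [e1.fderiv_eq, fderiv_sum_mul_mul (fun i j => (hSd i j 0).1) (fun i => hAd i u)
    (fun j => hAd j w), φ.chartForm_eq_sum S b hbe, φ.chartForm_eq_sum S b hbe,
    ← Finset.sum_add_distrib, ← Finset.sum_add_distrib]
  unfold FieldConfig.metricVar
  refine Finset.sum_congr rfl fun i _ => ?_
  rw [← Finset.sum_add_distrib, ← Finset.sum_add_distrib]
  refine Finset.sum_congr rfl fun j _ => ?_
  have h8 : chartField v x y = v x := chartField_self v x
  rw [hg, hg, (hSd i j _).2, h8]
  simp only [hself, hyx]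
  rw [← hy]
  ring

end Diffeo


/-! ### The vector field induced by a gauge parameter -/

section Induced

variable {d : ℕ} {W : Type*} [TopologicalSpace W] [ChartedSpace (EuclideanSpace ℝ (Fin d)) W]
  [IsManifold (𝓡 d) ∞ W]
  {m : ℕ} {M : Type*} [TopologicalSpace M] [T2Space M]
  [ChartedSpace (EuclideanSpace ℝ (Fin m)) M] [IsManifold (𝓡 m) ∞ M]
  {F : Type*} [NormedAddCommGroup F] [NormedSpace ℝ F]
  {E : M → Type*} [TopologicalSpace (TotalSpace F E)] [∀ x, TopologicalSpace (E x)]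
  [∀ x, AddCommGroup (E x)] [∀ x, Module ℝ (E x)] [FiberBundle F E] [VectorBundle ℝ F E]

lemma exists_apply_eq_of_nondegenerate {D : Type*} [AddCommGroup D] [Module ℝ D]
    [FiniteDimensional ℝ D] (B : D →ₗ[ℝ] D →ₗ[ℝ] ℝ) (hB : ∀ u, (∀ w, B u w = 0) → u = 0)
    (l : D →ₗ[ℝ] ℝ) : ∃ v, ∀ w, B v w = l w := by
  have hinj : Function.Injective B := by
    rw [injective_iff_map_eq_zero]
    intro u hu
    exact hB u fun w => by rw [hu]; rfl
  obtain ⟨v, hv⟩ := (LinearMap.injective_iff_surjective_of_finrank_eq_finrank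
    (Subspace.dual_finrank_eq (K := ℝ) (V := D)).symm).1 hinj l
  exact ⟨v, fun w => by rw [hv]⟩

/-- The metric of a field configuration as a bilinear map. -/
def FieldConfig.metricLin (S : SymTensor m M F E) (φ : FieldConfig d W m M F E) (x : W) :
    TangentSpace (𝓡 d) x →ₗ[ℝ] TangentSpace (𝓡 d) x →ₗ[ℝ] ℝ :=
  (S.form (φ.base x)).compl₁₂ (φ.form x) (φ.form x)

open Classical in
/-- The vector field `v` with `g(v, ·) = S(ε, A(·))`; at a point where there is no such vector it is
set to zero. -/
def FieldConfig.inducedField (S : SymTensor m M F E) (φ : FieldConfig d W m M F E)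
    (ε : ∀ x, E (φ.base x)) (x : W) : TangentSpace (𝓡 d) x :=
  if h : ∃ v, ∀ w, φ.metric S x v w = S.form (φ.base x) (ε x) (φ.form x w) then h.choose else 0

lemma FieldConfig.metric_inducedField (S : SymTensor m M F E) (φ : FieldConfig d W m M F E)
    (ε : ∀ x, E (φ.base x)) {x : W}
    (hx : ∀ v : TangentSpace (𝓡 d) x, (∀ w, φ.metric S x v w = 0) → v = 0)
    (w : TangentSpace (𝓡 d) x) :
    φ.metric S x (φ.inducedField S ε x) w = S.form (φ.base x) (ε x) (φ.form x w) := by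
  have : FiniteDimensional ℝ (TangentSpace (𝓡 d) x) :=
    inferInstanceAs (FiniteDimensional ℝ (EuclideanSpace ℝ (Fin d)))
  have h : ∃ v, ∀ w, φ.metric S x v w = S.form (φ.base x) (ε x) (φ.form x w) :=
    exists_apply_eq_of_nondegenerate (φ.metricLin S x) hx
      (S.form (φ.base x) (ε x) ∘ₗ φ.form x)
  unfold FieldConfig.inducedField
  rw [dif_pos h]
  exact h.choose_spec w

lemma FieldConfig.exists_bilinear_eq_chartForm (S : SymTensor m M F E) (φ : FieldConfig d W m M F E) (x : W)
    (y : EuclideanSpace ℝ (Fin d)) :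
    ∃ B : EuclideanSpace ℝ (Fin d) →ₗ[ℝ] EuclideanSpace ℝ (Fin d) →ₗ[ℝ] ℝ,
      ∀ u w, chartForm (φ.metric S) x y u w = B u w :=
  ⟨(φ.metricLin S ((extChartAt (𝓡 d) x).symm y)).compl₁₂
    (mfderiv 𝓘(ℝ, EuclideanSpace ℝ (Fin d)) (𝓡 d) (extChartAt (𝓡 d) x).symm y).toLinearMap
    (mfderiv 𝓘(ℝ, EuclideanSpace ℝ (Fin d)) (𝓡 d) (extChartAt (𝓡 d) x).symm y).toLinearMap,
    fun _ _ => rfl⟩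

variable [FiniteDimensional ℝ F] [ContMDiffVectorBundle ∞ F E (𝓡 m)]

/-- `δ_ε g = L_v g` for the induced vector field `v`, because `ε - A(v)` lies in the kernel of
`S`. -/
lemma FieldConfig.metricVar_eq_lieDerivMetric (L : LieAlgebroid m M F E) (S : SymTensor m M F E)
    (hrank : ∀ x : M, finrank ℝ (LinearMap.range (S.form x)) = d)
    (hinv : L.KernelInvariant S) (φ : FieldConfig d W m M F E) (hφ : φ.IsSolution L)
    (hnd : NonDegenerate (φ.metric S)) (ε : ∀ x, E (φ.base x))
    (b : Frame m M F E) {x : W} (hb : φ.base x ∈ b.dom)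
    (hεd : ∀ i, MDifferentiableAt (𝓡 d) 𝓘(ℝ, ℝ) (fun z => b.comp i (φ.base z) (ε z)) x)
    (hv : DifferentiableAt ℝ (chartField (φ.inducedField S ε) x) (extChartAt (𝓡 d) x x))
    (u w : EuclideanSpace ℝ (Fin d)) :
    φ.metricVar L S ε b x u w
      = lieDerivMetric (φ.inducedField S ε) (φ.metric S) x u w := by
  have hfd : ∀ q : M, FiniteDimensional ℝ (E q) := fun q =>
    ((trivializationAt F E q).linearEquivAt ℝ q
      (FiberBundle.mem_baseSet_trivializationAt' q)).symm.finiteDimensional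
  have hAv := fun i => (φ.gaugeVar_form_apply L hφ b hb hv i 0).1
  have hker : ∀ z, S.form (φ.base z) (ε z - φ.form z (φ.inducedField S ε z)) = 0 := by
    intro z
    have : FiniteDimensional ℝ (TangentSpace (𝓡 d) z) :=
      inferInstanceAs (FiniteDimensional ℝ (EuclideanSpace ℝ (Fin d)))
    have hfr : finrank ℝ (TangentSpace (𝓡 d) z) = d := finrank_euclideanSpace_fin
    refine eq_zero_of_orthogonal (S.symm (φ.base z)) (by rw [hrank, hfr]) (φ.form z) (hnd z)
      fun w => ?_
    have := φ.metric_inducedField S ε (hnd z) w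
    rw [map_sub, LinearMap.sub_apply, sub_eq_zero, ← this]
    rfl
  have hkd : ∀ i, MDifferentiableAt (𝓡 d) 𝓘(ℝ, ℝ) (fun z => b.comp i (φ.base z)
      (ε z - φ.form z (φ.inducedField S ε z))) x := by
    intro i
    simp only [map_sub]
    exact (hεd i).sub (hAv i)
  have h1 := φ.metricVar_add L S (fun z => φ.form z (φ.inducedField S ε z))
    (fun z => ε z - φ.form z (φ.inducedField S ε z)) b hAv hkd u w
  have h2 := φ.metricVar_eq_zero_of_kernel L S hrank hinv (hφ.1 x) _ hker b hb hkd u w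
  have h3 := φ.metricVar_form_apply L S hφ b hb hv u w
  have h4 : ε = fun z => φ.form z (φ.inducedField S ε z)
      + (ε z - φ.form z (φ.inducedField S ε z)) := funext fun z => (add_sub_cancel _ _).symm
  have h5 : φ.metricVar L S ε b x u w = φ.metricVar L S (fun z => φ.form z (φ.inducedField S ε z)
      + (ε z - φ.form z (φ.inducedField S ε z))) b x u w :=
    congrArg (fun ε' => φ.metricVar L S ε' b x u w) h4
  exact h5.trans (h1.trans ((congrArg₂ (· + ·) h3 h2).trans (add_zero _)))

section Family

variable {Φ : ℝ → FieldConfig d W m M F E} {ε : ∀ (t : ℝ) (x : W), E ((Φ t).base x)}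

lemma contMDiffAt_family_form
    (hfield : ContMDiff (𝓘(ℝ, ℝ).prod (𝓡 d).tangent) ((𝓡 m).prod 𝓘(ℝ, F)) ∞
      (fun p : ℝ × TangentBundle (𝓡 d) W =>
        (⟨(Φ p.1).base p.2.1, (Φ p.1).form p.2.1 p.2.2⟩ : TotalSpace F E)))
    (t : ℝ) {x₀ : W} {y : EuclideanSpace ℝ (Fin d)}
    (hy : y ∈ (extChartAt (𝓡 d) x₀).target) (u : EuclideanSpace ℝ (Fin d)) :
    ContMDiffAt 𝓘(ℝ, ℝ × EuclideanSpace ℝ (Fin d)) ((𝓡 m).prod 𝓘(ℝ, F)) ∞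
      (fun q : ℝ × EuclideanSpace ℝ (Fin d) =>
        (⟨(Φ q.1).base ((extChartAt (𝓡 d) x₀).symm q.2),
          (Φ q.1).form _ (coordVec x₀ q.2 u)⟩ : TotalSpace F E)) (t, y) := by
  have h1 : ContMDiffAt 𝓘(ℝ, ℝ × EuclideanSpace ℝ (Fin d)) (𝓡 d).tangent ∞
      (fun q : ℝ × EuclideanSpace ℝ (Fin d) =>
        (⟨(extChartAt (𝓡 d) x₀).symm q.2, coordVec x₀ q.2 u⟩ : TangentBundle (𝓡 d) W)) (t, y) :=
    ContMDiffAt.comp (g := fun q : EuclideanSpace ℝ (Fin d) × EuclideanSpace ℝ (Fin d) =>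
      (⟨(extChartAt (𝓡 d) x₀).symm q.1, coordVec x₀ q.1 q.2⟩ : TangentBundle (𝓡 d) W))
      (f := fun q : ℝ × EuclideanSpace ℝ (Fin d) => (q.2, u)) (t, y)
      (contMDiffAt_coordVec hy u) (contDiff_snd.prodMk contDiff_const).contMDiff.contMDiffAt
  have h2 : ContMDiffAt 𝓘(ℝ, ℝ × EuclideanSpace ℝ (Fin d)) 𝓘(ℝ, ℝ) ∞
      (fun q : ℝ × EuclideanSpace ℝ (Fin d) => q.1) (t, y) := contDiff_fst.contMDiff.contMDiffAt
  exact hfield.contMDiffAt.comp (t, y) (h2.prodMk h1)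

lemma contMDiffAt_family_param
    (hparam : ContMDiff (𝓘(ℝ, ℝ).prod (𝓡 d)) ((𝓡 m).prod 𝓘(ℝ, F)) ∞
      (fun p : ℝ × W => (⟨(Φ p.1).base p.2, ε p.1 p.2⟩ : TotalSpace F E)))
    (t : ℝ) {x₀ : W} {y : EuclideanSpace ℝ (Fin d)}
    (hy : y ∈ (extChartAt (𝓡 d) x₀).target) :
    ContMDiffAt 𝓘(ℝ, ℝ × EuclideanSpace ℝ (Fin d)) ((𝓡 m).prod 𝓘(ℝ, F)) ∞
      (fun q : ℝ × EuclideanSpace ℝ (Fin d) =>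
        (⟨(Φ q.1).base ((extChartAt (𝓡 d) x₀).symm q.2),
          ε q.1 ((extChartAt (𝓡 d) x₀).symm q.2)⟩ : TotalSpace F E)) (t, y) := by
  have h1 : ContMDiffAt 𝓘(ℝ, ℝ × EuclideanSpace ℝ (Fin d)) (𝓡 d) ∞
      (fun q : ℝ × EuclideanSpace ℝ (Fin d) => (extChartAt (𝓡 d) x₀).symm q.2) (t, y) :=
    ContMDiffAt.comp (g := (extChartAt (𝓡 d) x₀).symm) (t, y)
      (contMDiffAt_chart_symm hy) contDiff_snd.contMDiff.contMDiffAt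
  have h2 : ContMDiffAt 𝓘(ℝ, ℝ × EuclideanSpace ℝ (Fin d)) 𝓘(ℝ, ℝ) ∞
      (fun q : ℝ × EuclideanSpace ℝ (Fin d) => q.1) (t, y) := contDiff_fst.contMDiff.contMDiffAt
  exact hparam.contMDiffAt.comp (t, y) (h2.prodMk h1)

lemma contDiffAt_family_chartForm
    (hfield : ContMDiff (𝓘(ℝ, ℝ).prod (𝓡 d).tangent) ((𝓡 m).prod 𝓘(ℝ, F)) ∞
      (fun p : ℝ × TangentBundle (𝓡 d) W =>
        (⟨(Φ p.1).base p.2.1, (Φ p.1).form p.2.1 p.2.2⟩ : TotalSpace F E)))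
    (S : SymTensor m M F E) (t : ℝ) {x₀ : W}
    {y : EuclideanSpace ℝ (Fin d)} (hy : y ∈ (extChartAt (𝓡 d) x₀).target)
    (u w : EuclideanSpace ℝ (Fin d)) :
    ContDiffAt ℝ ∞ (fun q : ℝ × EuclideanSpace ℝ (Fin d) =>
      chartForm ((Φ q.1).metric S) x₀ q.2 u w) (t, y) :=
  (S.contMDiffAt_form (contMDiffAt_family_form hfield t hy u)
    (contMDiffAt_family_form hfield t hy w)).contDiffAt

/-- The induced vector field depends smoothly on parameters. -/
lemma contDiffAt_family_inducedField
    (hfield : ContMDiff (𝓘(ℝ, ℝ).prod (𝓡 d).tangent) ((𝓡 m).prod 𝓘(ℝ, F)) ∞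
      (fun p : ℝ × TangentBundle (𝓡 d) W =>
        (⟨(Φ p.1).base p.2.1, (Φ p.1).form p.2.1 p.2.2⟩ : TotalSpace F E)))
    (hparam : ContMDiff (𝓘(ℝ, ℝ).prod (𝓡 d)) ((𝓡 m).prod 𝓘(ℝ, F)) ∞
      (fun p : ℝ × W => (⟨(Φ p.1).base p.2, ε p.1 p.2⟩ : TotalSpace F E)))
    (S : SymTensor m M F E) {t : ℝ}
    (hnd : NonDegenerate ((Φ t).metric S)) {x₀ : W}
    {y : EuclideanSpace ℝ (Fin d)} (hy : y ∈ (extChartAt (𝓡 d) x₀).target) :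
    ContDiffAt ℝ ∞ (fun q : ℝ × EuclideanSpace ℝ (Fin d) =>
      chartField ((Φ q.1).inducedField S (ε q.1)) x₀ q.2) (t, y) := by
  let κ := extChartAt (𝓡 d) x₀
  let T : EuclideanSpace ℝ (Fin d) → EuclideanSpace ℝ (Fin d) →L[ℝ] EuclideanSpace ℝ (Fin d) :=
    fun z => mfderiv 𝓘(ℝ, EuclideanSpace ℝ (Fin d)) (𝓡 d) κ.symm z
  let B : ℝ × EuclideanSpace ℝ (Fin d) →
      EuclideanSpace ℝ (Fin d) →L[ℝ] EuclideanSpace ℝ (Fin d) →L[ℝ] ℝ := fun q =>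
    bilinOfMatrix fun i j => chartForm ((Φ q.1).metric S) x₀ q.2
      (EuclideanSpace.single i 1) (EuclideanSpace.single j 1)
  have hB : ∀ q u w, B q u w = chartForm ((Φ q.1).metric S) x₀ q.2 u w := by
    intro q u w
    obtain ⟨B', hB'⟩ := (Φ q.1).exists_bilinear_eq_chartForm S x₀ q.2
    simp only [B, hB']
    exact bilinOfMatrix_apply B' u w
  let l : ℝ × EuclideanSpace ℝ (Fin d) → EuclideanSpace ℝ (Fin d) →L[ℝ] ℝ := fun q =>
    linOfVector fun j => S.form ((Φ q.1).base (κ.symm q.2)) (ε q.1 (κ.symm q.2))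
      ((Φ q.1).form _ (coordVec x₀ q.2 (EuclideanSpace.single j 1)))
  have hl : ∀ q w, l q w = S.form ((Φ q.1).base (κ.symm q.2)) (ε q.1 (κ.symm q.2))
      ((Φ q.1).form _ (coordVec x₀ q.2 w)) := fun q w =>
    linOfVector_apply (S.form ((Φ q.1).base (κ.symm q.2)) (ε q.1 (κ.symm q.2)) ∘ₗ
      (Φ q.1).form (κ.symm q.2) ∘ₗ (T q.2).toLinearMap) w
  have hBs : ContMDiffAt 𝓘(ℝ, ℝ × EuclideanSpace ℝ (Fin d))
      𝓘(ℝ, EuclideanSpace ℝ (Fin d) →L[ℝ] EuclideanSpace ℝ (Fin d) →L[ℝ] ℝ) ∞ B (t, y) :=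
    contMDiffAt_bilinOfMatrix fun i j => (contDiffAt_family_chartForm hfield S t hy _ _).contMDiffAt
  have hls : ContMDiffAt 𝓘(ℝ, ℝ × EuclideanSpace ℝ (Fin d))
      𝓘(ℝ, EuclideanSpace ℝ (Fin d) →L[ℝ] ℝ) ∞ l (t, y) :=
    contMDiffAt_linOfVector fun j => S.contMDiffAt_form (contMDiffAt_family_param hparam t hy)
      (contMDiffAt_family_form hfield t hy _)
  -- passing between nondegeneracy on the tangent space and in coordinates
  have hcoord : ∀ z ∈ κ.target, ∀ v : TangentSpace (𝓡 d) (κ.symm z),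
      ∃ u, coordVec x₀ z u = v := fun z hz v => ⟨_, coordVec_mfderiv_chart hz v⟩
  have hBnd : ∀ u, (∀ w, B (t, y) u w = 0) → u = 0 := by
    intro u hu
    have h1 : coordVec x₀ y u = 0 := by
      refine hnd _ _ fun w => ?_
      obtain ⟨w, rfl⟩ := hcoord y hy w
      rw [← hu w, hB]
      rfl
    have h2 := mfderiv_chart_coordVec hy u
    rw [h1, map_zero] at h2
    exact h2.symm
  refine ((contMDiffAt_inverse_apply hBs hls hBnd).contDiffAt).congr_of_eventuallyEq ?_
  have hopen : IsOpen (Prod.snd ⁻¹' κ.target : Set (ℝ × EuclideanSpace ℝ (Fin d))) :=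
    (isOpen_extChartAt_target x₀).preimage continuous_snd
  filter_upwards [eventually_nondegenerate hBs.continuousAt hBnd, hopen.mem_nhds hy] with q hq hqt
  have h3 : ∀ v : TangentSpace (𝓡 d) (κ.symm q.2),
      (∀ w, (Φ q.1).metric S _ v w = 0) → v = 0 := by
    intro v hv
    obtain ⟨u, rfl⟩ := hcoord q.2 hqt v
    rw [hq u fun w => by rw [hB]; exact hv _]
    exact map_zero (T q.2)
  refine sub_eq_zero.1 (hq _ fun w => ?_)
  have h4 := congrArg (fun f : EuclideanSpace ℝ (Fin d) →L[ℝ] ℝ => f w)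
    (apply_inverse_of_nondegenerate hq (l q))
  rw [map_sub, sub_apply]
  refine sub_eq_zero.2 (Eq.trans ?_ h4.symm)
  rw [hB, hl]
  unfold chartForm
  rw [coordVec_chartField _ hqt]
  exact (Φ q.1).metric_inducedField S (ε q.1) h3 _

end Family

/-- A vector field is smooth if its coordinate expressions are. -/
lemma contMDiff_of_chartField {v : ∀ x : W, TangentSpace (𝓡 d) x}
    (hv : ∀ x, ContDiffAt ℝ ∞ (chartField v x) (extChartAt (𝓡 d) x x)) :
    ContMDiff (𝓡 d) (𝓡 d).tangent ∞ (fun x => (⟨x, v x⟩ : TangentBundle (𝓡 d) W)) := by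
  intro x
  rw [contMDiffAt_tangent_iff (x₀ := x) (mem_extChartAt_source x)]
  refine ⟨contMDiffAt_id, ?_⟩
  refine ((hv x).contMDiffAt.comp x (contMDiffAt_chart (mem_extChartAt_source x))).congr_of_eventuallyEq ?_
  filter_upwards [extChartAt_source_mem_nhds (I := 𝓡 d) x] with z hz
  simp only [Function.comp_apply]
  unfold chartField
  rw [(extChartAt (𝓡 d) x).left_inv hz]

theorem gaugeActsByDiffeosInfinitesimally (L : LieAlgebroid m M F E) (S : SymTensor m M F E)
    (hrank : ∀ x : M, finrank ℝ (LinearMap.range (S.form x)) = d)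
    (hinv : L.KernelInvariant S) : GaugeActsByDiffeosInfinitesimally.{u} d L S := by
  intro W _ _ _ _ _ φ hφ hnd ε
  have hv : ∀ x, ContDiffAt ℝ ∞ (chartField (φ.inducedField S ε.val) x) (extChartAt (𝓡 d) x x) := by
    intro x
    have h := contDiffAt_family_inducedField (Φ := fun _ => φ) (ε := fun _ => ε.val)
      (φ.smooth.comp contMDiff_snd) (ε.smooth.comp contMDiff_snd) S (t := 0) hnd
      (mem_extChartAt_target (I := 𝓡 d) x)
    exact h.comp (extChartAt (𝓡 d) x x) (contDiffAt_const.prodMk contDiffAt_id)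
  refine ⟨φ.inducedField S ε.val, contMDiff_of_chartField hv, fun b x hb u w => ?_⟩
  exact φ.metricVar_eq_lieDerivMetric L S hrank hinv hφ hnd ε.val b hb
    (fun i => (b.contMDiffAt_comp i ε.smooth.contMDiffAt hb).mdifferentiableAt (by simp))
    ((hv x).differentiableAt (by simp)) u w

theorem kernelGaugeActsTrivially (L : LieAlgebroid m M F E) (S : SymTensor m M F E)
    (hrank : ∀ x : M, finrank ℝ (LinearMap.range (S.form x)) = d)
    (hinv : L.KernelInvariant S) : KernelGaugeActsTrivially.{u} d L S := by
  intro W _ _ _ _ _ φ hφ ε hε b x hb u w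
  exact φ.metricVar_eq_zero_of_kernel L S hrank hinv (hφ.1 x) ε.val hε b hb
    (fun i => (b.contMDiffAt_comp i ε.smooth.contMDiffAt hb).mdifferentiableAt (by simp)) u w

end Induced


/-! ### Flow lines of time-dependent vector fields -/

section FlowLine

variable {d : ℕ} {W : Type*} [TopologicalSpace W] [ChartedSpace (EuclideanSpace ℝ (Fin d)) W]

/-- The time-dependent vector field `v` is jointly smooth in time and space. -/
def IsSmoothField (v : ℝ → ∀ x : W, TangentSpace (𝓡 d) x) : Prop :=
  ∀ (x₀ : W) (t : ℝ), ∀ y ∈ (extChartAt (𝓡 d) x₀).target,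
    ContDiffAt ℝ ∞ (fun q : ℝ × EuclideanSpace ℝ (Fin d) => chartField (v q.1) x₀ q.2) (t, y)

/-- `c` is, on the time interval `(a, b)`, a flow line of the time-dependent vector field `v`. -/
def IsFlowLine (v : ℝ → ∀ x : W, TangentSpace (𝓡 d) x) (c : ℝ → W) (a b : ℝ) : Prop :=
  ∀ r ∈ Ioo a b, HasMFDerivAt 𝓘(ℝ, ℝ) (𝓡 d) c r ((1 : ℝ →L[ℝ] ℝ).smulRight (v r (c r)))

/-- The flow of `v` takes the point `x` at time `t` to the point `y` at time `s`. -/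
def Reach (v : ℝ → ∀ x : W, TangentSpace (𝓡 d) x) (t : ℝ) (x : W) (s : ℝ) (y : W) : Prop :=
  ∃ a b : ℝ, t ∈ Ioo a b ∧ s ∈ Ioo a b ∧ ∃ c : ℝ → W, IsFlowLine v c a b ∧ c t = x ∧ c s = y

variable [IsManifold (𝓡 d) ∞ W] {v : ℝ → ∀ x : W, TangentSpace (𝓡 d) x}

lemma chartField_chart (v : ∀ x : W, TangentSpace (𝓡 d) x) {x₀ p : W}
    (hp : p ∈ (extChartAt (𝓡 d) x₀).source) :
    chartField v x₀ (extChartAt (𝓡 d) x₀ p)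
      = mfderiv (𝓡 d) 𝓘(ℝ, EuclideanSpace ℝ (Fin d)) (extChartAt (𝓡 d) x₀) p (v p) := by
  unfold chartField
  rw [(extChartAt (𝓡 d) x₀).left_inv hp]

lemma IsFlowLine.continuousAt {c : ℝ → W} {a b r : ℝ} (hc : IsFlowLine v c a b)
    (hr : r ∈ Ioo a b) : ContinuousAt c r := (hc r hr).continuousAt

lemma IsFlowLine.hasDerivAt_chart {c : ℝ → W} {a b r : ℝ} (hc : IsFlowLine v c a b)
    (hr : r ∈ Ioo a b) {x₀ : W} (hx : c r ∈ (extChartAt (𝓡 d) x₀).source) :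
    HasDerivAt (fun s => extChartAt (𝓡 d) x₀ (c s))
      (chartField (v r) x₀ (extChartAt (𝓡 d) x₀ (c r))) r := by
  have h := (((contMDiffAt_chart hx).mdifferentiableAt (by simp)).hasMFDerivAt).comp r (hc r hr)
  have key : ∀ (L : ℝ →L[ℝ] EuclideanSpace ℝ (Fin d)) (X : EuclideanSpace ℝ (Fin d)),
      HasFDerivAt (fun s => extChartAt (𝓡 d) x₀ (c s)) L r → L 1 = X →
      HasDerivAt (fun s => extChartAt (𝓡 d) x₀ (c s)) X r := fun L X h e => e ▸ h.hasDerivAt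
  refine key _ _ h.hasFDerivAt ?_
  rw [chartField_chart (v r) hx]
  refine congrArg (mfderiv (𝓡 d) 𝓘(ℝ, EuclideanSpace ℝ (Fin d)) (extChartAt (𝓡 d) x₀) (c r)) ?_
  exact one_smul ℝ (v r (c r))

lemma hasMFDerivAt_chart_symm_comp {f : ℝ → EuclideanSpace ℝ (Fin d)} {r : ℝ} {x₀ : W}
    (hy : f r ∈ (extChartAt (𝓡 d) x₀).target) (hf : HasDerivAt f (chartField (v r) x₀ (f r)) r) :
    HasMFDerivAt 𝓘(ℝ, ℝ) (𝓡 d) (fun s => (extChartAt (𝓡 d) x₀).symm (f s)) r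
      ((1 : ℝ →L[ℝ] ℝ).smulRight (v r ((extChartAt (𝓡 d) x₀).symm (f r)))) := by
  have h := (((contMDiffAt_chart_symm hy).mdifferentiableAt (by simp)).hasMFDerivAt).comp r
    hf.hasFDerivAt.hasMFDerivAt
  refine HasMFDerivAt.congr_mfderiv h ?_
  ext1
  have := coordVec_mfderiv_chart hy (v r ((extChartAt (𝓡 d) x₀).symm (f r)))
  exact ((one_smul ℝ (v r ((extChartAt (𝓡 d) x₀).symm (f r)))).trans (this.symm.trans
    (congrArg (coordVec x₀ (f r)) (one_smul ℝ (chartField (v r) x₀ (f r))).symm))).symm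

lemma IsFlowLine.eventuallyEq (hv : IsSmoothField v) {c₁ c₂ : ℝ → W} {a b a' b' r : ℝ}
    (h₁ : IsFlowLine v c₁ a b) (h₂ : IsFlowLine v c₂ a' b') (hr : r ∈ Ioo a b)
    (hr' : r ∈ Ioo a' b') (heq : c₁ r = c₂ r) : c₁ =ᶠ[𝓝 r] c₂ := by
  set x₀ := c₁ r with hx₀
  have ht := mem_extChartAt_target (I := 𝓡 d) x₀
  obtain ⟨K, N, hN, hK⟩ := ((hv x₀ r _ ht).of_le (m := 1) (by simp)).exists_lipschitzOnWith
  have key : ∀ {c : ℝ → W} {a b : ℝ}, IsFlowLine v c a b → r ∈ Ioo a b → c r = x₀ →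
      ∀ᶠ s in 𝓝 r, c s ∈ (extChartAt (𝓡 d) x₀).source ∧
        HasDerivAt (fun s => extChartAt (𝓡 d) x₀ (c s))
          (chartField (v s) x₀ (extChartAt (𝓡 d) x₀ (c s))) s ∧
        extChartAt (𝓡 d) x₀ (c s) ∈ {y | (s, y) ∈ N} := by
    intro c a b hc hr hcr
    have hs : c r ∈ (extChartAt (𝓡 d) x₀).source := by
      rw [hcr]; exact mem_extChartAt_source (I := 𝓡 d) x₀
    have hd := hc.hasDerivAt_chart hr hs
    filter_upwards [(hc.continuousAt hr).preimage_mem_nhds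
        ((isOpen_extChartAt_source (I := 𝓡 d) x₀).mem_nhds hs), isOpen_Ioo.mem_nhds hr,
      (continuousAt_id.prodMk hd.continuousAt).preimage_mem_nhds (by simpa only [id, hcr] using hN)]
      with s h1 h2 h3
    exact ⟨h1, hc.hasDerivAt_chart h2 h1, h3⟩
  have k1 := key h₁ hr rfl
  have k2 := key h₂ hr' heq.symm
  have hE := ODE_solution_unique_of_eventually (K := K)
    (v := fun s y => chartField (v s) x₀ y) (s := fun s => {y | (s, y) ∈ N})
    (Eventually.of_forall fun s => by
      intro y hy y' hy'
      refine (hK hy hy').trans (le_of_eq ?_)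
      simp [Prod.edist_eq])
    (k1.mono fun s h => h.2) (k2.mono fun s h => h.2)
    (congrArg (extChartAt (𝓡 d) x₀) heq)
  filter_upwards [hE, k1, k2] with s h h1 h2
  exact (extChartAt (𝓡 d) x₀).injOn h1.1 h2.1 h

variable [T2Space W]

lemma IsFlowLine.eqOn (hv : IsSmoothField v) {c₁ c₂ : ℝ → W} {a b r : ℝ}
    (h₁ : IsFlowLine v c₁ a b) (h₂ : IsFlowLine v c₂ a b) (hr : r ∈ Ioo a b)
    (heq : c₁ r = c₂ r) : EqOn c₁ c₂ (Ioo a b) := by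
  have h := isPreconnected_Ioo.subset_of_closure_inter_subset (s := Ioo a b)
    (u := {r | c₁ =ᶠ[𝓝 r] c₂}) isOpen_setOfPred_eventually_nhds
    ⟨r, hr, h₁.eventuallyEq hv h₂ hr hr heq⟩ ?_
  · exact fun s hs => (h hs).self_of_nhds
  · rintro s ⟨hs, hs'⟩
    refine h₁.eventuallyEq hv h₂ hs' hs' ?_
    by_contra hne
    have hev : ∀ᶠ s' in 𝓝 s, c₁ s' ≠ c₂ s' :=
      ((h₁.continuousAt hs').prodMk (h₂.continuousAt hs')).preimage_mem_nhds
        (isClosed_diagonal.isOpen_compl.mem_nhds hne)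
    obtain ⟨s', h1, h2⟩ := (mem_closure_iff_frequently.1 hs).and_eventually hev |>.exists
    exact h2 h1.self_of_nhds

lemma IsFlowLine.mono {c : ℝ → W} {a b a' b' : ℝ} (h : IsFlowLine v c a b) (ha : a ≤ a')
    (hb : b' ≤ b) : IsFlowLine v c a' b' := fun r hr => h r (Ioo_subset_Ioo ha hb hr)

lemma Reach.unique (hv : IsSmoothField v) {t s : ℝ} {x y y' : W} (h : Reach v t x s y)
    (h' : Reach v t x s y') : y = y' := by
  obtain ⟨a, b, ht, hs, c, hc, hct, hcs⟩ := h
  obtain ⟨a', b', ht', hs', c', hc', hct', hcs'⟩ := h'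
  rw [← hcs, ← hcs']
  exact (hc.mono (le_max_left a a') (min_le_left b b')).eqOn hv
    (hc'.mono (le_max_right a a') (min_le_right b b'))
    ⟨max_lt ht.1 ht'.1, lt_min ht.2 ht'.2⟩ (hct.trans hct'.symm)
    ⟨max_lt hs.1 hs'.1, lt_min hs.2 hs'.2⟩

lemma Reach.symm {t s : ℝ} {x y : W} (h : Reach v t x s y) : Reach v s y t x := by
  obtain ⟨a, b, ht, hs, c, hc, hct, hcs⟩ := h
  exact ⟨a, b, hs, ht, c, hc, hcs, hct⟩

lemma IsFlowLine.reach {c : ℝ → W} {a b t s : ℝ} (h : IsFlowLine v c a b) (ht : t ∈ Ioo a b)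
    (hs : s ∈ Ioo a b) : Reach v t (c t) s (c s) := ⟨a, b, ht, hs, c, h, rfl, rfl⟩

lemma Reach.trans (hv : IsSmoothField v) {t s r : ℝ} {x y z : W} (h : Reach v t x s y)
    (h' : Reach v s y r z) : Reach v t x r z := by
  classical
  obtain ⟨a, b, ht, hs, c, hc, rfl, rfl⟩ := h
  obtain ⟨a', b', hs', hr, c', hc', hcs', rfl⟩ := h'
  have hE := (hc.mono (le_max_left a a') (min_le_left b b')).eqOn hv
    (hc'.mono (le_max_right a a') (min_le_right b b'))
    ⟨max_lt hs.1 hs'.1, lt_min hs.2 hs'.2⟩ hcs'.symm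
  let C : ℝ → W := fun q => if q ∈ Ioo a b then c q else c' q
  have hC : ∀ q ∈ Ioo a b, C q = c q := fun q hq => if_pos hq
  have hC' : ∀ q ∈ Ioo a' b', C q = c' q := by
    intro q hq
    by_cases h : q ∈ Ioo a b
    · rw [hC q h]
      exact hE ⟨max_lt h.1 hq.1, lt_min h.2 hq.2⟩
    · exact if_neg h
  refine ⟨min a a', max b b', ⟨min_lt_of_left_lt ht.1, lt_max_of_lt_left ht.2⟩,
    ⟨min_lt_of_right_lt hr.1, lt_max_of_lt_right hr.2⟩, C, ?_, hC t ht, hC' r hr⟩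
  intro q hq
  have hq2 : q ∈ Ioo a b ∨ q ∈ Ioo a' b' := by
    simp only [mem_Ioo, min_lt_iff, lt_max_iff] at hq hs hs' ⊢
    grind
  rcases hq2 with h | h
  · rw [hC q h]
    exact (hc q h).congr_of_eventuallyEq (eventually_of_mem (isOpen_Ioo.mem_nhds h) hC)
  · rw [hC' q h]
    exact (hc' q h).congr_of_eventuallyEq (eventually_of_mem (isOpen_Ioo.mem_nhds h) hC')

/-- Near each point of space-time the flow exists for a uniform time and is smooth. -/
lemma exists_flow_box (hv : IsSmoothField v) (T : ℝ) (z : W) :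
    ∃ δ > 0, ∃ O : Set (EuclideanSpace ℝ (Fin d)), IsOpen O ∧ extChartAt (𝓡 d) z z ∈ O ∧
      O ⊆ (extChartAt (𝓡 d) z).target ∧
      ∃ Ψ : ℝ → ℝ → EuclideanSpace ℝ (Fin d) → W, ∀ t ∈ Ioo (T - δ) (T + δ),
        ContMDiffOn 𝓘(ℝ, ℝ × EuclideanSpace ℝ (Fin d)) (𝓡 d) ∞
          (fun q : ℝ × EuclideanSpace ℝ (Fin d) => Ψ t q.1 q.2) (Ioo (T - δ) (T + δ) ×ˢ O) ∧
        ∀ y ∈ O, Ψ t t y = (extChartAt (𝓡 d) z).symm y ∧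
          IsFlowLine v (fun s => Ψ t s y) (T - δ) (T + δ) := by
  set y₀ := extChartAt (𝓡 d) z z with hy₀
  have htar := isOpen_extChartAt_target (I := 𝓡 d) z
  -- The suspended field on space-time, whose time component is `1`.
  let f : ℝ × EuclideanSpace ℝ (Fin d) → ℝ × EuclideanSpace ℝ (Fin d) :=
    fun q => (1, chartField (v q.1) z q.2)
  have hf : ContDiffOn ℝ ∞ f (univ ×ˢ (extChartAt (𝓡 d) z).target) := fun q hq =>
    (contDiffAt_const.prodMk (hv z q.1 q.2 hq.2)).contDiffWithinAt
  obtain ⟨δ, hδ, φ, hφ, hφ'⟩ := exists_smooth_local_flow_on (isOpen_univ.prod htar) hf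
    (x₀ := (T, y₀)) ⟨mem_univ _, mem_extChartAt_target z⟩
  have hball : ∀ t ∈ Ioo (T - δ / 2) (T + δ / 2), ∀ y ∈ Metric.ball y₀ δ,
      (t, y) ∈ Metric.ball (T, y₀) δ := by
    intro t ht y hy
    rw [Metric.mem_ball, Prod.dist_eq, Real.dist_eq]
    refine max_lt (abs_lt.2 ⟨?_, ?_⟩) hy <;> simp only [mem_Ioo] at ht ⊢ <;> linarith
  have htime : ∀ q ∈ Metric.ball (T, y₀) δ, ∀ s ∈ Ioo (-δ) δ, (φ s q).1 = q.1 + s := by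
    intro q hq s hs
    have h1 : ∀ s ∈ Ioo (-δ) δ, HasDerivAt (fun s => (φ s q).1 - s) 0 s := fun s hs => by
      have := (hasFDerivAt_fst.comp_hasDerivAt s ((hφ' q hq).2 s hs).2).sub (hasDerivAt_id s)
      exact this.congr_deriv (by simp [f])
    have h2 := isOpen_Ioo.is_const_of_deriv_eq_zero (isPreconnected_Ioo)
      (fun s hs => (h1 s hs).differentiableAt.differentiableWithinAt)
      (fun s hs => (h1 s hs).deriv) hs (y := 0) ⟨by linarith, hδ⟩
    simp only [(hφ' q hq).1] at h2
    linarith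
  have hsub : ∀ t ∈ Ioo (T - δ / 2) (T + δ / 2), ∀ s ∈ Ioo (T - δ / 2) (T + δ / 2),
      s - t ∈ Ioo (-δ) δ := by
    intro t ht s hs
    simp only [mem_Ioo] at ht hs ⊢
    constructor <;> linarith
  refine ⟨δ / 2, by positivity, Metric.ball y₀ δ ∩ (extChartAt (𝓡 d) z).target,
    Metric.isOpen_ball.inter htar, ⟨Metric.mem_ball_self hδ, mem_extChartAt_target z⟩,
    inter_subset_right,
    fun t s y => (extChartAt (𝓡 d) z).symm (φ (s - t) (t, y)).2, fun t ht => ⟨?_, ?_⟩⟩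
  · rintro ⟨s, y⟩ ⟨hs, hy⟩
    have hst := hsub t ht s hs
    have hb := hball t ht y hy.1
    have h1 := hφ.contDiffAt (x := (s - t, (t, y)))
      ((isOpen_Ioo.prod Metric.isOpen_ball).mem_nhds ⟨hst, hb⟩)
    have h2 : ContDiffAt ℝ ∞ (fun q : ℝ × EuclideanSpace ℝ (Fin d) =>
        (φ (q.1 - t) (t, q.2)).2) (s, y) :=
      contDiffAt_snd.comp (s, y) (h1.comp (s, y)
        ((contDiffAt_fst.sub contDiffAt_const).prodMk (contDiffAt_const.prodMk contDiffAt_snd)))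
    exact (ContMDiffAt.comp (s, y) (g := (extChartAt (𝓡 d) z).symm)
      (contMDiffAt_chart_symm ((hφ' _ hb).2 _ hst).1.2) h2.contMDiffAt).contMDiffWithinAt
  · intro y hy
    have hb := hball t ht y hy.1
    refine ⟨by simp [(hφ' _ hb).1], fun s hs => ?_⟩
    have hst := hsub t ht s hs
    have h1 := ((hφ' _ hb).2 _ hst)
    refine hasMFDerivAt_chart_symm_comp (v := v) (f := fun s => (φ (s - t) (t, y)).2) h1.1.2 ?_
    have h2 := (hasFDerivAt_snd.comp_hasDerivAt (s - t) h1.2).scomp s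
      ((hasDerivAt_id s).sub_const t)
    refine h2.congr_deriv ?_
    have h3 := htime _ hb _ hst
    simp only [ContinuousLinearMap.coe_snd', f, one_smul, h3]
    congr 2
    ring

end FlowLine


/-! ### Metrics transported by a flow -/

section MetricFlow

variable {d : ℕ} {W : Type*} [TopologicalSpace W] [ChartedSpace (EuclideanSpace ℝ (Fin d)) W]

variable (d W) in
/-- A field of bilinear forms on the tangent spaces of `W`, with bilinearity bundled. -/
abbrev FormField := ∀ x : W, TangentSpace (𝓡 d) x →ₗ[ℝ] TangentSpace (𝓡 d) x →ₗ[ℝ] ℝ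

/-- The underlying field of functions of two tangent vectors. -/
abbrev FormField.toFun (g : FormField d W) : BilinField d W := fun x u w => g x u w

/-- The coordinate expression of `g` in the chart at `x₀`, as a continuous bilinear form. -/
def FormField.chart (g : FormField d W) (x₀ : W) (y : EuclideanSpace ℝ (Fin d)) :
    EuclideanSpace ℝ (Fin d) →L[ℝ] EuclideanSpace ℝ (Fin d) →L[ℝ] ℝ :=
  bilinOfMatrix fun i j =>
    chartForm g.toFun x₀ y (EuclideanSpace.single i 1) (EuclideanSpace.single j 1)

/-- The metrics `g t` are smooth and satisfy `d/dt g = - L_v g`: they are transported by the flow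
of the time-dependent vector field `v`. -/
structure IsMetricFlow (g : ℝ → FormField d W) (v : ℝ → ∀ x : W, TangentSpace (𝓡 d) x) :
    Prop where
  smooth_field : IsSmoothField v
  smooth : ∀ (x₀ : W) (u w : EuclideanSpace ℝ (Fin d)) (t : ℝ),
    ∀ y ∈ (extChartAt (𝓡 d) x₀).target,
      ContDiffAt ℝ ∞ (fun q : ℝ × EuclideanSpace ℝ (Fin d) =>
        chartForm (g q.1).toFun x₀ q.2 u w) (t, y)
  symm : ∀ t x u w, g t x u w = g t x w u
  nondegenerate : ∀ t, NonDegenerate (g t).toFun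
  deriv : ∀ (t : ℝ) (x : W) (u w : EuclideanSpace ℝ (Fin d)),
    HasDerivAt (fun s => g s x u w) (-lieDerivMetric (v t) (g t).toFun x u w) t

lemma FormField.chart_apply (g : FormField d W) (x₀ : W) (y u w : EuclideanSpace ℝ (Fin d)) :
    g.chart x₀ y u w = chartForm g.toFun x₀ y u w :=
  bilinOfMatrix_apply ((g ((extChartAt (𝓡 d) x₀).symm y)).compl₁₂
    (mfderiv 𝓘(ℝ, EuclideanSpace ℝ (Fin d)) (𝓡 d) (extChartAt (𝓡 d) x₀).symm y).toLinearMap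
    (mfderiv 𝓘(ℝ, EuclideanSpace ℝ (Fin d)) (𝓡 d) (extChartAt (𝓡 d) x₀).symm y).toLinearMap) u w

lemma IsMetricFlow.contDiffAt_chart {g : ℝ → FormField d W}
    {v : ℝ → ∀ x : W, TangentSpace (𝓡 d) x} (hM : IsMetricFlow g v) (x₀ : W) (t : ℝ)
    {y : EuclideanSpace ℝ (Fin d)} (hy : y ∈ (extChartAt (𝓡 d) x₀).target) :
    ContDiffAt ℝ ∞ (fun q : ℝ × EuclideanSpace ℝ (Fin d) => (g q.1).chart x₀ q.2) (t, y) :=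
  (contMDiffAt_bilinOfMatrix fun _ _ => (hM.smooth x₀ _ _ t y hy).contMDiffAt).contDiffAt

variable [IsManifold (𝓡 d) ∞ W] {g : ℝ → FormField d W} {v : ℝ → ∀ x : W, TangentSpace (𝓡 d) x}

lemma chartForm_mfderiv_chart (g : BilinField d W) {x₀ p : W}
    (hp : p ∈ (extChartAt (𝓡 d) x₀).source) (u w : TangentSpace (𝓡 d) p) :
    chartForm g x₀ (extChartAt (𝓡 d) x₀ p)
      (mfderiv (𝓡 d) 𝓘(ℝ, EuclideanSpace ℝ (Fin d)) (extChartAt (𝓡 d) x₀) p u)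
      (mfderiv (𝓡 d) 𝓘(ℝ, EuclideanSpace ℝ (Fin d)) (extChartAt (𝓡 d) x₀) p w) = g p u w := by
  have hy := (extChartAt (𝓡 d) x₀).map_source hp
  have key : ∀ (q : W) (_ : (extChartAt (𝓡 d) x₀).symm (extChartAt (𝓡 d) x₀ p) = q)
      (u w : TangentSpace (𝓡 d) q),
      chartForm g x₀ (extChartAt (𝓡 d) x₀ p)
        (mfderiv (𝓡 d) 𝓘(ℝ, EuclideanSpace ℝ (Fin d)) (extChartAt (𝓡 d) x₀) q u)
        (mfderiv (𝓡 d) 𝓘(ℝ, EuclideanSpace ℝ (Fin d)) (extChartAt (𝓡 d) x₀) q w) = g q u w := by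
    rintro q rfl u w
    unfold chartForm
    rw [coordVec_mfderiv_chart hy u, coordVec_mfderiv_chart hy w]
  exact key p ((extChartAt (𝓡 d) x₀).left_inv hp) u w

lemma chartForm_self (g : BilinField d W) (x : W) (u w : EuclideanSpace ℝ (Fin d)) :
    chartForm g x (extChartAt (𝓡 d) x x) u w = g x u w :=
  (congrArg₂ (chartForm g x (extChartAt (𝓡 d) x x)) (mfderiv_chart_self x u).symm
    (mfderiv_chart_self x w).symm).trans
      (chartForm_mfderiv_chart g (mem_extChartAt_source x) u w)

/-- The metrics `g s` pulled back along the flow of `v` do not depend on time. -/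
lemma IsMetricFlow.hasDerivAt_pullback (hM : IsMetricFlow g v) {a b : ℝ}
    {O : Set (EuclideanSpace ℝ (Fin d))} (hO : IsOpen O) {Ψ : ℝ → EuclideanSpace ℝ (Fin d) → W}
    (hΨ : ContMDiffOn 𝓘(ℝ, ℝ × EuclideanSpace ℝ (Fin d)) (𝓡 d) ∞
      (fun q : ℝ × EuclideanSpace ℝ (Fin d) => Ψ q.1 q.2) (Ioo a b ×ˢ O))
    (hfl : ∀ y ∈ O, IsFlowLine v (fun s => Ψ s y) a b) {r : ℝ} (hr : r ∈ Ioo a b)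
    {y : EuclideanSpace ℝ (Fin d)} (hy : y ∈ O) (u w : EuclideanSpace ℝ (Fin d)) :
    HasDerivAt (fun s => g s (Ψ s y)
      (mfderiv 𝓘(ℝ, EuclideanSpace ℝ (Fin d)) (𝓡 d) (Ψ s) y u)
      (mfderiv 𝓘(ℝ, EuclideanSpace ℝ (Fin d)) (𝓡 d) (Ψ s) y w)) 0 r := by
  set p := Ψ r y with hp
  set κ := extChartAt (𝓡 d) p with hκ
  have hpt : κ p ∈ κ.target := mem_extChartAt_target (I := 𝓡 d) p
  let Ω : Set (ℝ × EuclideanSpace ℝ (Fin d)) :=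
    (Ioo a b ×ˢ O) ∩ (fun q => Ψ q.1 q.2) ⁻¹' κ.source
  have hΩ : IsOpen Ω := hΨ.continuousOn.isOpen_inter_preimage (isOpen_Ioo.prod hO)
    (isOpen_extChartAt_source p)
  have hΩr : (r, y) ∈ Ω := ⟨⟨hr, hy⟩, mem_extChartAt_source (I := 𝓡 d) p⟩
  have hΨat : ∀ q ∈ Ω, ContMDiffAt 𝓘(ℝ, ℝ × EuclideanSpace ℝ (Fin d)) (𝓡 d) ∞
      (fun q : ℝ × EuclideanSpace ℝ (Fin d) => Ψ q.1 q.2) q := fun q hq =>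
    hΨ.contMDiffAt ((isOpen_Ioo.prod hO).mem_nhds hq.1)
  let ψ : ℝ × EuclideanSpace ℝ (Fin d) → EuclideanSpace ℝ (Fin d) := fun q => κ (Ψ q.1 q.2)
  have hψ : ContDiffOn ℝ ∞ ψ Ω := fun q hq =>
    (ContMDiffAt.comp q (g := κ) (contMDiffAt_chart hq.2) (hΨat q hq)).contDiffAt.contDiffWithinAt
  have hψd : ∀ q ∈ Ω, HasDerivAt (fun s => ψ (s, q.2)) (chartField (v q.1) p (ψ q)) q.1 :=
    fun q hq => (hfl q.2 hq.1.2).hasDerivAt_chart hq.1.1 hq.2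
  -- The variational equation along the flow line.
  have hvar : ∀ e, HasDerivAt (fun s => fderiv ℝ (fun x => ψ (s, x)) y e)
      (fderiv ℝ (chartField (v r) p) (κ p) (fderiv ℝ (fun x => ψ (r, x)) y e)) r := by
    intro e
    have h1 := hasDerivAt_fderiv_param (g := fun q => chartField (v q.1) p (ψ q)) hΩ hψ hψd hΩr e
    refine h1.congr_deriv ?_
    have h2 : DifferentiableAt ℝ (chartField (v r) p) (κ p) :=
      ((hM.smooth_field p r _ hpt).comp (κ p) (contDiffAt_const.prodMk contDiffAt_id)
        ).differentiableAt (by simp)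
    have h3 : DifferentiableAt ℝ (fun x => ψ (r, x)) y :=
      ((hψ.contDiffAt (hΩ.mem_nhds hΩr)).comp y
        (contDiffAt_const.prodMk contDiffAt_id)).differentiableAt (by simp)
    have h4 : HasFDerivAt (fun x => chartField (v r) p (ψ (r, x))) _ y :=
      hasFDerivAt_comp_map (c := chartField (v r) p) (X := fun x => ψ (r, x))
        h2.hasFDerivAt h3.hasFDerivAt
    rw [h4.fderiv]
    rfl
  let B : ℝ × EuclideanSpace ℝ (Fin d) → _ := fun q => (g q.1).chart p q.2
  have hB : DifferentiableAt ℝ B (r, κ p) := (hM.contDiffAt_chart p r hpt).differentiableAt (by simp)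
  have hBc : HasDerivAt (fun s => B (s, ψ (s, y)))
      (fderiv ℝ B (r, κ p) (1, chartField (v r) p (κ p))) r :=
    hasDerivAt_comp_curve (c := B) (γ := fun s => (s, ψ (s, y))) hB.hasFDerivAt
      ((hasDerivAt_id r).prodMk (hψd _ hΩr))
  have hBuw : ∀ e e' : EuclideanSpace ℝ (Fin d),
      fderiv ℝ B (r, κ p) (1, chartField (v r) p (κ p)) e e'
        = -lieDerivMetric (v r) (g r).toFun p e e'
          + fderiv ℝ (fun z => chartForm (g r).toFun p z e e') (κ p) (chartField (v r) p (κ p)) := by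
    intro e e'
    have h1 : HasFDerivAt (fun q => B q e e') _ (r, κ p) :=
      (hB.hasFDerivAt.clm_apply (hasFDerivAt_const e _)).clm_apply (hasFDerivAt_const e' _)
    have h2 : HasDerivAt (fun s => B (s, κ p) e e') _ r :=
      hasDerivAt_comp_curve (c := fun q => B q e e') (γ := fun s => (s, κ p)) h1
        ((hasDerivAt_id r).prodMk (hasDerivAt_const r (κ p)))
    have h3 : HasFDerivAt (fun z => B (r, z) e e') _ (κ p) :=
      hasFDerivAt_comp_map (c := fun q => B q e e') (X := fun z => (r, z)) h1
        ((hasFDerivAt_const r (κ p)).prodMk (hasFDerivAt_id (κ p)))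
    have h4 : (fun s => B (s, κ p) e e') = fun s => g s p e e' := by
      funext s
      exact ((g s).chart_apply p (κ p) e e').trans (chartForm_self (g s).toFun p e e')
    have h5 : (fun z => B (r, z) e e') = fun z => chartForm (g r).toFun p z e e' := by
      funext z
      exact (g r).chart_apply p z e e'
    rw [h4] at h2
    rw [h5] at h3
    rw [h3.fderiv, ← h2.unique (hM.deriv r p e e')]
    simp only [add_apply, ContinuousLinearMap.flip_apply, ContinuousLinearMap.comp_apply,
      map_zero, zero_add, ContinuousLinearMap.prod_apply, zero_apply,
      ContinuousLinearMap.id_apply]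
    rw [← add_apply, ← add_apply, ← map_add]
    simp
  have hk := hasDerivAt_bilin hBc (hvar u) (hvar w)
  have hev : (fun s => g s (Ψ s y)
      (mfderiv 𝓘(ℝ, EuclideanSpace ℝ (Fin d)) (𝓡 d) (Ψ s) y u)
      (mfderiv 𝓘(ℝ, EuclideanSpace ℝ (Fin d)) (𝓡 d) (Ψ s) y w)) =ᶠ[𝓝 r]
      fun s => B (s, ψ (s, y)) (fderiv ℝ (fun x => ψ (s, x)) y u)
        (fderiv ℝ (fun x => ψ (s, x)) y w) := by
    have h1 : ∀ᶠ s in 𝓝 r, (s, y) ∈ Ω :=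
      (continuousAt_id.prodMk continuousAt_const).preimage_mem_nhds (hΩ.mem_nhds hΩr)
    filter_upwards [h1] with s hs
    have h2 : ∀ e, fderiv ℝ (fun x => ψ (s, x)) y e
        = mfderiv (𝓡 d) 𝓘(ℝ, EuclideanSpace ℝ (Fin d)) κ (Ψ s y)
          (mfderiv 𝓘(ℝ, EuclideanSpace ℝ (Fin d)) (𝓡 d) (Ψ s) y e) := by
      intro e
      have h3 : MDifferentiableAt 𝓘(ℝ, EuclideanSpace ℝ (Fin d)) (𝓡 d) (Ψ s) y :=
        (ContMDiffAt.comp (g := fun q : ℝ × EuclideanSpace ℝ (Fin d) => Ψ q.1 q.2) y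
          (hΨat _ hs) (contDiffAt_const.prodMk contDiffAt_id).contMDiffAt).mdifferentiableAt
          (by simp)
      have h4 := ((contMDiffAt_chart hs.2).mdifferentiableAt (by simp)).hasMFDerivAt.comp y
        h3.hasMFDerivAt
      have h5 := h4.mfderiv
      rw [mfderiv_eq_fderiv] at h5
      exact congrArg (fun A : EuclideanSpace ℝ (Fin d) →L[ℝ] EuclideanSpace ℝ (Fin d) => A e) h5
    rw [h2, h2]
    exact ((((g s).chart_apply p _ _ _).trans
      (chartForm_mfderiv_chart (g s).toFun hs.2 _ _))).symm
  refine (hk.congr_of_eventuallyEq hev).congr_deriv ?_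
  rw [hBuw]
  have h6 : ∀ e e', B (r, ψ (r, y)) e e' = chartForm (g r).toFun p (κ p) e e' := fun e e' =>
    (g r).chart_apply p (κ p) e e'
  rw [h6, h6]
  simp only [lieDerivMetric]
  ring

end MetricFlow


/-! ### The flow as a family of local isometries -/

section FlowMap

variable {d : ℕ} {W : Type*} [TopologicalSpace W] [ChartedSpace (EuclideanSpace ℝ (Fin d)) W]

/-- The points which the flow of `v` carries from time `t` to time `s`. -/
def flowDomain (v : ℝ → ∀ x : W, TangentSpace (𝓡 d) x) (t s : ℝ) : Set W :=
  {x | ∃ y, Reach v t x s y}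

open Classical in
/-- The flow of `v` from time `t` to time `s`; outside `flowDomain v t s` it is the identity. -/
def flowMap (v : ℝ → ∀ x : W, TangentSpace (𝓡 d) x) (t s : ℝ) (x : W) : W :=
  if h : ∃ y, Reach v t x s y then h.choose else x

/-- `ψ` is smooth at `x` and its differential at `x` pulls back the form `h` to `g`. -/
def IsIsometryAt (g h : FormField d W) (ψ : W → W) (x : W) : Prop :=
  ContMDiffAt (𝓡 d) (𝓡 d) ∞ ψ x ∧ ∀ u w : TangentSpace (𝓡 d) x,
    h (ψ x) (mfderiv (𝓡 d) (𝓡 d) ψ x u) (mfderiv (𝓡 d) (𝓡 d) ψ x w) = g x u w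

variable {v : ℝ → ∀ x : W, TangentSpace (𝓡 d) x} {g : ℝ → FormField d W}

lemma reach_flowMap {t s : ℝ} {x : W} (hx : x ∈ flowDomain v t s) :
    Reach v t x s (flowMap v t s x) := by
  have h : ∃ y, Reach v t x s y := hx
  rw [flowMap, dif_pos h]
  exact h.choose_spec

lemma IsIsometryAt.comp [IsManifold (𝓡 d) ∞ W] {g h k : FormField d W} {ψ χ : W → W} {x : W}
    (hψ : IsIsometryAt g h ψ x) (hχ : IsIsometryAt h k χ (ψ x)) :
    IsIsometryAt g k (fun z => χ (ψ z)) x := by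
  refine ⟨hχ.1.comp x hψ.1, fun u w => ?_⟩
  have h1 := (hχ.1.mdifferentiableAt (by simp)).hasMFDerivAt.comp x
    (hψ.1.mdifferentiableAt (by simp)).hasMFDerivAt
  have h2 : mfderiv (𝓡 d) (𝓡 d) (fun z => χ (ψ z)) x = _ := h1.mfderiv
  rw [h2]
  exact (hχ.2 _ _).trans (hψ.2 u w)

lemma IsIsometryAt.congr {g h : FormField d W} {ψ χ : W → W} {x : W}
    (hψ : IsIsometryAt g h ψ x) (he : χ =ᶠ[𝓝 x] ψ) : IsIsometryAt g h χ x := by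
  refine ⟨hψ.1.congr_of_eventuallyEq he, fun u w => ?_⟩
  have h1 := hψ.2 u w
  have h2 : mfderiv (𝓡 d) (𝓡 d) χ x = mfderiv (𝓡 d) (𝓡 d) ψ x := he.mfderiv_eq
  have key : ∀ (q : W) (_ : q = ψ x) (A A' : EuclideanSpace ℝ (Fin d) →L[ℝ] EuclideanSpace ℝ (Fin d)),
      A = A' → h q (A u) (A w) = h (ψ x) (A' u) (A' w) := by
    rintro q rfl A A' rfl
    rfl
  exact (key (χ x) he.self_of_nhds _ _ h2).trans h1

variable [IsManifold (𝓡 d) ∞ W] [T2Space W]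

lemma Reach.flowMap_eq (hv : IsSmoothField v) {t s : ℝ} {x y : W} (h : Reach v t x s y) :
    flowMap v t s x = y :=
  (reach_flowMap ⟨y, h⟩).unique hv h

lemma IsMetricFlow.exists_box (hM : IsMetricFlow g v) (T : ℝ) (z : W) :
    ∃ δ > 0, ∀ᶠ x in 𝓝 z, ∀ t ∈ Ioo (T - δ) (T + δ), ∀ s ∈ Ioo (T - δ) (T + δ),
      x ∈ flowDomain v t s ∧ IsIsometryAt (g t) (g s) (flowMap v t s) x := by
  obtain ⟨δ, hδ, O, hO, hzO, hOt, Ψ, hΨ⟩ := exists_flow_box hM.smooth_field T z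
  set κ := extChartAt (𝓡 d) z with hκ
  have hreach : ∀ t ∈ Ioo (T - δ) (T + δ), ∀ s ∈ Ioo (T - δ) (T + δ), ∀ x ∈ κ.source, κ x ∈ O →
      Reach v t x s (Ψ t s (κ x)) := by
    intro t ht s hs x hx hxO
    have h := ((hΨ t ht).2 (κ x) hxO).2.reach ht hs
    rwa [((hΨ t ht).2 (κ x) hxO).1, κ.left_inv hx] at h
  have hopen : IsOpen (κ.source ∩ κ ⁻¹' O) :=
    (continuousOn_extChartAt z).isOpen_inter_preimage (isOpen_extChartAt_source z) hO
  refine ⟨δ, hδ, ?_⟩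
  filter_upwards [hopen.mem_nhds ⟨mem_extChartAt_source z, hzO⟩] with x hx t ht s hs
  refine ⟨⟨_, hreach t ht s hs x hx.1 hx.2⟩, ?_⟩
  have hE : flowMap v t s =ᶠ[𝓝 x] fun x => Ψ t s (κ x) := by
    filter_upwards [hopen.mem_nhds hx] with x' hx'
    exact (hreach t ht s hs x' hx'.1 hx'.2).flowMap_eq hM.smooth_field
  refine IsIsometryAt.congr ?_ hE
  have hΨx : ∀ s ∈ Ioo (T - δ) (T + δ),
      ContMDiffAt 𝓘(ℝ, EuclideanSpace ℝ (Fin d)) (𝓡 d) ∞ (Ψ t s) (κ x) := fun s hs =>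
    ContMDiffAt.comp (g := fun q : ℝ × EuclideanSpace ℝ (Fin d) => Ψ t q.1 q.2)
      (f := fun y => (s, y)) (κ x) ((hΨ t ht).1.contMDiffAt ((isOpen_Ioo.prod hO).mem_nhds ⟨hs, hx.2⟩))
      (contDiffAt_const.prodMk contDiffAt_id).contMDiffAt
  refine ⟨(hΨx s hs).comp x (contMDiffAt_chart hx.1), fun u w => ?_⟩
  have hconst : ∀ a b : EuclideanSpace ℝ (Fin d), g s (Ψ t s (κ x))
        (mfderiv 𝓘(ℝ, EuclideanSpace ℝ (Fin d)) (𝓡 d) (Ψ t s) (κ x) a)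
        (mfderiv 𝓘(ℝ, EuclideanSpace ℝ (Fin d)) (𝓡 d) (Ψ t s) (κ x) b)
      = chartForm (g t).toFun z (κ x) a b := by
    intro a b
    have hd := fun r (hr : r ∈ Ioo (T - δ) (T + δ)) => hM.hasDerivAt_pullback hO (hΨ t ht).1
      (fun y hy => ((hΨ t ht).2 y hy).2) hr hx.2 a b
    have h1 := isOpen_Ioo.is_const_of_deriv_eq_zero isPreconnected_Ioo
      (fun r hr => (hd r hr).differentiableAt.differentiableWithinAt)
      (fun r hr => (hd r hr).deriv) hs ht
    refine h1.trans ?_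
    have hE' : Ψ t t =ᶠ[𝓝 (κ x)] κ.symm := by
      filter_upwards [hO.mem_nhds hx.2] with y hy
      exact ((hΨ t ht).2 y hy).1
    have key : ∀ (q : W) (_ : q = κ.symm (κ x))
        (A A' : EuclideanSpace ℝ (Fin d) →L[ℝ] EuclideanSpace ℝ (Fin d)), A = A' →
        g t q (A a) (A b) = g t (κ.symm (κ x)) (A' a) (A' b) := by
      rintro q rfl A A' rfl
      rfl
    exact key _ hE'.self_of_nhds _ _ hE'.mfderiv_eq
  have h1 := ((hΨx s hs).mdifferentiableAt (by simp)).hasMFDerivAt.comp x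
    ((contMDiffAt_chart hx.1).mdifferentiableAt (by simp)).hasMFDerivAt
  have h2 : mfderiv (𝓡 d) (𝓡 d) (fun x => Ψ t s (κ x)) x = _ := h1.mfderiv
  rw [h2]
  exact (hconst _ _).trans (chartForm_mfderiv_chart (g t).toFun hx.1 u w)

/-- Along a flow line, the flow is defined and isometric near each of its points: the local
statement `exists_box` is propagated along the flow line. -/
lemma IsMetricFlow.eventually_isIsometryAt (hM : IsMetricFlow g v) {t s : ℝ} {x : W}
    (hx : x ∈ flowDomain v t s) :
    ∀ᶠ x' in 𝓝 x, x' ∈ flowDomain v t s ∧ IsIsometryAt (g t) (g s) (flowMap v t s) x' := by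
  obtain ⟨y, a, b, ht, hs, c, hc, rfl, rfl⟩ := hx
  let P : ℝ → ℝ → Prop := fun t s => ∀ᶠ x' in 𝓝 (c t),
    x' ∈ flowDomain v t s ∧ IsIsometryAt (g t) (g s) (flowMap v t s) x'
  refine isPreconnected_Ioo.induction₂' P ?_ ?_ ht hs
  · intro r hr
    obtain ⟨δ, hδ, hbox⟩ := hM.exists_box r (c r)
    have hr0 : r ∈ Ioo (r - δ) (r + δ) := ⟨by linarith, by linarith⟩
    refine eventually_nhdsWithin_of_eventually_nhds ?_
    filter_upwards [isOpen_Ioo.mem_nhds hr0,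
      (hc.continuousAt hr).eventually (eventually_eventually_nhds.2 hbox)] with r' hr' hbox'
    exact ⟨hbox.mono fun x' h => h r hr0 r' hr', hbox'.mono fun x' h => h r' hr' r hr0⟩
  · intro t s r ht hs hr hts hsr
    have hct : flowMap v t s (c t) = c s := (hc.reach ht hs).flowMap_eq hM.smooth_field
    have hcont : Tendsto (flowMap v t s) (𝓝 (c t)) (𝓝 (c s)) := by
      have := hts.self_of_nhds.2.1.continuousAt
      rwa [ContinuousAt, hct] at this
    have h1 : ∀ᶠ x' in 𝓝 (c t), (x' ∈ flowDomain v t s ∧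
        IsIsometryAt (g t) (g s) (flowMap v t s) x') ∧
        flowMap v t s x' ∈ flowDomain v s r ∧
        IsIsometryAt (g s) (g r) (flowMap v s r) (flowMap v t s x') :=
      hts.and (hcont.eventually hsr)
    have h2 : ∀ x', x' ∈ flowDomain v t s → flowMap v t s x' ∈ flowDomain v s r →
        Reach v t x' r (flowMap v s r (flowMap v t s x')) := fun x' h h' =>
      (reach_flowMap h).trans hM.smooth_field (reach_flowMap h')
    filter_upwards [eventually_eventually_nhds.2 h1] with x' hx'
    have h3 := hx'.self_of_nhds
    refine ⟨⟨_, h2 x' h3.1.1 h3.2.1⟩, (h3.1.2.comp h3.2.2).congr ?_⟩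
    filter_upwards [hx'] with x'' h4
    exact (h2 x'' h4.1.1 h4.2.1).flowMap_eq hM.smooth_field

lemma IsMetricFlow.isOpen_flowDomain (hM : IsMetricFlow g v) (t s : ℝ) :
    IsOpen (flowDomain v t s) :=
  isOpen_iff_eventually.2 fun _ hx => (hM.eventually_isIsometryAt hx).mono fun _ h => h.1

lemma IsMetricFlow.isIsometryAt (hM : IsMetricFlow g v) {t s : ℝ} {x : W}
    (hx : x ∈ flowDomain v t s) : IsIsometryAt (g t) (g s) (flowMap v t s) x :=
  (hM.eventually_isIsometryAt hx).self_of_nhds.2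

end FlowMap


/-! ### Geodesics -/

section Geodesic

variable {D : Type*} [NormedAddCommGroup D] [NormedSpace ℝ D] [FiniteDimensional ℝ D]

/-- The geodesic equation of the metric `B` on a vector space, for the position `y`, the velocity
`p` and the acceleration `q`: `B(q, w) = ½ ∂_w B(p, p) - ∂_p B(p, w)`. -/
def GeodesicEq (B : D → D →L[ℝ] D →L[ℝ] ℝ) (y p q : D) : Prop :=
  ∀ w, B y q w = 2⁻¹ * fderiv ℝ B y w p p - fderiv ℝ B y p p w

lemma GeodesicEq.smul {B : D → D →L[ℝ] D →L[ℝ] ℝ} {y p q : D} (h : GeodesicEq B y p q) (r : ℝ) :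
    GeodesicEq B y (r • p) (r ^ 2 • q) := by
  intro w
  have := h w
  simp only [map_smul, smul_apply, smul_eq_mul] at this ⊢
  linear_combination r ^ 2 * this

lemma exists_geodesic {B : D → D →L[ℝ] D →L[ℝ] ℝ} {V : Set D} (hV : IsOpen V)
    (hB : ContDiffOn ℝ ∞ B V) (hnd : ∀ y ∈ V, ∀ u, (∀ w, B y u w = 0) → u = 0) {y₀ : D}
    (hy₀ : y₀ ∈ V) (p₀ : D) :
    ∃ δ > 0, ∃ c p q : ℝ → D, c 0 = y₀ ∧ p 0 = p₀ ∧ ContDiffOn ℝ ∞ c (Ioo (-δ) δ) ∧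
      ∀ s ∈ Ioo (-δ) δ, HasDerivAt c (p s) s ∧ HasDerivAt p (q s) s ∧
        GeodesicEq B (c s) (p s) (q s) := by
  -- The right-hand side of the geodesic equation, as a linear form in `w`.
  let l : D × D → D →L[ℝ] ℝ := fun z =>
    (2⁻¹ : ℝ) • (((fderiv ℝ B z.1).flip z.2).flip z.2) - fderiv ℝ B z.1 z.2 z.2
  have hl : ContDiffOn ℝ ∞ l (V ×ˢ univ) := by
    rw [contDiffOn_clm_apply]
    intro w
    have h1 : ContDiffOn ℝ ∞ (fun z : D × D => fderiv ℝ B z.1) (V ×ˢ univ) :=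
      (hB.fderiv_of_isOpen hV (by simp)).comp contDiffOn_fst fun z hz => hz.1
    exact ((((h1.clm_apply contDiffOn_const).clm_apply contDiffOn_snd).clm_apply
      contDiffOn_snd).const_smul (2⁻¹ : ℝ)).sub
        (((h1.clm_apply contDiffOn_snd).clm_apply contDiffOn_snd).clm_apply contDiffOn_const)
  let f : D × D → D × D := fun z => (z.2, ContinuousLinearMap.inverse (B z.1) (l z))
  have hf : ContDiffOn ℝ ∞ f (V ×ˢ univ) := by
    intro z hz
    have hVz := (hV.prod isOpen_univ).mem_nhds hz
    have h1 : ContDiffAt ℝ ∞ (fun z : D × D => B z.1) z :=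
      (hB.contDiffAt (hV.mem_nhds hz.1)).comp z contDiffAt_fst
    exact (contDiffAt_snd.prodMk (contMDiffAt_inverse_apply h1.contMDiffAt
      (hl.contDiffAt hVz).contMDiffAt (hnd _ hz.1)).contDiffAt).contDiffWithinAt
  obtain ⟨δ, hδ, φ, hφ, hφ'⟩ := exists_smooth_local_flow_on (hV.prod isOpen_univ) hf
    (x₀ := (y₀, p₀)) ⟨hy₀, mem_univ _⟩
  have hx := Metric.mem_ball_self (x := (y₀, p₀)) hδ
  have h0 := (hφ' _ hx).1
  refine ⟨δ, hδ, fun s => (φ s (y₀, p₀)).1, fun s => (φ s (y₀, p₀)).2,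
    fun s => ContinuousLinearMap.inverse (B (φ s (y₀, p₀)).1) (l (φ s (y₀, p₀))),
    by simp [h0], by simp [h0], ?_, fun s hs => ?_⟩
  · exact contDiff_fst.comp_contDiffOn (hφ.comp (contDiffOn_id.prodMk contDiffOn_const)
      fun s hs => ⟨hs, hx⟩)
  · obtain ⟨h1, h2⟩ := (hφ' _ hx).2 s hs
    refine ⟨hasDerivAt_comp_curve (c := Prod.fst) (γ := fun s => φ s (y₀, p₀)) hasFDerivAt_fst h2,
      hasDerivAt_comp_curve (c := Prod.snd) (γ := fun s => φ s (y₀, p₀)) hasFDerivAt_snd h2, ?_⟩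
    intro w
    rw [apply_inverse_of_nondegenerate (hnd _ h1.1)]
    simp [l]

/-- A local isometry takes geodesics to geodesics. -/
lemma hasDerivAt_euler_lagrange_of_isometry {B₁ B₂ : D → D →L[ℝ] D →L[ℝ] ℝ} {ψ : D → D}
    {c p : ℝ → D} {q : D} {t : ℝ} (hB₂ : DifferentiableAt ℝ B₂ (ψ (c t)))
    (hψ : ContDiffAt ℝ ∞ ψ (c t)) (hsymm : ∀ u w, B₂ (ψ (c t)) u w = B₂ (ψ (c t)) w u)
    (hB₁ : ∀ᶠ y in 𝓝 (c t), ∀ u w, B₁ y u w = B₂ (ψ y) (fderiv ℝ ψ y u) (fderiv ℝ ψ y w))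
    (hdB₁ : DifferentiableAt ℝ B₁ (c t))
    (hnd : ∀ u, (∀ w, B₁ (c t) u w = 0) → u = 0)
    (hc : ∀ᶠ s in 𝓝 t, HasDerivAt c (p s) s) (hp : HasDerivAt p q t)
    (hgeo : GeodesicEq B₁ (c t) (p t) q) (w : D) :
    HasDerivAt (fun s => B₂ (ψ (c s)) (deriv (fun s => ψ (c s)) s) w)
      (2⁻¹ * fderiv ℝ B₂ (ψ (c t)) w (deriv (fun s => ψ (c s)) t)
        (deriv (fun s => ψ (c s)) t)) t := by
  have hψd : ∀ᶠ y in 𝓝 (c t), HasFDerivAt ψ (fderiv ℝ ψ y) y := by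
    filter_upwards [(hψ.of_le (m := 1) (by simp)).eventually (by simp)] with y hy
    exact (hy.differentiableAt (by simp)).hasFDerivAt
  have hct := hc.self_of_nhds
  have hder : ∀ᶠ s in 𝓝 t, deriv (fun s => ψ (c s)) s = fderiv ℝ ψ (c s) (p s) := by
    filter_upwards [hc, hct.continuousAt.eventually hψd] with s h1 h2
    exact (hasDerivAt_comp_curve h2 h1).deriv
  have hψ2 : HasFDerivAt (fderiv ℝ ψ) (fderiv ℝ (fderiv ℝ ψ) (c t)) (c t) :=
    ((hψ.fderiv_right (m := 1) (by rw [one_add_one_eq_two]; exact two_le_infty)).differentiableAt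
      (by simp)).hasFDerivAt
  have hsym2 : ∀ a b, fderiv ℝ (fderiv ℝ ψ) (c t) a b = fderiv ℝ (fderiv ℝ ψ) (c t) b a :=
    fun a b => second_derivative_symmetric_of_eventually hψd hψ2 a b
  set A := fderiv ℝ ψ (c t) with hA
  set H := fderiv ℝ (fderiv ℝ ψ) (c t) with hH
  set e := A (p t) with he
  -- The differential of `ψ` is injective, hence surjective.
  have hinj : Function.Injective A := by
    rw [injective_iff_map_eq_zero]
    intro u hu
    refine hnd u fun w => ?_
    rw [hB₁.self_of_nhds, ← hA, hu]
    simp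
  obtain ⟨w₀, rfl⟩ := (LinearMap.injective_iff_surjective (f := A.toLinearMap)).1 hinj w
  -- The derivative of the relation `B₁ = ψ^* B₂`.
  have hpull : ∀ a b b', fderiv ℝ B₁ (c t) a b b'
      = fderiv ℝ B₂ (ψ (c t)) (A a) (A b) (A b') + B₂ (ψ (c t)) (H a b) (A b')
        + B₂ (ψ (c t)) (A b) (H a b') := by
    intro a b b'
    have h1 : HasFDerivAt (fun y => B₁ y b b') _ (c t) :=
      (hdB₁.hasFDerivAt.clm_apply (hasFDerivAt_const b _)).clm_apply (hasFDerivAt_const b' _)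
    have h2 : HasFDerivAt (fun y => B₂ (ψ y)) ((fderiv ℝ B₂ (ψ (c t))).comp A) (c t) :=
      hasFDerivAt_comp_map (c := B₂) (X := ψ) hB₂.hasFDerivAt hψd.self_of_nhds
    have h3 : HasFDerivAt (fun y => B₂ (ψ y) (fderiv ℝ ψ y b) (fderiv ℝ ψ y b')) _ (c t) :=
      (h2.clm_apply (hψ2.clm_apply (hasFDerivAt_const b _))).clm_apply
        (hψ2.clm_apply (hasFDerivAt_const b' _))
    have h4 := h1.unique (h3.congr_of_eventuallyEq (hB₁.mono fun y hy => hy b b'))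
    have h5 := congrArg (fun L : D →L[ℝ] ℝ => L a) h4
    simp only [add_apply, ContinuousLinearMap.flip_apply, ContinuousLinearMap.comp_apply,
      zero_apply, map_zero, zero_add] at h5
    rw [h5]
    ring
  have hQ : HasDerivAt (fun s => B₂ (ψ (c s))) (fderiv ℝ B₂ (ψ (c t)) e) t :=
    hasDerivAt_comp_curve (c := B₂) (γ := fun s => ψ (c s)) hB₂.hasFDerivAt
      (hasDerivAt_comp_curve hψd.self_of_nhds hct)
  have hvel : HasDerivAt (fun s => fderiv ℝ ψ (c s) (p s)) (H (p t) (p t) + A q) t :=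
    (hasDerivAt_comp_curve (c := fderiv ℝ ψ) (γ := c) hψ2 hct).clm_apply hp
  have hk := hasDerivAt_bilin hQ hvel (hasDerivAt_const t (A w₀))
  have hev : (fun s => B₂ (ψ (c s)) (deriv (fun s => ψ (c s)) s) (A w₀)) =ᶠ[𝓝 t]
      fun s => B₂ (ψ (c s)) (fderiv ℝ ψ (c s) (p s)) (A w₀) :=
    hder.mono fun s hs => by simp only [hs]
  refine (hk.congr_of_eventuallyEq hev).congr_deriv ?_
  rw [hder.self_of_nhds]
  have h1 := hgeo w₀
  rw [hpull, hpull, hB₁.self_of_nhds] at h1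
  simp only [map_add, add_apply, map_zero, add_zero]
  have h2 := hsym2 (p t) w₀
  have h3 := hsymm (H w₀ (p t)) e
  rw [h2] at h1
  change B₂ (ψ (c t)) (A q) (A w₀) = _ at h1
  change fderiv ℝ B₂ (ψ (c t)) e e (A w₀) + _ = 2⁻¹ * fderiv ℝ B₂ (ψ (c t)) (A w₀) e e
  linear_combination h1 + 2⁻¹ * h3

/-- A ball in the open set `A` touching its complement, near a given boundary point of `A`. -/
lemma exists_touching_ball {A V : Set D} (hA : IsOpen A) (hV : IsOpen V) {y : D} (hyV : y ∈ V)
    (hy : y ∈ closure A) (hyA : y ∉ A) :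
    ∃ y₁ y₂ : D, 0 < dist y₂ y₁ ∧ Metric.ball y₁ (dist y₂ y₁) ⊆ A ∩ V ∧ y₂ ∈ V ∧ y₂ ∉ A := by
  have : ProperSpace D := FiniteDimensional.proper ℝ D
  obtain ⟨r, hr, hrV⟩ := Metric.isOpen_iff.1 hV y hyV
  obtain ⟨y₁, hy₁, hd⟩ := Metric.mem_closure_iff.1 hy (r / 4) (by positivity)
  obtain ⟨y₂, hy₂, hmin⟩ := ((isCompact_closedBall y (r / 2)).diff hA).exists_isMinOn
    ⟨y, Metric.mem_closedBall_self (by positivity), hyA⟩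
    (f := fun z => dist z y₁) (by fun_prop)
  have hle : dist y₂ y₁ ≤ dist y y₁ :=
    hmin (show y ∈ Metric.closedBall y (r / 2) \ A from
      ⟨Metric.mem_closedBall_self (by positivity), hyA⟩)
  refine ⟨y₁, y₂, dist_pos.2 fun h => hy₂.2 (h ▸ hy₁), fun z hz => ?_,
    hrV (lt_of_le_of_lt (Metric.mem_closedBall.1 hy₂.1) (by linarith)), hy₂.2⟩
  have hz' : dist z y < r / 2 := by
    have h1 := dist_triangle z y₁ y
    rw [dist_comm y₁ y] at h1
    have h2 := Metric.mem_ball.1 hz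
    linarith
  refine ⟨?_, hrV (Metric.mem_ball.2 (by linarith))⟩
  by_contra hzA
  have h3 : dist y₂ y₁ ≤ dist z y₁ :=
    hmin (show z ∈ Metric.closedBall y (r / 2) \ A from ⟨hz'.le, hzA⟩)
  exact absurd (Metric.mem_ball.1 hz) (not_lt.2 h3)

/-- A geodesic in the ball around `y₁` through `y₂` which runs into the boundary point `y₂`. -/
lemma exists_geodesic_into_boundary {B : D → D →L[ℝ] D →L[ℝ] ℝ} {V : Set D} (hV : IsOpen V)
    (hB : ContDiffOn ℝ ∞ B V) (hnd : ∀ y ∈ V, ∀ u, (∀ w, B y u w = 0) → u = 0) {y₁ y₂ : D}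
    (hy₂ : y₂ ∈ V) (hpos : 0 < dist y₂ y₁) :
    ∃ c p q : ℝ → D, Tendsto c (𝓝[<] 1) (𝓝 y₂) ∧ ContDiffOn ℝ ∞ c (Ioo 0 1) ∧
      ∀ s ∈ Ioo (0 : ℝ) 1, c s ∈ Metric.ball y₁ (dist y₂ y₁) ∧ HasDerivAt c (p s) s ∧
        HasDerivAt p (q s) s ∧ GeodesicEq B (c s) (p s) (q s) := by
  obtain ⟨δ, hδ, c, p, q, hc0, hp0, hcs, hc⟩ := exists_geodesic hV hB hnd hy₂ (y₁ - y₂)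
  have h0 : (0 : ℝ) ∈ Ioo (-δ) δ := ⟨by linarith, hδ⟩
  -- To first order `c s` is `y₂ + s (y₁ - y₂)`, which lies in the ball for `0 < s ≤ 1`.
  have hlin := (hasDerivAt_iff_isLittleO.1 (hc 0 h0).1).def (half_pos hpos)
  simp only [hc0, hp0, sub_zero] at hlin
  obtain ⟨η, hη, hηb⟩ := Metric.eventually_nhds_iff.1 hlin
  obtain ⟨ε, hε0, hε⟩ : ∃ ε > 0, ε < min (min δ η) 1 :=
    exists_between (lt_min (lt_min hδ hη) one_pos)
  simp only [lt_min_iff] at hε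
  have hball : ∀ s ∈ Ioo 0 ε, c s ∈ Metric.ball y₁ (dist y₂ y₁) := by
    intro s hs
    have h1 := hηb (y := s) (by
      rw [Real.dist_eq, sub_zero, abs_of_pos hs.1]
      exact hs.2.trans hε.1.2)
    rw [Real.norm_of_nonneg hs.1.le] at h1
    have h2 : c s - y₁ = (c s - y₂ - s • (y₁ - y₂)) + (1 - s) • (y₂ - y₁) := by
      module
    rw [Metric.mem_ball, dist_eq_norm, h2]
    refine lt_of_le_of_lt (norm_add_le _ _) ?_
    rw [norm_smul, Real.norm_of_nonneg (by linarith [hs.2, hε.2]), ← dist_eq_norm y₂ y₁]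
    nlinarith [mul_pos hpos hs.1]
  have hε' : ∀ s ∈ Ioo (0 : ℝ) 1, ε * (1 - s) ∈ Ioo 0 ε := fun s hs =>
    ⟨mul_pos hε0 (by linarith [hs.2]), by nlinarith [hs.1]⟩
  have hεδ : ∀ s ∈ Ioo (0 : ℝ) 1, ε * (1 - s) ∈ Ioo (-δ) δ := fun s hs =>
    ⟨by linarith [(hε' s hs).1], (hε' s hs).2.trans hε.1.1⟩
  have hd : ∀ s, HasDerivAt (fun s => ε * (1 - s)) (-ε) s := fun s => by
    simpa using ((hasDerivAt_id s).const_sub 1).const_mul ε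
  refine ⟨fun s => c (ε * (1 - s)), fun s => (-ε) • p (ε * (1 - s)),
    fun s => (-ε) ^ 2 • q (ε * (1 - s)), ?_, ?_, fun s hs => ⟨hball _ (hε' s hs), ?_, ?_, ?_⟩⟩
  · have h1 : ContinuousAt c (ε * (1 - 1)) := by
      rw [sub_self, mul_zero]
      exact (hc 0 h0).1.continuousAt
    have h2 := ContinuousAt.comp (f := fun s : ℝ => ε * (1 - s)) h1 (hd 1).continuousAt
    have h3 := h2.tendsto.mono_left (nhdsWithin_le_nhds (s := Iio (1 : ℝ)))
    simpa [Function.comp_def, hc0] using h3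
  · exact hcs.comp (by fun_prop) hεδ
  · exact (hc _ (hεδ s hs)).1.scomp s (hd s)
  · have := ((hc _ (hεδ s hs)).2.1.scomp s (hd s)).const_smul (-ε)
    refine this.congr_deriv ?_
    rw [smul_smul, sq]
  · exact (hc _ (hεδ s hs)).2.2.smul (-ε)

/-- A metric defined near a point agrees near that point with a metric on the whole space. -/
lemma exists_metric_extension {B : D → D →L[ℝ] D →L[ℝ] ℝ} {V : Set D} (hV : IsOpen V)
    (hB : ContDiffOn ℝ ∞ B V) (hsymm : ∀ y ∈ V, ∀ u w, B y u w = B y w u) {y₀ : D} (hy₀ : y₀ ∈ V)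
    (hnd : ∀ u, (∀ w, B y₀ u w = 0) → u = 0) :
    ∃ r > 0, Metric.ball y₀ r ⊆ V ∧ ∃ h : D → D →L[ℝ] D →L[ℝ] ℝ, ContDiff ℝ ∞ h ∧
      (∀ y u w, h y u w = h y w u) ∧ (∀ y u, (∀ w, h y u w = 0) → u = 0) ∧
      ∀ y ∈ Metric.ball y₀ r, h y = B y := by
  obtain ⟨ε, hε, hεnd⟩ := Metric.eventually_nhds_iff.1
    (eventually_nondegenerate (G := fun b : D →L[ℝ] D →L[ℝ] ℝ => b) (z := B y₀) continuousAt_id hnd)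
  have hBc : ContinuousAt B y₀ := (hB.contDiffAt (hV.mem_nhds hy₀)).continuousAt
  obtain ⟨δ, hδ, hδV⟩ := Metric.eventually_nhds_iff.1
    ((hV.eventually_mem hy₀).and (hBc.eventually (Metric.ball_mem_nhds (B y₀) hε)))
  let χ : ContDiffBump y₀ := ⟨δ / 4, δ / 2, by positivity, by linarith⟩
  have hχ0 : ∀ y, y ∉ V → χ =ᶠ[𝓝 y] 0 := by
    intro y hy
    rw [← notMem_tsupport_iff_eventuallyEq, χ.tsupport_eq]
    intro h
    exact hy (hδV (lt_of_le_of_lt (Metric.mem_closedBall.1 h)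
      (by change δ / 2 < δ; linarith))).1
  refine ⟨δ / 4, by positivity, fun y hy => (hδV (lt_trans (Metric.mem_ball.1 hy)
    (by linarith))).1, fun y => B y₀ + χ y • (B y - B y₀), ?_, ?_, ?_, ?_⟩
  · rw [contDiff_iff_contDiffAt]
    intro y
    by_cases hy : y ∈ V
    · exact contDiffAt_const.add (χ.contDiff.contDiffAt.smul
        ((hB.contDiffAt (hV.mem_nhds hy)).sub contDiffAt_const))
    · refine (contDiffAt_const (c := B y₀)).congr_of_eventuallyEq ?_
      filter_upwards [hχ0 y hy] with z hz
      simp [hz]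
  · intro y u w
    by_cases hy : y ∈ V
    · simp [hsymm y hy u w, hsymm y₀ hy₀ u w]
    · simp [(hχ0 y hy).self_of_nhds, hsymm y₀ hy₀ u w]
  · intro y
    refine hεnd ?_
    rw [dist_eq_norm, add_sub_cancel_left]
    by_cases hy : dist y y₀ < δ
    · rw [norm_smul, Real.norm_of_nonneg χ.nonneg]
      refine lt_of_le_of_lt (mul_le_of_le_one_left (norm_nonneg _) χ.le_one) ?_
      rw [← dist_eq_norm]
      exact (hδV hy).2
    · rw [χ.zero_of_le_dist (by change δ / 2 ≤ _; linarith)]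
      simpa using hε
  · intro y hy
    have h1 : χ y = 1 := χ.one_of_mem_closedBall (Metric.ball_subset_closedBall hy)
    simp [h1]

end Geodesic

section GeodesicManifold

variable {d : ℕ} {W : Type*} [TopologicalSpace W] [ChartedSpace (EuclideanSpace ℝ (Fin d)) W]
  [IsManifold (𝓡 d) ∞ W]

/-- The image under a local isometry of a geodesic given in coordinates is a geodesic. -/
lemma isGeodesic_of_isometry {g₁ g₂ : FormField d W}
    (hg₁ : ∀ x₀, ∀ y ∈ (extChartAt (𝓡 d) x₀).target, ContDiffAt ℝ ∞ (g₁.chart x₀) y)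
    (hg₂ : ∀ x₀, ∀ y ∈ (extChartAt (𝓡 d) x₀).target, ContDiffAt ℝ ∞ (g₂.chart x₀) y)
    (hsymm : ∀ x u w, g₂ x u w = g₂ x w u) {x₀ : W} {ψ : W → W}
    {c p q : ℝ → EuclideanSpace ℝ (Fin d)}
    (hnd : ∀ s ∈ Ioo (0 : ℝ) 1, ∀ u, (∀ w, g₁.chart x₀ (c s) u w = 0) → u = 0)
    (hct : ∀ s ∈ Ioo (0 : ℝ) 1, c s ∈ (extChartAt (𝓡 d) x₀).target)
    (hψ : ∀ s ∈ Ioo (0 : ℝ) 1, ∀ᶠ x in 𝓝 ((extChartAt (𝓡 d) x₀).symm (c s)),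
      IsIsometryAt g₁ g₂ ψ x)
    (hc : ContDiffOn ℝ ∞ c (Ioo 0 1)) (hcp : ∀ s ∈ Ioo (0 : ℝ) 1, HasDerivAt c (p s) s)
    (hpq : ∀ s ∈ Ioo (0 : ℝ) 1, HasDerivAt p (q s) s)
    (hgeo : ∀ s ∈ Ioo (0 : ℝ) 1, GeodesicEq (g₁.chart x₀) (c s) (p s) (q s)) :
    IsGeodesic g₂.toFun (fun s => ψ ((extChartAt (𝓡 d) x₀).symm (c s))) := by
  refine ⟨fun s hs => ?_, fun t ht => ?_⟩
  · have h1 := (hc.contDiffAt (isOpen_Ioo.mem_nhds hs)).contMDiffAt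
    have h2 : ContMDiffAt 𝓘(ℝ, ℝ) (𝓡 d) ∞ (fun s => (extChartAt (𝓡 d) x₀).symm (c s)) s :=
      (contMDiffAt_chart_symm (hct s hs)).comp s h1
    exact (ContMDiffAt.comp (g := ψ) s (hψ s hs).self_of_nhds.1 h2).contMDiffWithinAt
  set z := ψ ((extChartAt (𝓡 d) x₀).symm (c t)) with hz
  set κ := extChartAt (𝓡 d) z with hκ
  have hsm := contMDiffAt_chart_symm (hct t ht)
  let f : EuclideanSpace ℝ (Fin d) → EuclideanSpace ℝ (Fin d) :=
    fun y => κ (ψ ((extChartAt (𝓡 d) x₀).symm y))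
  have hψt := (hψ t ht).self_of_nhds.1
  have hψs : ContMDiffAt 𝓘(ℝ, EuclideanSpace ℝ (Fin d)) (𝓡 d) ∞
      (fun y => ψ ((extChartAt (𝓡 d) x₀).symm y)) (c t) :=
    ContMDiffAt.comp (g := ψ) (c t) hψt hsm
  have hf : ContDiffAt ℝ ∞ f (c t) :=
    (ContMDiffAt.comp (g := κ) (c t) (contMDiffAt_chart (mem_extChartAt_source z)) hψs).contDiffAt
  have hpull : ∀ᶠ y in 𝓝 (c t), ∀ u w, g₁.chart x₀ y u w
      = g₂.chart z (f y) (fderiv ℝ f y u) (fderiv ℝ f y w) := by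
    filter_upwards [(isOpen_extChartAt_target (I := 𝓡 d) x₀).mem_nhds (hct t ht),
      hsm.continuousAt.eventually (hψ t ht),
      hψs.continuousAt.preimage_mem_nhds
        ((isOpen_extChartAt_source (I := 𝓡 d) z).mem_nhds (mem_extChartAt_source z))] with y h1 h2 h3
    have h4 : ∀ e, fderiv ℝ f y e = mfderiv (𝓡 d) 𝓘(ℝ, EuclideanSpace ℝ (Fin d)) κ
        (ψ ((extChartAt (𝓡 d) x₀).symm y)) (mfderiv (𝓡 d) (𝓡 d) ψ
          ((extChartAt (𝓡 d) x₀).symm y) (coordVec x₀ y e)) := by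
      intro e
      have h5 := ((contMDiffAt_chart h3).mdifferentiableAt (by simp)).hasMFDerivAt.comp y
        (((h2.1.mdifferentiableAt (by simp)).hasMFDerivAt).comp y
          ((contMDiffAt_chart_symm h1).mdifferentiableAt (by simp)).hasMFDerivAt)
      have h6 := h5.mfderiv
      rw [mfderiv_eq_fderiv] at h6
      exact congrArg (fun A : EuclideanSpace ℝ (Fin d) →L[ℝ] EuclideanSpace ℝ (Fin d) => A e) h6
    intro u w
    rw [h4, h4, g₁.chart_apply]
    exact ((g₂.chart_apply z (f y) _ _).trans
      ((chartForm_mfderiv_chart g₂.toFun h3 _ _).trans (h2.2 _ _))).symm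
  intro γ w
  have h := hasDerivAt_euler_lagrange_of_isometry (B₁ := g₁.chart x₀) (B₂ := g₂.chart z) (ψ := f)
    (p := p) (q := q t) ((hg₂ z _ (mem_extChartAt_target z)).differentiableAt (by simp)) hf
    (fun u w => by
      rw [g₂.chart_apply, g₂.chart_apply]
      exact hsymm _ _ _)
    hpull ((hg₁ x₀ _ (hct t ht)).differentiableAt (by simp)) (hnd t ht)
    (eventually_of_mem (isOpen_Ioo.mem_nhds ht) hcp) (hpq t ht) (hgeo t ht) w
  simp only [g₂.chart_apply] at h
  refine h.congr_deriv ?_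
  have h1 := (hg₂ z _ (mem_extChartAt_target z)).differentiableAt (by simp)
  have h2 : HasFDerivAt (fun y => g₂.chart z y (deriv γ t) (deriv γ t)) _ (κ z) :=
    (h1.hasFDerivAt.clm_apply (hasFDerivAt_const _ _)).clm_apply (hasFDerivAt_const _ _)
  simp only [g₂.chart_apply] at h2
  refine congrArg (2⁻¹ * ·) ?_
  have h3 := h2.fderiv
  refine Eq.trans ?_ (congrArg (fun L : EuclideanSpace ℝ (Fin d) →L[ℝ] ℝ => L w) h3).symm
  simp [γ, f, z]
  rfl

end GeodesicManifold


/-! ### Completeness of the flow on maximally extended metrics -/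

section Complete

variable {d : ℕ} {W : Type*} [TopologicalSpace W] [ChartedSpace (EuclideanSpace ℝ (Fin d)) W]
  [IsManifold (𝓡 d) ∞ W] {v : ℝ → ∀ x : W, TangentSpace (𝓡 d) x} {g : ℝ → FormField d W}

lemma IsMetricFlow.contDiffAt_chart_time (hM : IsMetricFlow g v) (t : ℝ) (x₀ : W)
    {y : EuclideanSpace ℝ (Fin d)} (hy : y ∈ (extChartAt (𝓡 d) x₀).target) :
    ContDiffAt ℝ ∞ ((g t).chart x₀) y :=
  (hM.contDiffAt_chart x₀ t hy).comp y (contDiffAt_const.prodMk contDiffAt_id)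

lemma FormField.chart_symm {g : FormField d W} (hg : ∀ x u w, g x u w = g x w u) (x₀ : W)
    (y u w : EuclideanSpace ℝ (Fin d)) : g.chart x₀ y u w = g.chart x₀ y w u := by
  rw [g.chart_apply, g.chart_apply]
  exact hg _ _ _

lemma FormField.chart_nondegenerate {g : FormField d W} (hg : NonDegenerate g.toFun) (x₀ : W)
    {y : EuclideanSpace ℝ (Fin d)} (hy : y ∈ (extChartAt (𝓡 d) x₀).target)
    (u : EuclideanSpace ℝ (Fin d)) (hu : ∀ w, g.chart x₀ y u w = 0) : u = 0 := by
  have h1 : coordVec x₀ y u = 0 := hg _ _ fun w => by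
    have h2 := hu (mfderiv (𝓡 d) 𝓘(ℝ, EuclideanSpace ℝ (Fin d)) (extChartAt (𝓡 d) x₀)
      ((extChartAt (𝓡 d) x₀).symm y) w)
    refine Eq.trans ?_ ((g.chart_apply x₀ y u _).symm.trans h2)
    exact congrArg (g _ (coordVec x₀ y u)) (coordVec_mfderiv_chart hy w).symm
  have h2 := mfderiv_chart_coordVec hy u
  rw [h1] at h2
  exact h2.symm.trans (map_zero (mfderiv (𝓡 d) 𝓘(ℝ, EuclideanSpace ℝ (Fin d)) (extChartAt (𝓡 d) x₀)
      ((extChartAt (𝓡 d) x₀).symm y)))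

lemma flowDomain_subset {t s r : ℝ} (hr : r ∈ uIcc t s) :
    flowDomain v t s ⊆ flowDomain v t r := by
  rintro x ⟨y, a, b, ht, hs, c, hc, hct, -⟩
  have hr' : r ∈ Ioo a b := ordConnected_Ioo.uIcc_subset ht hs hr
  exact ⟨c r, a, b, ht, hr', c, hc, hct, rfl⟩

lemma isOpen_setOf_mem_flowDomain (t : ℝ) (x : W) : IsOpen {s | x ∈ flowDomain v t s} := by
  rw [isOpen_iff_mem_nhds]
  rintro s ⟨y, a, b, ht, hs, c, hc, hct, -⟩
  filter_upwards [isOpen_Ioo.mem_nhds hs] with r hr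
  exact ⟨c r, a, b, ht, hr, c, hc, hct, rfl⟩

variable [T2Space W]

lemma IsMetricFlow.self_mem_flowDomain (hM : IsMetricFlow g v) (t : ℝ) (x : W) :
    x ∈ flowDomain v t t := by
  obtain ⟨δ, hδ, h⟩ := hM.exists_box t x
  have ht : t ∈ Ioo (t - δ) (t + δ) := ⟨by linarith, by linarith⟩
  exact (h.self_of_nhds t ht t ht).1

lemma IsMetricFlow.flowMap_flowMap (hM : IsMetricFlow g v) {t s : ℝ} {x : W}
    (hx : x ∈ flowDomain v t s) : flowMap v s t (flowMap v t s x) = x :=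
  (reach_flowMap hx).symm.flowMap_eq hM.smooth_field

lemma flowMap_mem_flowDomain {t s : ℝ} {x : W} (hx : x ∈ flowDomain v t s) : flowMap v t s x ∈ flowDomain v s t :=
  ⟨x, (reach_flowMap hx).symm⟩

/-- If points converging to `x` are carried from time `t` to time `T` in such a way that their
images have a cluster point `z`, and if the flow line of `x` exists for times arbitrarily close
to `T`, then it exists at time `T`. -/
lemma IsMetricFlow.mem_flowDomain_of_mapClusterPt (hM : IsMetricFlow g v) {t T : ℝ} {x z : W}
    {f : ℝ → W} {l : Filter ℝ} (hf : Tendsto f l (𝓝 x)) (hfT : ∀ᶠ τ in l, f τ ∈ flowDomain v t T)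
    (hz : MapClusterPt z l (fun τ => flowMap v t T (f τ)))
    (hT : T ∈ closure {σ | x ∈ flowDomain v t σ}) : x ∈ flowDomain v t T := by
  obtain ⟨δ, hδ, hbox⟩ := hM.exists_box T z
  have hTI : T ∈ Ioo (T - δ) (T + δ) := ⟨by linarith, by linarith⟩
  obtain ⟨σ, hσI, hσ⟩ := mem_closure_iff.1 hT _ isOpen_Ioo hTI
  have hzσ := hbox.self_of_nhds T hTI σ hσI
  have heq : flowMap v T σ z = flowMap v t σ x := by
    by_contra hne
    obtain ⟨P, Q, hP, hQ, hzP, hxQ, hPQ⟩ := t2_separation hne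
    have h1 : ∀ᶠ z' in 𝓝 z, z' ∈ flowDomain v T σ ∧ flowMap v T σ z' ∈ P :=
      (hbox.mono fun z' h => (h T hTI σ hσI).1).and
        (hzσ.2.1.continuousAt.eventually (hP.mem_nhds hzP))
    have h2 : ∀ᶠ τ in l, flowMap v t σ (f τ) ∈ Q :=
      hf.eventually ((hM.isIsometryAt hσ).1.continuousAt.eventually (hQ.mem_nhds hxQ))
    obtain ⟨τ, h3, h4, h5⟩ := ((hz.frequently h1).and_eventually (h2.and hfT)).exists
    have h6 : flowMap v t σ (f τ) = flowMap v T σ (flowMap v t T (f τ)) :=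
      ((reach_flowMap h5).trans hM.smooth_field (reach_flowMap h3.1)).flowMap_eq hM.smooth_field
    rw [h6] at h4
    exact hPQ.le_bot ⟨h3.2, h4⟩
  have h7 := reach_flowMap hzσ.1
  rw [heq] at h7
  exact ⟨z, (reach_flowMap hσ).trans hM.smooth_field h7.symm⟩

/-- The flow does not lose points: at a boundary point of the set of points which are carried from
time `t` to time `s` some geodesic of `g t` would be carried to a geodesic of `g T`, for the
time `T` at which that boundary point is lost, which runs off at a regular place. -/
theorem IsMetricFlow.isClosed_flowDomain (hM : IsMetricFlow g v)
    (hmax : ∀ t, MaximallyExtended (g t).toFun) (t s : ℝ) : IsClosed (flowDomain v t s) := by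
  refine isClosed_of_closure_subset fun x' hx' => ?_
  by_contra hx'G
  set κ := extChartAt (𝓡 d) x' with hκ
  set B := (g t).chart x' with hBdef
  have hsrc : x' ∈ κ.source := mem_extChartAt_source x'
  have htar : κ x' ∈ κ.target := mem_extChartAt_target (I := 𝓡 d) x'
  have htaro : IsOpen κ.target := isOpen_extChartAt_target x'
  have hBs : ContDiffOn ℝ ∞ B κ.target := fun y hy =>
    (hM.contDiffAt_chart_time t x' hy).contDiffWithinAt
  have hBnd : ∀ y ∈ κ.target, ∀ u, (∀ w, B y u w = 0) → u = 0 := fun y hy =>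
    FormField.chart_nondegenerate (hM.nondegenerate t) x' hy
  obtain ⟨r, hr, hrV, h, hhs, hhsymm, hhnd, hhB⟩ := exists_metric_extension htaro hBs
    (fun y _ => FormField.chart_symm (hM.symm t) x' y) htar (hBnd _ htar)
  let A := κ.target ∩ κ.symm ⁻¹' flowDomain v t s
  have hA : IsOpen A := (continuousOn_extChartAt_symm x').isOpen_inter_preimage htaro
    (hM.isOpen_flowDomain t s)
  have hclA : κ x' ∈ closure A := by
    rw [mem_closure_iff_frequently]
    refine (continuousAt_extChartAt x').tendsto.frequently ?_
    refine ((mem_closure_iff_frequently.1 hx').and_eventually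
      (extChartAt_source_mem_nhds (I := 𝓡 d) x')).mono fun x hx => ?_
    refine ⟨κ.map_source hx.2, ?_⟩
    rw [mem_preimage, κ.left_inv hx.2]
    exact hx.1
  have hyA : κ x' ∉ A := fun hy => hx'G (by
    have := hy.2
    rwa [mem_preimage, κ.left_inv hsrc] at this)
  obtain ⟨y₁, y₂, hpos, hsub, hy₂V, hy₂A⟩ := exists_touching_ball hA Metric.isOpen_ball
    (Metric.mem_ball_self hr) hclA hyA
  obtain ⟨c, p, q, hclim, hcs, hc⟩ := exists_geodesic_into_boundary Metric.isOpen_ball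
    (hBs.mono hrV) (fun y hy => hBnd y (hrV hy)) hy₂V hpos
  have hy₂t : y₂ ∈ κ.target := hrV hy₂V
  set x := κ.symm y₂ with hx
  have hxG : x ∉ flowDomain v t s := fun hxG => hy₂A ⟨hy₂t, hxG⟩
  -- A time at which the flow line of `x` ceases to exist: a boundary point of its lifespan.
  obtain ⟨T, hTcl, hTI, hT⟩ : ∃ T, T ∈ closure {σ | x ∈ flowDomain v t σ} ∧ T ∈ uIcc t s ∧
      x ∉ flowDomain v t T := by
    by_contra! hcon
    exact hxG (isPreconnected_uIcc.subset_of_closure_inter_subset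
      (isOpen_setOf_mem_flowDomain t x) ⟨t, left_mem_uIcc, hM.self_mem_flowDomain t x⟩
      (fun T hT => hcon T hT.1 hT.2) right_mem_uIcc)
  have hcA : ∀ τ ∈ Ioo (0 : ℝ) 1, c τ ∈ κ.target ∧ κ.symm (c τ) ∈ flowDomain v t T ∧
      c τ ∈ Metric.ball (κ x') r := fun τ hτ => by
    have h1 := hsub (hc τ hτ).1
    exact ⟨h1.1.1, flowDomain_subset hTI h1.1.2, h1.2⟩
  have hev : ∀ᶠ τ in 𝓝[<] (1 : ℝ), τ ∈ Ioo (0 : ℝ) 1 :=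
    Ioo_mem_nhdsLT one_pos
  set γ : ℝ → W := fun τ => flowMap v t T (κ.symm (c τ)) with hγ
  have hgeo : IsGeodesic (g T).toFun γ :=
    isGeodesic_of_isometry (fun x₀ y hy => hM.contDiffAt_chart_time t x₀ hy)
      (fun x₀ y hy => hM.contDiffAt_chart_time T x₀ hy) (hM.symm T)
      (fun τ hτ => hBnd _ (hcA τ hτ).1) (fun τ hτ => (hcA τ hτ).1)
      (fun τ hτ => (hM.eventually_isIsometryAt (hcA τ hτ).2.1).mono fun _ h => h.2) hcs
      (fun τ hτ => (hc τ hτ).2.1) (fun τ hτ => (hc τ hτ).2.2.1) fun τ hτ => (hc τ hτ).2.2.2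
  obtain ⟨z, hz⟩ : ∃ z, MapClusterPt z (𝓝[<] (1 : ℝ)) γ := by
    rcases hmax T with hcpt | hmaxT
    · exact exists_clusterPt_of_compactSpace _
    have hfl := fun z (hz : z ∈ flowDomain v T t) => hM.isIsometryAt hz
    let U : Set W := flowDomain v T t ∩ flowMap v T t ⁻¹' (κ.source ∩ κ ⁻¹' Metric.ball (κ x') r)
    have hU : IsOpen U := by
      refine ContinuousOn.isOpen_inter_preimage
        (fun z hz => (hfl z hz).1.continuousAt.continuousWithinAt) (hM.isOpen_flowDomain T t) ?_
      exact (continuousOn_extChartAt x').isOpen_inter_preimage (isOpen_extChartAt_source x')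
        Metric.isOpen_ball
    have hback : ∀ τ ∈ Ioo (0 : ℝ) 1, flowMap v T t (γ τ) = κ.symm (c τ) := fun τ hτ =>
      hM.flowMap_flowMap (hcA τ hτ).2.1
    have hγU : γ '' Ioo 0 1 ⊆ U := by
      rintro _ ⟨τ, hτ, rfl⟩
      refine ⟨flowMap_mem_flowDomain (hcA τ hτ).2.1, ?_⟩
      rw [mem_preimage, hback τ hτ]
      refine ⟨κ.map_target (hcA τ hτ).1, ?_⟩
      rw [mem_preimage, κ.right_inv (hcA τ hτ).1]
      exact (hcA τ hτ).2.2
    obtain ⟨z, hz⟩ := hmaxT γ hgeo U hU hγU (fun z => κ (flowMap v T t z))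
      (fun z hz => (ContMDiffAt.comp (g := κ) z (contMDiffAt_chart hz.2.1)
        (hfl z hz.1).1).contMDiffWithinAt) h hhs hhsymm hhnd
      (fun z hz u w => by
        have h1 := ((contMDiffAt_chart hz.2.1).mdifferentiableAt (by simp)).hasMFDerivAt.comp z
          ((hfl z hz.1).1.mdifferentiableAt (by simp)).hasMFDerivAt
        have h2 : mfderiv (𝓡 d) 𝓘(ℝ, EuclideanSpace ℝ (Fin d))
          (fun z => κ (flowMap v T t z)) z = _ := h1.mfderiv
        rw [h2, hhB _ hz.2.2]
        exact ((g t).chart_apply x' _ _ _).trans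
          ((chartForm_mfderiv_chart (g t).toFun hz.2.1 _ _).trans ((hfl z hz.1).2 u w)))
      y₂ (hclim.congr' (hev.mono fun τ hτ => by
        simp only [hback τ hτ, κ.right_inv (hcA τ hτ).1]))
    exact ⟨z, hz.mapClusterPt⟩
  exact hT (hM.mem_flowDomain_of_mapClusterPt
    ((contMDiffAt_chart_symm hy₂t).continuousAt.tendsto.comp hclim)
    (hev.mono fun τ hτ => (hcA τ hτ).2.1) hz hTcl)

theorem IsMetricFlow.mem_flowDomain (hM : IsMetricFlow g v)
    (hmax : ∀ t, MaximallyExtended (g t).toFun) (t s : ℝ) (x : W) : x ∈ flowDomain v t s := by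
  refine isPreconnected_univ.subset_of_closure_inter_subset (isOpen_setOf_mem_flowDomain t x)
    ⟨t, mem_univ _, hM.self_mem_flowDomain t x⟩ (fun σ₀ hσ₀ => ?_) (mem_univ s)
  obtain ⟨δ, hδ, hbox⟩ := hM.exists_box σ₀ x
  have hI : σ₀ ∈ Ioo (σ₀ - δ) (σ₀ + δ) := ⟨by linarith, by linarith⟩
  obtain ⟨σ, hσI, y, a, b, ht, hs, c, hc, rfl, rfl⟩ := mem_closure_iff.1 hσ₀.1 _ isOpen_Ioo hI
  have hclopen : IsClopen (flowDomain v σ σ₀) :=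
    ⟨hM.isClosed_flowDomain hmax σ σ₀, hM.isOpen_flowDomain σ σ₀⟩
  -- The flow line stays in one connected component.
  have hpre : IsPreconnected (c '' Ioo a b) := isPreconnected_Ioo.image c fun r hr =>
    (hc.continuousAt hr).continuousWithinAt
  have hmem : c σ ∈ flowDomain v σ σ₀ :=
    hclopen.connectedComponent_subset (hbox.self_of_nhds σ hσI σ₀ hI).1
      (hpre.subset_connectedComponent (mem_image_of_mem c ht) (mem_image_of_mem c hs))
  exact ⟨_, (hc.reach ht hs).trans hM.smooth_field (reach_flowMap hmem)⟩

/-- Metrics which are transported by a flow and are maximally extended at all times are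
diffeomorphic. -/
theorem IsMetricFlow.exists_diffeomorph (hM : IsMetricFlow g v)
    (hmax : ∀ t, MaximallyExtended (g t).toFun) (t s : ℝ) :
    ∃ D : W ≃ₘ^∞⟮𝓡 d, 𝓡 d⟯ W, ∀ (x : W) (u w : TangentSpace (𝓡 d) x),
      g t x u w = g s (D x) (mfderiv (𝓡 d) (𝓡 d) D x u) (mfderiv (𝓡 d) (𝓡 d) D x w) := by
  have hall := hM.mem_flowDomain hmax
  exact ⟨{ toFun := flowMap v t s
           invFun := flowMap v s t
           left_inv := fun x => hM.flowMap_flowMap (hall t s x)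
           right_inv := fun x => hM.flowMap_flowMap (hall s t x)
           contMDiff_toFun := fun x => (hM.isIsometryAt (hall t s x)).1
           contMDiff_invFun := fun x => (hM.isIsometryAt (hall s t x)).1 },
    fun x u w => ((hM.isIsometryAt (hall t s x)).2 u w).symm⟩

end Complete


/-! ### Finite gauge transformations -/

section GaugeFlow

variable {d : ℕ} {W : Type*} [TopologicalSpace W] [ChartedSpace (EuclideanSpace ℝ (Fin d)) W]
  [IsManifold (𝓡 d) ∞ W]

lemma chartField_smul (r : ℝ) (v : ∀ x : W, TangentSpace (𝓡 d) x) (x₀ : W) :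
    chartField (fun x => r • v x) x₀ = fun y => r • chartField v x₀ y :=
  funext fun y => map_smul (mfderiv (𝓡 d) 𝓘(ℝ, EuclideanSpace ℝ (Fin d)) (extChartAt (𝓡 d) x₀)
    ((extChartAt (𝓡 d) x₀).symm y)) r (v ((extChartAt (𝓡 d) x₀).symm y))

lemma lieDerivMetric_smul (r : ℝ) {v : ∀ x : W, TangentSpace (𝓡 d) x} (g : FormField d W) {x : W}
    (hv : DifferentiableAt ℝ (chartField v x) (extChartAt (𝓡 d) x x))
    (u w : EuclideanSpace ℝ (Fin d)) :
    lieDerivMetric (fun x => r • v x) g.toFun x u w = r * lieDerivMetric v g.toFun x u w := by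
  simp only [lieDerivMetric, chartField_smul, fderiv_fun_const_smul hv, ← g.chart_apply, map_smul,
    smul_apply, smul_eq_mul]
  ring

variable {m : ℕ} {M : Type*} [TopologicalSpace M] [T2Space M]
  [ChartedSpace (EuclideanSpace ℝ (Fin m)) M] [IsManifold (𝓡 m) ∞ M]
  {F : Type*} [NormedAddCommGroup F] [NormedSpace ℝ F]
  {E : M → Type*} [TopologicalSpace (TotalSpace F E)] [∀ x, TopologicalSpace (E x)]
  [∀ x, AddCommGroup (E x)] [∀ x, Module ℝ (E x)] [FiberBundle F E] [VectorBundle ℝ F E]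
  [FiniteDimensional ℝ F] [ContMDiffVectorBundle ∞ F E (𝓡 m)]
  {Φ : ℝ → FieldConfig d W m M F E} {ε : ∀ (t : ℝ) (x : W), E ((Φ t).base x)}

lemma IsGaugeFlow.contMDiff_base_time {L : LieAlgebroid m M F E} (hΦ : IsGaugeFlow L Φ ε) (x : W) :
    ContMDiff 𝓘(ℝ, ℝ) (𝓡 m) ∞ (fun s => (Φ s).base x) :=
  (contMDiff_proj E).comp (hΦ.smooth_field.comp
    (contMDiff_id.prodMk (contMDiff_const (c := (⟨x, 0⟩ : TangentBundle (𝓡 d) W)))))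

/-- Along a flow of gauge transformations the metric changes by `δ_ε g`. -/
lemma IsGaugeFlow.hasDerivAt_metric {L : LieAlgebroid m M F E} (hΦ : IsGaugeFlow L Φ ε)
    (S : SymTensor m M F E) {t : ℝ} (ht : t ∈ Icc (0 : ℝ) 1) (b : Frame m M F E) {x : W}
    (hb : (Φ t).base x ∈ b.dom) (u w : TangentSpace (𝓡 d) x) :
    HasDerivAt (fun s => (Φ s).metric S x u w) ((Φ t).metricVar L S (ε t) b x u w) t := by
  have hbase := hΦ.contMDiff_base_time x
  have hS : ∀ i j, HasDerivAt (fun s => S.comp b i j ((Φ s).base x))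
      (mvfderiv (𝓡 m) (S.comp b i j) ((Φ t).base x) (L.anchor ((Φ t).base x) (ε t x))) t := by
    intro i j
    have h1 := ((S.contMDiff_comp b i j).contMDiffAt.mdifferentiableAt (by simp)).hasMFDerivAt.comp
      t (hbase.contMDiffAt.mdifferentiableAt (by simp)).hasMFDerivAt
    have key : ∀ (A : ℝ →L[ℝ] ℝ) (r : ℝ),
        HasFDerivAt (fun s => S.comp b i j ((Φ s).base x)) A t → A 1 = r →
        HasDerivAt (fun s => S.comp b i j ((Φ s).base x)) r t := fun A r h e => e ▸ h.hasDerivAt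
    refine key _ _ h1.hasFDerivAt ?_
    exact congrArg (mfderiv (𝓡 m) 𝓘(ℝ, ℝ) (S.comp b i j) ((Φ t).base x)) (hΦ.deriv_base t ht x)
  have h2 := hasDerivAt_sum_mul_mul hS (fun i => hΦ.deriv_form t ht b x hb i u)
    (fun j => hΦ.deriv_form t ht b x hb j w)
  refine h2.congr_of_eventuallyEq ?_
  filter_upwards [hbase.continuous.continuousAt.preimage_mem_nhds (b.isOpen_dom.mem_nhds hb)]
    with s hs
  exact S.form_eq_sum b hs _ _

theorem gaugeActsByDiffeos (L : LieAlgebroid m M F E) (S : SymTensor m M F E)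
    (hrank : ∀ x : M, finrank ℝ (LinearMap.range (S.form x)) = d)
    (hinv : L.KernelInvariant S) : GaugeActsByDiffeos.{u} d L S := by
  rintro W _ _ _ _ _ φ₁ φ₂ ⟨Φ, ε, hΦ, rfl, rfl, hmet⟩
  -- Reparametrize time so that the family is defined and well behaved for all times.
  let τ : ℝ → ℝ := Real.smoothTransition
  have hτ : ContDiff ℝ ∞ τ := Real.smoothTransition.contDiff
  have hτI : ∀ t, τ t ∈ Icc (0 : ℝ) 1 := fun t =>
    ⟨Real.smoothTransition.nonneg t, Real.smoothTransition.le_one t⟩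
  let V : ℝ → ∀ x : W, TangentSpace (𝓡 d) x := fun t => (Φ t).inducedField S (ε t)
  let g : ℝ → FormField d W := fun t => (Φ (τ t)).metricLin S
  let v : ℝ → ∀ x : W, TangentSpace (𝓡 d) x := fun t x => (-deriv τ t) • V (τ t) x
  have hV : ∀ (x₀ : W) (t : ℝ), ∀ y ∈ (extChartAt (𝓡 d) x₀).target,
      ContDiffAt ℝ ∞ (fun q : ℝ × EuclideanSpace ℝ (Fin d) => chartField (V q.1) x₀ q.2)
        (τ t, y) := fun x₀ t y hy =>
    contDiffAt_family_inducedField hΦ.smooth_field hΦ.smooth_param S (hmet _ (hτI t)).1 hy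
  have hpair : ∀ (t : ℝ) (y : EuclideanSpace ℝ (Fin d)),
      ContDiffAt ℝ ∞ (fun q : ℝ × EuclideanSpace ℝ (Fin d) => (τ q.1, q.2)) (t, y) := fun t y =>
    (hτ.contDiffAt.comp (t, y) contDiffAt_fst).prodMk contDiffAt_snd
  have hM : IsMetricFlow g v :=
    { smooth_field := fun x₀ t y hy => by
        have h1 : ContDiffAt ℝ ∞ (fun q : ℝ × EuclideanSpace ℝ (Fin d) => -deriv τ q.1) (t, y) :=
          ((contDiff_infty_iff_deriv.1 hτ).2.contDiffAt.comp (t, y) contDiffAt_fst).neg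
        have h2 := h1.smul ((hV x₀ t y hy).comp (t, y) (hpair t y))
        refine h2.congr_of_eventuallyEq (Eventually.of_forall fun q => ?_)
        exact congrFun (chartField_smul (-deriv τ q.1) (V (τ q.1)) x₀) q.2
      smooth := fun x₀ u w t y hy =>
        ContDiffAt.comp (g := fun q : ℝ × EuclideanSpace ℝ (Fin d) =>
          chartForm ((Φ q.1).metric S) x₀ q.2 u w) (f := fun q => (τ q.1, q.2)) (t, y)
          (contDiffAt_family_chartForm hΦ.smooth_field S (τ t) hy u w) (hpair t y)
      symm := fun t x u w => S.symm _ _ _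
      nondegenerate := fun t => (hmet _ (hτI t)).1
      deriv := fun t x u w => by
        obtain ⟨b, hb⟩ := exists_frame (m := m) (F := F) (E := E) ((Φ (τ t)).base x)
        have hd : DifferentiableAt ℝ (chartField (V (τ t)) x) (extChartAt (𝓡 d) x x) :=
          ((hV x t _ (mem_extChartAt_target x)).comp (extChartAt (𝓡 d) x x)
            (contDiffAt_const.prodMk contDiffAt_id)).differentiableAt (by simp)
        have hεs : ContMDiff (𝓡 d) ((𝓡 m).prod 𝓘(ℝ, F)) ∞
            (fun x => (⟨(Φ (τ t)).base x, ε (τ t) x⟩ : TotalSpace F E)) :=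
          hΦ.smooth_param.comp (contMDiff_const.prodMk contMDiff_id)
        have h1 := (hΦ.hasDerivAt_metric S (hτI t) b hb u w).scomp t
          ((hτ.differentiable (by simp)) t).hasDerivAt
        refine h1.congr_deriv ?_
        rw [(Φ (τ t)).metricVar_eq_lieDerivMetric L S hrank hinv (hΦ.solution _ (hτI t))
          (hmet _ (hτI t)).1 (ε (τ t)) b hb
          (fun i => (b.contMDiffAt_comp i hεs.contMDiffAt hb).mdifferentiableAt (by simp)) hd u w]
        have h2 := lieDerivMetric_smul (-deriv τ t) (g t) hd u w
        refine Eq.trans ?_ (congrArg Neg.neg h2).symm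
        rw [neg_mul, neg_neg]
        rfl }
  obtain ⟨D, hD⟩ := hM.exists_diffeomorph (fun t => (hmet _ (hτI t)).2) 0 1
  have h0 : τ 0 = 0 := Real.smoothTransition.zero
  have h1 : τ 1 = 1 := Real.smoothTransition.one
  have hg0 : g 0 = (Φ 0).metricLin S := by simp only [g, h0]
  have hg1 : g 1 = (Φ 1).metricLin S := by simp only [g, h1]
  rw [hg0, hg1] at hD
  exact ⟨D, hD⟩

end GaugeFlow

end EGravity

end

theorem mainTheorem1
    {d m : ℕ} {M : Type*} [TopologicalSpace M] [T2Space M] [SecondCountableTopology M]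
    [ChartedSpace (EuclideanSpace ℝ (Fin m)) M] [IsManifold (𝓡 m) ∞ M]
    {F : Type*} [NormedAddCommGroup F] [NormedSpace ℝ F] [FiniteDimensional ℝ F]
    {E : M → Type*} [TopologicalSpace (TotalSpace F E)] [∀ x, TopologicalSpace (E x)]
    [∀ x, AddCommGroup (E x)] [∀ x, Module ℝ (E x)] [FiberBundle F E] [VectorBundle ℝ F E]
    [ContMDiffVectorBundle ∞ F E (𝓡 m)]
    (L : EGravity.LieAlgebroid m M F E) (S : EGravity.SymTensor m M F E)
    (hrank : ∀ x : M, finrank ℝ (LinearMap.range (S.form x)) = d)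
    (hinv : L.KernelInvariant S) :
    EGravity.IsReasonable.{u} d L S ∧
    EGravity.GaugeActsByDiffeosInfinitesimally.{u} d L S ∧
    EGravity.KernelGaugeActsTrivially.{u} d L S :=
  ⟨⟨EGravity.exists_nondegenerate_solution L S hrank,
    EGravity.gaugeActsByDiffeos L S hrank hinv⟩,
    EGravity.gaugeActsByDiffeosInfinitesimally L S hrank hinv,
    EGravity.kernelGaugeActsTrivially L S hrank hinv⟩
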